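/- **Setting.** Let $f:\mathbb{R}^d\to\mathbb{R}$ have minimizer $\theta^\star$, let $\xi$ be a random variable with values in a measurable space $\mathsf Z$ and law $\mathbb{P}_\xi$, and let $\nabla F(\theta,z)$ be a jointly measurable stochastic gradient with $\mathsf{E}[\nabla F(\theta,\xi)]=\nabla f(\theta)$ for every $\theta$. Let $p\ge 2$ be real, and assume the following. * *Strong convexity.* $f\in C^1$ and, for some $\mu>0$ and all $\theta,\theta'$, $\frac{\mu}{2}\|\theta-\theta'\|^2\le f(\theta)-f(\theta')-\langle\nabla f(\theta'),\theta-\theta'\rangle$. * *Smoothness.* $f\in C^4$, $\nabla f$ is $L_2$-Lipschitz, and $\|\nabla^3 f(\theta)\|\le L_3$, $\|\nabla^4 f(\theta)\|\le L_4$ for all $\theta$. * *Noise condition $A(3p)$.* For some $L_1>0$, all integers $2\le q\le 3p$ and all $\theta_1,\theta_2$, $$\mathsf{E}\|\nabla F(\theta_1,\xi)-\nabla F(\theta_2,\xi)\|^q\le L_1^{q-1}\|\theta_1-\theta_2\|^{q-2}\langle\nabla f(\theta_1)-\nabla f(\theta_2),\theta_1-\theta_2\rangle ,$$ and $\mathsf{E}^{1/q}\|\nabla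 F(\theta^\star,\xi)\|^q\le\tau_q<\infty$ for $q\in\{2,p,2p,3p\}$. Put $L=\max(L_1,L_2,L_3,L_4)$. For $s>0$ let $Q_s$ be the Markov kernel of $\theta\mapsto\theta-s\nabla F(\theta,\xi)$. * *Moment condition $C(3p)$, with the constants of the lower orders that it entails.* There are constants $\mathsf{C}=\mathsf{C}_{3p}\ge 2$ and $D_q\ge 2$, $q\in\{2,p,2p,3p\}$, such that for each of these $q$, every $s\in(0,1/(L\mathsf{C})]$, every initial law $\rho$ and every $k\ge 0$, $$\Bigl(\int\|\theta-\theta^\star\|^q\,\rho Q_s^k(d\theta)\Bigr)^{2/q}\le(1-s\mu)^k\Bigl(\int\|\theta-\theta^\star\|^q\,\rho(d\theta)\Bigr)^{2/q}+\frac{D_q s\tau_q^2}{\mu},$$ and $\bigl(\int\|\theta-\theta^\star\|^q\,\pi(d\theta)\bigr)^{2/q}\le D_q s\tau_q^2/\mu$ for every invariant probability measure $\pi$ of $Q_s$. Let $\xi_1,\xi_2,\dots$ be i.i.d. with law $\mathbb{P}_\xi$, independent of $\theta_0$, whose law is arbitrary. For $h\in\{\gamma,2\gamma\}$ let $\theta_0^{(h)}=\theta_0$,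 $\theta_{k+1}^{(h)}=\theta_k^{(h)}-h\nabla F(\theta_k^{(h)},\xi_{k+1})$ and $\bar\theta_n^{(h)}=\frac1n\sum_{k=n+1}^{2n}\theta_k^{(h)}$; let $\bar\theta_n^{(RR)}=2\bar\theta_n^{(\gamma)}-\bar\theta_n^{(2\gamma)}$. Write $H^\star=\nabla^2 f(\theta^\star)$ and $\Sigma^\star_\varepsilon=\mathsf{E}[\nabla F(\theta^\star,\xi)^{\otimes 2}]$. **Theorem.** There is an absolute constant $c_0>0$ such that in this setting, for every $\gamma>0$ with $2\gamma\le 1/(L\mathsf{C}_{3p})$ (so that both step sizes are admissible in the moment condition) and every integer $n\ge1$, $$\mathsf{E}^{1/p}\|H^\star(\bar\theta_n^{(RR)}-\theta^\star)\|^p\le c_0\Bigl(\frac{\sqrt{p\operatorname{Tr}\Sigma^\star_\varepsilon}}{\sqrt n}+\frac{p\,\tau_p}{n^{1-1/p}}+\frac{C_5}{n\sqrt\gamma}+\frac{C_6\sqrt\gamma}{\sqrt n}+C_7\gamma^{3/2}+\frac{C_8}{n}+\mathcal R_5\Bigr),$$ where $$C_5=\frac{D_p^{1/2}\tau_p}{\mu^{1/2}},\qquad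 C_6=\frac{L D_p^{1/2}p\,\tau_p}{\mu^{1/2}}+\frac{L D_{2p}\,p\,\tau_{2p}^2}{\mu^{3/2}},\qquad C_8=\frac{L D_{2p}\tau_{2p}}{\mu^2},$$ $$C_7=\Bigl(\frac{L^2D_2}{\sqrt\mu}+\frac{L\sqrt{D_2}}{\sqrt\mu}\Bigr)\frac{\tau_2^2}{\mu}+\frac{L}{\mu}+\frac{L D_{3p}^{3/2}\tau_{3p}^3}{\mu^{3/2}},$$ and $$\mathcal R_5=\Bigl(\frac{(1-\gamma\mu)^{(n+1)/2}}{\gamma n}+\frac{Lp(1-\gamma\mu)^{(n+1)/2}}{\mu^{1/2}\gamma^{1/2}n}\Bigr)\mathsf{E}^{1/p}\|\theta_0-\theta^\star\|^p+\frac{L(1-\gamma\mu)^{(n+1)/2}p^2}{\gamma\mu^2}\mathsf{E}^{1/p}\|\theta_0-\theta^\star\|^{2p}+\frac{L(1-\gamma\mu)^{3n/2}}{\gamma\mu}\mathsf{E}^{1/p}\|\theta_0-\theta^\star\|^{3p}$$ (the right-hand side is $+\infty$ if a moment of $\theta_0$ is infinite). -/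

import Mathlib

open MeasureTheory ProbabilityTheory
open scoped ENNReal

namespace RichardsonRomberg

noncomputable section

/-- The parameter space `ℝ^d` with its Euclidean norm. -/
abbrev Vec (d : ℕ) : Type := EuclideanSpace ℝ (Fin d)

/-- `E^r[‖X‖^q]`, i.e. `(E[‖X‖^q])^r`, with values in `[0, ∞]`. -/
def normMoment {Ω : Type*} [MeasurableSpace Ω] {d : ℕ} (P : Measure Ω) (X : Ω → Vec d)
    (q r : ℝ) : ℝ≥0∞ :=
  (∫⁻ ω, ‖X ω‖ₑ ^ q ∂P) ^ r

/-- `f` is continuously differentiable and `μ`-strongly convex on `ℝ^d`. -/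
structure StronglyConvex {d : ℕ} (f : Vec d → ℝ) (μ : ℝ) : Prop where
  pos : 0 < μ
  contDiff : ContDiff ℝ 1 f
  lower : ∀ x y : Vec d,
    μ / 2 * ‖x - y‖ ^ 2 ≤ f x - f y - inner ℝ (gradient f y) (x - y)

/-- `f` is four times continuously differentiable, has an `L₂`-Lipschitz gradient, and its third
and fourth derivatives are bounded by `L₃` and `L₄` (in operator norm). -/
structure SmoothBounded {d : ℕ} (f : Vec d → ℝ) (L₂ L₃ L₄ : ℝ) : Prop where
  nonneg₂ : 0 ≤ L₂
  nonneg₃ : 0 ≤ L₃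
  nonneg₄ : 0 ≤ L₄
  contDiff : ContDiff ℝ 4 f
  lipschitz : ∀ x y : Vec d, ‖gradient f x - gradient f y‖ ≤ L₂ * ‖x - y‖
  bound₃ : ∀ x : Vec d, ‖iteratedFDeriv ℝ 3 f x‖ ≤ L₃
  bound₄ : ∀ x : Vec d, ‖iteratedFDeriv ℝ 4 f x‖ ≤ L₄

/-- The stochastic gradient `g θ z` (for `∇F(θ, z)`), with noise distribution `ν`, is an unbiased
estimate of `∇f` and satisfies the co-coercivity inequality with constant `L₁` for every integer
exponent `2 ≤ q ≤ r`. -/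
structure NoiseCondition {d : ℕ} {Z : Type*} [MeasurableSpace Z] (f : Vec d → ℝ)
    (g : Vec d → Z → Vec d) (ν : Measure Z) (L₁ r : ℝ) : Prop where
  pos : 0 < L₁
  measurable : Measurable (fun x : Vec d × Z => g x.1 x.2)
  integrable : ∀ θ : Vec d, Integrable (g θ) ν
  unbiased : ∀ θ : Vec d, ∫ z, g θ z ∂ν = gradient f θ
  cocoercive : ∀ q : ℕ, 2 ≤ q → (q : ℝ) ≤ r → ∀ x y : Vec d,
    ∫⁻ z, ‖g x z - g y z‖ₑ ^ q ∂ν ≤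
      ENNReal.ofReal (L₁ ^ (q - 1) * ‖x - y‖ ^ (q - 2) *
        inner ℝ (gradient f x - gradient f y) (x - y))

/-- `τ` is a bound for `E^{1/q}[‖∇F(θ⋆, ξ)‖^q]`. -/
structure NoiseMomentBound {d : ℕ} {Z : Type*} [MeasurableSpace Z]
    (g : Vec d → Z → Vec d) (ν : Measure Z) (θs : Vec d) (q τ : ℝ) : Prop where
  nonneg : 0 ≤ τ
  bound : normMoment ν (g θs) q (1 / q) ≤ ENNReal.ofReal τ

/-- The action `ρ ↦ ρ Q_γ` of the Markov kernel of constant step-size SGD: the law of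
`θ - γ ∇F(θ, ξ)` for independent `θ ∼ ρ` and `ξ ∼ ν`. -/
def sgdStepLaw {d : ℕ} {Z : Type*} [MeasurableSpace Z] (g : Vec d → Z → Vec d) (ν : Measure Z)
    (γ : ℝ) (ρ : Measure (Vec d)) : Measure (Vec d) :=
  (ρ.prod ν).map (fun x => x.1 - γ • g x.1 x.2)

/-- The law `ρ Q_γ^k` of the `k`-th SGD iterate started from `ρ`. -/
def sgdLaw {d : ℕ} {Z : Type*} [MeasurableSpace Z] (g : Vec d → Z → Vec d) (ν : Measure Z)
    (γ : ℝ) (ρ : Measure (Vec d)) (k : ℕ) : Measure (Vec d) :=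
  (sgdStepLaw g ν γ)^[k] ρ

/-- The moment condition of order `q` with constants `D` (in front of the noise level) and `K`
(limiting the step size): for all step sizes `s ∈ (0, 1 / (L K)]` and all initial laws, the
`q`-th moment of the SGD iterates contracts geometrically up to the level `D s τ² / μ`, and
the invariant laws satisfy the corresponding bound. -/
structure MomentCondition {d : ℕ} {Z : Type*} [MeasurableSpace Z] (g : Vec d → Z → Vec d)
    (ν : Measure Z) (θs : Vec d) (μ L q τ K D : ℝ) : Prop where
  two_le_K : 2 ≤ K
  two_le_D : 2 ≤ D
  iterates : ∀ s : ℝ, 0 < s → s ≤ 1 / (L * K) →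
    ∀ ρ : Measure (Vec d), IsProbabilityMeasure ρ → ∀ k : ℕ,
      normMoment (sgdLaw g ν s ρ k) (fun θ => θ - θs) q (2 / q) ≤
        ENNReal.ofReal ((1 - s * μ) ^ k) * normMoment ρ (fun θ => θ - θs) q (2 / q) +
          ENNReal.ofReal (D * s * τ ^ 2 / μ)
  stationary : ∀ s : ℝ, 0 < s → s ≤ 1 / (L * K) →
    ∀ π : Measure (Vec d), IsProbabilityMeasure π → sgdStepLaw g ν s π = π →
      normMoment π (fun θ => θ - θs) q (2 / q) ≤ ENNReal.ofReal (D * s * τ ^ 2 / μ)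

/-- The SGD iterates `θ_{k+1} = θ_k - γ ∇F(θ_k, ξ_{k+1})`. -/
def sgd {d : ℕ} {Z : Type*} (g : Vec d → Z → Vec d) (γ : ℝ) (θ₀ : Vec d) (ξ : ℕ → Z) : ℕ → Vec d
  | 0 => θ₀
  | k + 1 => sgd g γ θ₀ ξ k - γ • g (sgd g γ θ₀ ξ k) (ξ (k + 1))

/-- The Polyak–Ruppert average `n⁻¹ ∑_{k=n+1}^{2n} θ_k`. -/
def prAverage {d : ℕ} {Z : Type*} (g : Vec d → Z → Vec d) (γ : ℝ) (θ₀ : Vec d) (ξ : ℕ → Z)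
    (n : ℕ) : Vec d :=
  (1 / (n : ℝ)) • ∑ k ∈ Finset.Icc (n + 1) (2 * n), sgd g γ θ₀ ξ k

/-- The Richardson–Romberg estimator, built from two chains with step sizes `γ` and `2γ` that are
driven by the same noise. -/
def rrEstimator {d : ℕ} {Z : Type*} (g : Vec d → Z → Vec d) (γ : ℝ) (θ₀ : Vec d) (ξ : ℕ → Z)
    (n : ℕ) : Vec d :=
  (2 : ℝ) • prAverage g γ θ₀ ξ n - prAverage g (2 * γ) θ₀ ξ n

/-- The Hessian `∇²f(θ)`, as a linear map. -/
def hessian {d : ℕ} (f : Vec d → ℝ) (θ : Vec d) : Vec d →L[ℝ] Vec d :=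
  fderiv ℝ (gradient f) θ

/-- The noise covariance `E[∇F(θ⋆, ξ) ⊗ ∇F(θ⋆, ξ)]`. -/
def noiseCov {d : ℕ} {Z : Type*} [MeasurableSpace Z] (g : Vec d → Z → Vec d) (ν : Measure Z)
    (θs : Vec d) : Matrix (Fin d) (Fin d) ℝ :=
  Matrix.of fun i j => ∫ z, g θs z i * g θs z j ∂ν

/-- The bias constant `C₁`. -/
def biasConst (μ L τ₂ D₂ : ℝ) : ℝ :=
  (L ^ 2 * D₂ / √μ + L * √D₂ / √μ) * (τ₂ ^ 2 / μ) + L / μ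

/-- The constant `C₅`. -/
def const₅ (p μ : ℝ) (τ D : ℝ → ℝ) : ℝ := √(D p) * τ p / √μ

/-- The constant `C₆`. -/
def const₆ (p μ L : ℝ) (τ D : ℝ → ℝ) : ℝ :=
  L * √(D p) * p * τ p / √μ + L * D (2 * p) * p * τ (2 * p) ^ 2 / μ ^ (3 / 2 : ℝ)

/-- The constant `C₇`. -/
def const₇ (p μ L : ℝ) (τ D : ℝ → ℝ) : ℝ :=
  biasConst μ L (τ 2) (D 2) +
    L * D (3 * p) ^ (3 / 2 : ℝ) * τ (3 * p) ^ 3 / μ ^ (3 / 2 : ℝ)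

/-- The constant `C₈`. -/
def const₈ (p μ L : ℝ) (τ D : ℝ → ℝ) : ℝ := L * D (2 * p) * τ (2 * p) / μ ^ 2

/-- The part of the bound that does not depend on the initial condition; `trCov` is the trace of
the noise covariance. -/
def mainTerms (p μ L γ : ℝ) (n : ℕ) (τ D : ℝ → ℝ) (trCov : ℝ) : ℝ :=
  √trCov * √p / √(n : ℝ) + p * τ p / (n : ℝ) ^ (1 - 1 / p) +
    const₅ p μ τ D / ((n : ℝ) * √γ) + const₆ p μ L τ D * √γ / √(n : ℝ) +
    const₇ p μ L τ D * γ ^ (3 / 2 : ℝ) + const₈ p μ L τ D / (n : ℝ)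

/-- The remainder `R₅`, which depends on the initial error `X = θ₀ - θ⋆` through its moments. -/
def remainder₅ {Ω : Type*} [MeasurableSpace Ω] {d : ℕ} (P : Measure Ω) (X : Ω → Vec d)
    (p μ L γ : ℝ) (n : ℕ) : ℝ≥0∞ :=
  ENNReal.ofReal ((1 - γ * μ) ^ (((n : ℝ) + 1) / 2) / (γ * n)) * normMoment P X p (1 / p) +
  ENNReal.ofReal (L * p * (1 - γ * μ) ^ (((n : ℝ) + 1) / 2) / (√μ * √γ * n)) *
    normMoment P X p (1 / p) +
  ENNReal.ofReal (L * (1 - γ * μ) ^ (((n : ℝ) + 1) / 2) * p ^ 2 / (γ * μ ^ 2)) *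
    normMoment P X (2 * p) (1 / p) +
  ENNReal.ofReal (L * (1 - γ * μ) ^ (3 / 2 * (n : ℝ)) / (γ * μ)) *
    normMoment P X (3 * p) (1 / p)

end

end RichardsonRomberg

open RichardsonRomberg

open MeasureTheory ProbabilityTheory
open scoped ENNReal
open RichardsonRomberg
set_option linter.unusedSectionVars false

namespace RichardsonRomberg

/-! ### Second-order expansion of the `p`-th power of a Hilbert norm. -/

section PowerInequalities

/-! Write `e_k = θ_k - θs` and `H` for the Hessian at `θs`. Each stochastic gradient splits into the
noise `g θs ξ`, a martingale increment and the full gradient, and the latter into `H e_k` and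
`nonlinPart`. Summing the recursion over the averaging window therefore expresses `H ∑ e_k` through
a boundary term divided by the step, a martingale, the noise sum and the sum of the nonlinear parts
(`hessian_sum_eq`).

The noise sum is common to both chains, so in the combination `2 (γ) - (2γ)` it has weight one; a
Rosenthal inequality in Hilbert space (`LpLe.sum_rosenthal`) turns it into the two leading terms.
The boundary gives `const₅`; the martingale, through a Burkholder-type inequality with constant of
order `√p` (`LpLe.sum_of_orthogonal`), gives the first half of `const₆`. Both inequalities rest on
the 2-smoothness estimate `norm_add_rpow_le`. The sizes of `e_k` come from the moment condition,
recorded as `level`.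

The nonlinear part is the quadratic form `quadPart` plus a cubic remainder, which is bounded by
moments of order `3p` and lands in `const₇`. The quadratic part is compared with its mean. The SGD
kernel contracts functions whose Lipschitz constant grows linearly (`QuadLip.kernelOp`), so along
every `m`-th iterate, `m` of order `1 / (γ μ)`, the Poisson equation has solutions of bounded size
and yields a martingale; adding the `m` residue classes gives fluctuations of order `√(n / (γ μ))`
(`lpLe_chain_sum_sub`), the second half of `const₆`.

Extrapolation acts on the mean of the quadratic part. For a test vector `v` let `X` be the symmetric
solution of `H X + X H = ∇³f(θs) v`. One step changes the mean of `⟨e, X e⟩` by `-2h ⟨quadPart, v⟩ +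
h² E ⟨g θs, X (g θs)⟩` up to higher order. After telescoping, the mean of `⟨quadPart, v⟩` is `h c`
with `c` independent of the step (`exists_mean_bias`), and `2 γ c - (2γ) c = 0`
(`norm_mean_extrapolation_le`).

The errors must not carry an extra factor `√(L / μ)`. Two discriminant arguments ensure this:
`abs_inner_third_le`, which bounds `X`, and `gradient_remainder_sq_le`, which bounds the nonlinear
part by the dissipation of the mean squared error. Windows with `n γ μ < 1` need only a crude bound,
and the transient of order `2p` is interpolated between orders `p` and `3p`. -/

theorem rpow_sub_rpow_mul_le {a b t : ℝ} (ha : 0 ≤ a) (hab : a ≤ b) (ht : 0 ≤ t) :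
    (b ^ t - a ^ t) * b ≤ max 1 t * b ^ t * (b - a) := by
  rcases (ha.trans hab).eq_or_lt with hb | hb
  · have : a = 0 := le_antisymm (hab.trans hb.symm.le) ha
    simp [← hb, this]
  have hx0 : 0 ≤ a / b := by positivity
  have hx1 : a / b ≤ 1 := (div_le_one hb).2 hab
  -- By homogeneity only the ratio `a / b` matters: Bernoulli for `t ≥ 1`, and `x ≤ x ^ t` on `[0,
  -- 1]` for `t ≤ 1`.
  have key : 1 - (a / b) ^ t ≤ max 1 t * (1 - a / b) := by
    rcases le_total 1 t with h | h
    · have := one_add_mul_self_le_rpow_one_add (s := a / b - 1) (by linarith) h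
      rw [max_eq_right h]
      have e : 1 + (a / b - 1) = a / b := by ring
      rw [e] at this
      linarith
    · have := Real.rpow_le_rpow_of_exponent_ge' hx0 hx1 ht h
      rw [Real.rpow_one] at this
      rw [max_eq_left h]
      linarith
  have e1 : (b ^ t - a ^ t) * b = b ^ t * b * (1 - (a / b) ^ t) := by
    rw [Real.div_rpow ha hb.le]
    have : b ^ t ≠ 0 := (Real.rpow_pos_of_pos hb t).ne'
    field_simp
  have e2 : max 1 t * b ^ t * (b - a) = b ^ t * b * (max 1 t * (1 - a / b)) := by
    field_simp
  rw [e1, e2]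
  gcongr

/-- The convex function `s ↦ s ^ (p / 2)` lies above its tangent at `s = w ^ 2`; evaluate at `u ^
2`. -/
theorem rpow_le_rpow_add_tangent {u w p : ℝ} (hu : 0 ≤ u) (hw : 0 ≤ w) (hp : 2 ≤ p) :
    w ^ p ≤ u ^ p + p / 2 * w ^ (p - 2) * (w ^ 2 - u ^ 2) := by
  rcases hw.eq_or_lt with h | h
  · rw [← h, Real.zero_rpow (by linarith)]
    rcases hp.eq_or_lt with h2 | h2
    · simp [← h2]
    · rw [Real.zero_rpow (by linarith)]
      have := Real.rpow_nonneg hu p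
      simpa using this
  have hb := one_add_mul_self_le_rpow_one_add (s := u ^ 2 / w ^ 2 - 1) (p := p / 2)
    (by have : 0 ≤ u ^ 2 / w ^ 2 := by positivity
        linarith) (by linarith)
  have e : (1 + (u ^ 2 / w ^ 2 - 1)) ^ (p / 2) = u ^ p / w ^ p := by
    rw [add_sub_cancel, Real.div_rpow (by positivity) (by positivity), ← Real.rpow_natCast_mul hu,
      ← Real.rpow_natCast_mul hw]
    congr 2 <;> (push_cast; ring)
  rw [e, le_div_iff₀ (Real.rpow_pos_of_pos h p)] at hb
  have e2 : w ^ p = w ^ (p - 2) * w ^ 2 := by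
    rw [← Real.rpow_natCast w 2, ← Real.rpow_add h]
    congr 1; push_cast; ring
  have e3 : (1 + p / 2 * (u ^ 2 / w ^ 2 - 1)) * w ^ p
      = w ^ p - p / 2 * w ^ (p - 2) * (w ^ 2 - u ^ 2) := by
    rw [e2]; field_simp; ring
  linarith

/-- Convexity bounds `‖s + d‖ ^ p` from above by the tangent taken at the endpoint `s + d`.
Replacing the slope `‖s + d‖ ^ (p - 2)` by `‖s‖ ^ (p - 2)` costs only a second-order term, because
the two differences in `hcross` are each of first order in `d`. The remaining linear term has a
coefficient depending on `s` alone, so it integrates to zero when `d` is centred given `s`. -/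
theorem norm_add_rpow_le {E : Type*} [NormedAddCommGroup E] [InnerProductSpace ℝ E] {p : ℝ}
    (hp : 2 ≤ p) (s d : E) :
    ‖s + d‖ ^ p ≤ ‖s‖ ^ p + p * (‖s‖ ^ (p - 2) * inner ℝ s d)
      + p ^ 2 * (‖d‖ ^ 2 * (‖s‖ + ‖d‖) ^ (p - 2)) := by
  set u := ‖s‖
  set w := ‖s + d‖
  set M := u + ‖d‖
  have hu : 0 ≤ u := norm_nonneg _
  have hw : 0 ≤ w := norm_nonneg _
  have hd : 0 ≤ ‖d‖ := norm_nonneg _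
  have huM : u ≤ M := by simp [M]
  have hwM : w ≤ M := norm_add_le _ _
  have hwu : |w - u| ≤ ‖d‖ := by
    have := abs_norm_sub_norm_le (s + d) s
    simpa [w, u] using this
  have hsq : w ^ 2 - u ^ 2 = 2 * inner ℝ s d + ‖d‖ ^ 2 := by
    simp only [w, u, norm_add_sq_real]; ring
  have ht : 0 ≤ p - 2 := by linarith
  have hMt : 0 ≤ M ^ (p - 2) := by positivity
  have hcross : (w ^ (p - 2) - u ^ (p - 2)) * (w ^ 2 - u ^ 2)
      ≤ 2 * max 1 (p - 2) * M ^ (p - 2) * ‖d‖ ^ 2 := by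
    have main : ∀ a b : ℝ, 0 ≤ a → a ≤ b → b ≤ M → b - a ≤ ‖d‖ →
        (b ^ (p - 2) - a ^ (p - 2)) * (b ^ 2 - a ^ 2)
          ≤ 2 * max 1 (p - 2) * M ^ (p - 2) * ‖d‖ ^ 2 := by
      intro a b ha hab hbM hbd
      have hb : 0 ≤ b := ha.trans hab
      have h1 := rpow_sub_rpow_mul_le ha hab ht
      have h2 : 0 ≤ b ^ (p - 2) - a ^ (p - 2) :=
        sub_nonneg.2 (Real.rpow_le_rpow ha hab ht)
      have hm : 0 ≤ max 1 (p - 2) := le_trans zero_le_one (le_max_left _ _)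
      calc (b ^ (p - 2) - a ^ (p - 2)) * (b ^ 2 - a ^ 2)
          = (b ^ (p - 2) - a ^ (p - 2)) * (b + a) * (b - a) := by ring
        _ ≤ (b ^ (p - 2) - a ^ (p - 2)) * (2 * b) * (b - a) := by
            have : 0 ≤ b - a := by linarith
            gcongr; linarith
        _ = 2 * ((b ^ (p - 2) - a ^ (p - 2)) * b) * (b - a) := by ring
        _ ≤ 2 * (max 1 (p - 2) * b ^ (p - 2) * (b - a)) * (b - a) := by
            have : 0 ≤ b - a := by linarith
            gcongr
        _ = 2 * max 1 (p - 2) * b ^ (p - 2) * (b - a) ^ 2 := by ring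
        _ ≤ _ := by
            have : 0 ≤ b - a := by linarith
            gcongr
    rcases le_total u w with h | h
    · exact main u w hu h hwM ((le_abs_self _).trans hwu)
    · have := main w u hw h huM (by rw [abs_sub_comm] at hwu; exact (le_abs_self _).trans hwu)
      linarith [this]
  have h1 := rpow_le_rpow_add_tangent hu hw hp
  have h2 : u ^ (p - 2) * ‖d‖ ^ 2 ≤ M ^ (p - 2) * ‖d‖ ^ 2 := by gcongr
  have hcoef : p / 2 + p * max 1 (p - 2) ≤ p ^ 2 := by
    rcases le_total 1 (p - 2) with h | h
    · rw [max_eq_right h]; nlinarith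
    · rw [max_eq_left h]; nlinarith
  have h3 : p / 2 * w ^ (p - 2) * (w ^ 2 - u ^ 2)
      = p / 2 * ((w ^ (p - 2) - u ^ (p - 2)) * (w ^ 2 - u ^ 2))
        + p * (u ^ (p - 2) * inner ℝ s d) + p / 2 * (u ^ (p - 2) * ‖d‖ ^ 2) := by
    rw [hsq]; ring
  have h4 : p / 2 * ((w ^ (p - 2) - u ^ (p - 2)) * (w ^ 2 - u ^ 2))
      ≤ p / 2 * (2 * max 1 (p - 2) * M ^ (p - 2) * ‖d‖ ^ 2) := by gcongr
  have h5 : p / 2 * (u ^ (p - 2) * ‖d‖ ^ 2) ≤ p / 2 * (M ^ (p - 2) * ‖d‖ ^ 2) := by gcongr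
  have h6 : (p / 2 + p * max 1 (p - 2)) * (M ^ (p - 2) * ‖d‖ ^ 2)
      ≤ p ^ 2 * (M ^ (p - 2) * ‖d‖ ^ 2) := by gcongr
  nlinarith

end PowerInequalities

/-! ### Calculus of `L^p` norm bounds with explicit real constants. -/

section LpBounds

variable {Ω : Type*} [MeasurableSpace Ω]

/-- `X` is in `L^q` with norm at most `A`. -/
structure LpLe {E : Type*} [NormedAddCommGroup E] (P : Measure Ω) (q : ℝ) (X : Ω → E) (A : ℝ) :
    Prop where
  meas : AEStronglyMeasurable X P
  nonneg : 0 ≤ A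
  le : eLpNorm X (ENNReal.ofReal q) P ≤ ENNReal.ofReal A

variable {P : Measure Ω} {E F : Type*} [NormedAddCommGroup E] [NormedAddCommGroup F]
  {q A B : ℝ} {X Y : Ω → E}

theorem LpLe.memLp (h : LpLe P q X A) : MemLp X (ENNReal.ofReal q) P :=
  ⟨h.meas, h.le.trans_lt ENNReal.ofReal_lt_top⟩

theorem LpLe.weaken (h : LpLe P q X A) (hAB : A ≤ B) : LpLe P q X B :=
  ⟨h.meas, h.nonneg.trans hAB, h.le.trans (ENNReal.ofReal_le_ofReal hAB)⟩

theorem LpLe.add (hX : LpLe P q X A) (hY : LpLe P q Y B) (hq : 1 ≤ q) :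
    LpLe P q (fun ω => X ω + Y ω) (A + B) := by
  refine ⟨hX.meas.add hY.meas, add_nonneg hX.nonneg hY.nonneg, ?_⟩
  rw [ENNReal.ofReal_add hX.nonneg hY.nonneg]
  exact (eLpNorm_add_le hX.meas hY.meas (by simpa using hq)).trans (add_le_add hX.le hY.le)

theorem LpLe.neg (hX : LpLe P q X A) : LpLe P q (fun ω => -X ω) A := by
  refine ⟨hX.meas.neg, hX.nonneg, ?_⟩
  have := eLpNorm_neg X (ENNReal.ofReal q) P
  exact (le_of_eq this).trans hX.le

theorem LpLe.sub (hX : LpLe P q X A) (hY : LpLe P q Y B) (hq : 1 ≤ q) :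
    LpLe P q (fun ω => X ω - Y ω) (A + B) := by
  simpa only [sub_eq_add_neg] using hX.add hY.neg hq

theorem LpLe.const_smul [NormedSpace ℝ E] (hX : LpLe P q X A) (c : ℝ) :
    LpLe P q (fun ω => c • X ω) (|c| * A) := by
  refine ⟨hX.meas.const_smul c, mul_nonneg (abs_nonneg _) hX.nonneg, ?_⟩
  have := eLpNorm_const_smul c X (ENNReal.ofReal q) P
  refine (le_of_eq this).trans ?_
  rw [ENNReal.ofReal_mul (abs_nonneg _), ← Real.norm_eq_abs, ofReal_norm]
  gcongr
  exact hX.le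

theorem LpLe.zero : LpLe P q (fun _ => (0 : E)) 0 :=
  ⟨aestronglyMeasurable_const, le_rfl, by simp⟩

theorem LpLe.sum {ι : Type*} (s : Finset ι) {X : ι → Ω → E} {A : ι → ℝ}
    (h : ∀ i ∈ s, LpLe P q (X i) (A i)) (hq : 1 ≤ q) :
    LpLe P q (fun ω => ∑ i ∈ s, X i ω) (∑ i ∈ s, A i) := by
  classical
  induction s using Finset.induction_on with
  | empty => simpa using LpLe.zero
  | insert a s ha ih =>
    simp only [Finset.sum_insert ha]
    exact (h a (by simp)).add (ih fun i hi => h i (by simp [hi])) hq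

theorem LpLe.mono {X : Ω → E} {Y : Ω → F} (hY : LpLe P q Y A) (hX : AEStronglyMeasurable X P)
    (h : ∀ ω, ‖X ω‖ ≤ ‖Y ω‖) : LpLe P q X A :=
  ⟨hX, hY.nonneg, (eLpNorm_mono h).trans hY.le⟩

theorem LpLe.const [IsProbabilityMeasure P] (c : E) : LpLe P q (fun _ => c) ‖c‖ := by
  refine ⟨aestronglyMeasurable_const, norm_nonneg _, ?_⟩
  rcases le_or_gt q 0 with h | h
  · simp [ENNReal.ofReal_of_nonpos h]
  · rw [eLpNorm_const _ (by simpa using h) (IsProbabilityMeasure.ne_zero P)]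
    simp

theorem LpLe.norm (hX : LpLe P q X A) : LpLe P q (fun ω => ‖X ω‖) A :=
  hX.mono hX.meas.norm (by simp)

theorem LpLe.exponent_mono [IsProbabilityMeasure P] {r : ℝ} (hX : LpLe P q X A) (h : r ≤ q) :
    LpLe P r X A :=
  ⟨hX.meas, hX.nonneg,
    (eLpNorm_le_eLpNorm_of_exponent_le (ENNReal.ofReal_le_ofReal h) hX.meas).trans hX.le⟩

theorem eLpNorm_ofReal_eq (hq : 0 < q) (X : Ω → E) :
    eLpNorm X (ENNReal.ofReal q) P = (∫⁻ ω, ‖X ω‖ₑ ^ q ∂P) ^ (1 / q) := by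
  rw [eLpNorm_eq_lintegral_rpow_enorm_toReal (by simpa using hq) ENNReal.ofReal_ne_top,
    ENNReal.toReal_ofReal hq.le]

theorem LpLe.lintegral_le (hX : LpLe P q X A) (hq : 0 < q) :
    ∫⁻ ω, ‖X ω‖ₑ ^ q ∂P ≤ ENNReal.ofReal (A ^ q) := by
  have := hX.le
  rw [eLpNorm_ofReal_eq hq, one_div, ENNReal.rpow_inv_le_iff hq,
    ENNReal.ofReal_rpow_of_nonneg hX.nonneg hq.le] at this
  exact this

theorem LpLe.of_lintegral (hX : AEStronglyMeasurable X P) (hq : 0 < q) (hA : 0 ≤ A)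
    (h : ∫⁻ ω, ‖X ω‖ₑ ^ q ∂P ≤ ENNReal.ofReal (A ^ q)) : LpLe P q X A := by
  refine ⟨hX, hA, ?_⟩
  rw [eLpNorm_ofReal_eq hq, one_div, ENNReal.rpow_inv_le_iff hq,
    ENNReal.ofReal_rpow_of_nonneg hA hq.le]
  exact h

theorem LpLe.integrable_rpow (hX : LpLe P q X A) (hq : 0 < q) :
    Integrable (fun ω => ‖X ω‖ ^ q) P := by
  have := hX.memLp.integrable_norm_rpow (by simpa using hq) ENNReal.ofReal_ne_top
  rwa [ENNReal.toReal_ofReal hq.le] at this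

theorem enorm_rpow_eq_ofReal (hq : 0 ≤ q) (x : E) : ‖x‖ₑ ^ q = ENNReal.ofReal (‖x‖ ^ q) := by
  rw [← ofReal_norm, ENNReal.ofReal_rpow_of_nonneg (norm_nonneg _) hq]

theorem LpLe.integral_rpow_le (hX : LpLe P q X A) (hq : 0 < q) :
    ∫ ω, ‖X ω‖ ^ q ∂P ≤ A ^ q := by
  have h := hX.lintegral_le hq
  rw [integral_eq_lintegral_of_nonneg_ae (Filter.Eventually.of_forall fun ω => by positivity)
    (hX.integrable_rpow hq).aestronglyMeasurable]
  simp only [enorm_rpow_eq_ofReal hq.le] at h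
  exact ENNReal.toReal_le_of_le_ofReal (Real.rpow_nonneg hX.nonneg _) h

theorem LpLe.of_integral (hX : AEStronglyMeasurable X P) (hq : 0 < q) (hA : 0 ≤ A)
    (hi : Integrable (fun ω => ‖X ω‖ ^ q) P) (h : ∫ ω, ‖X ω‖ ^ q ∂P ≤ A ^ q) :
    LpLe P q X A := by
  refine .of_lintegral hX hq hA ?_
  simp only [enorm_rpow_eq_ofReal hq.le]
  rw [← ofReal_integral_eq_lintegral_ofReal hi (Filter.Eventually.of_forall fun ω => by positivity)]
  exact ENNReal.ofReal_le_ofReal h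

theorem LpLe.norm_rpow (hX : LpLe P q X A) {r : ℝ} (hr : 0 < r) (hq : 0 < q) :
    LpLe P (q / r) (fun ω => ‖X ω‖ ^ r) (A ^ r) := by
  refine .of_lintegral (hX.meas.norm.aemeasurable.pow_const r).aestronglyMeasurable (by positivity)
    (Real.rpow_nonneg hX.nonneg _) ?_
  have h := hX.lintegral_le hq
  rw [← Real.rpow_mul hX.nonneg, mul_div_cancel₀ _ hr.ne']
  convert h using 3 with ω
  rw [enorm_rpow_eq_ofReal hq.le, enorm_rpow_eq_ofReal (by positivity), Real.norm_eq_abs,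
    abs_of_nonneg (by positivity), ← Real.rpow_mul (norm_nonneg _), mul_div_cancel₀ _ hr.ne']

theorem LpLe.norm_pow (hX : LpLe P q X A) {r : ℕ} (hr : 0 < r) (hq : 0 < q) :
    LpLe P (q / r) (fun ω => ‖X ω‖ ^ r) (A ^ r) := by
  have := hX.norm_rpow (r := r) (by exact_mod_cast hr) hq
  simpa only [Real.rpow_natCast] using this

/-- Hölder's inequality. -/
theorem LpLe.norm_mul_norm {a b : ℝ} {X : Ω → E} {Y : Ω → F} (hX : LpLe P a X A)
    (hY : LpLe P b Y B) (ha : 0 < a) (hb : 0 < b) (hq : 0 < q) (h : 1 / a + 1 / b = 1 / q) :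
    LpLe P q (fun ω => ‖X ω‖ * ‖Y ω‖) (A * B) := by
  refine .of_lintegral (hX.meas.norm.mul hY.meas.norm) hq (mul_nonneg hX.nonneg hY.nonneg) ?_
  have e : q / a + q / b = 1 := by
    have : q * (1 / a + 1 / b) = q * (1 / q) := by rw [h]
    field_simp at this ⊢
    linarith
  have hol := ENNReal.lintegral_mul_norm_pow_le (μ := P) (f := fun ω => ‖X ω‖ₑ ^ a)
    (g := fun ω => ‖Y ω‖ₑ ^ b) (hX.meas.enorm.pow_const a) (hY.meas.enorm.pow_const b)
    (p := q / a) (q := q / b) (by positivity) (by positivity) e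
  simp only [← ENNReal.rpow_mul, mul_div_cancel₀ _ ha.ne', mul_div_cancel₀ _ hb.ne'] at hol
  have h1 := hX.lintegral_le ha
  have h2 := hY.lintegral_le hb
  calc ∫⁻ ω, ‖‖X ω‖ * ‖Y ω‖‖ₑ ^ q ∂P = ∫⁻ ω, ‖X ω‖ₑ ^ q * ‖Y ω‖ₑ ^ q ∂P := by
        congr 1; ext ω
        rw [← ENNReal.mul_rpow_of_nonneg _ _ hq.le, enorm_mul, enorm_norm, enorm_norm]
    _ ≤ _ := hol
    _ ≤ ENNReal.ofReal (A ^ a) ^ (q / a) * ENNReal.ofReal (B ^ b) ^ (q / b) := by gcongr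
    _ = _ := by
        rw [ENNReal.ofReal_rpow_of_nonneg (Real.rpow_nonneg hX.nonneg _) (by positivity),
          ENNReal.ofReal_rpow_of_nonneg (Real.rpow_nonneg hY.nonneg _) (by positivity),
          ← Real.rpow_mul hX.nonneg, ← Real.rpow_mul hY.nonneg, mul_div_cancel₀ _ ha.ne',
          mul_div_cancel₀ _ hb.ne', ← ENNReal.ofReal_mul (Real.rpow_nonneg hX.nonneg _),
          ← Real.mul_rpow hX.nonneg hY.nonneg]

theorem LpLe.integrable [IsProbabilityMeasure P] (hX : LpLe P q X A) (hq : 1 ≤ q) :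
    Integrable X P :=
  hX.memLp.integrable (by simpa using hq)

theorem LpLe.integral_norm_le [IsProbabilityMeasure P] (hX : LpLe P q X A) (hq : 1 ≤ q) :
    ∫ ω, ‖X ω‖ ∂P ≤ A := by
  have := (hX.exponent_mono hq).integral_rpow_le one_pos
  simpa using this

theorem LpLe.integral_sq_le [IsProbabilityMeasure P] (hX : LpLe P q X A) (hq : 2 ≤ q) :
    ∫ ω, ‖X ω‖ ^ 2 ∂P ≤ A ^ 2 := by
  have := (hX.exponent_mono hq).integral_rpow_le two_pos
  simpa using this

theorem LpLe.norm_integral_le [NormedSpace ℝ E] [IsProbabilityMeasure P] (hX : LpLe P q X A)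
    (hq : 1 ≤ q) : ‖∫ ω, X ω ∂P‖ ≤ A :=
  (MeasureTheory.norm_integral_le_integral_norm X).trans (hX.integral_norm_le hq)

theorem LpLe.sub_integral [NormedSpace ℝ E] [IsProbabilityMeasure P]
    (hX : LpLe P q X A) (hq : 1 ≤ q) :
    LpLe P q (fun ω => X ω - ∫ ω', X ω' ∂P) (2 * A) :=
  (hX.sub (LpLe.const (∫ ω', X ω' ∂P)) hq).weaken (by linarith [hX.norm_integral_le hq])

end LpBounds

/-! ### Burkholder-type inequality in `L^p` of a Hilbert space. -/

section Smoothness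

/-- Bounded by `e`: enlarging a quantity by the relative amount `1 / p` changes its power `p - 2` by
a bounded factor. This is the threshold in all case splits below. -/
theorem one_add_inv_rpow_le {p : ℝ} (hp : 2 ≤ p) : (1 + 1 / p) ^ (p - 2) ≤ 3 := by
  have h0 : 0 < p := by linarith
  have h1 : 1 + 1 / p ≤ Real.exp (1 / p) := by
    have := Real.add_one_le_exp (1 / p)
    linarith
  calc (1 + 1 / p) ^ (p - 2) ≤ Real.exp (1 / p) ^ (p - 2) :=
        Real.rpow_le_rpow (by positivity) h1 (by linarith)
    _ = Real.exp (1 / p * (p - 2)) := (Real.exp_mul _ _).symm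
    _ ≤ Real.exp 1 := by
        apply Real.exp_le_exp.2
        rw [one_div, inv_mul_le_iff₀ h0]
        linarith
    _ ≤ 3 := by linarith [Real.exp_one_lt_d9]

variable {Ω : Type*} [MeasurableSpace Ω] {P : Measure Ω}

section Holder

variable {E F : Type*} [NormedAddCommGroup E] [NormedAddCommGroup F]

/-- Hölder with weights `a / p` and `b / p`. A zero weight is allowed, so the exponent `p - 2` may
be used at `p = 2`. -/
theorem LpLe.lintegral_rpow_mul_rpow_le {p A B a b : ℝ} {X : Ω → E} {Y : Ω → F}
    (hX : LpLe P p X A) (hY : LpLe P p Y B) (hp : 0 < p) (ha : 0 ≤ a) (hb : 0 ≤ b)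
    (hab : a + b = p) :
    ∫⁻ ω, ENNReal.ofReal (‖X ω‖ ^ a * ‖Y ω‖ ^ b) ∂P ≤ ENNReal.ofReal (A ^ a * B ^ b) := by
  have hol := ENNReal.lintegral_mul_norm_pow_le (μ := P) (f := fun ω => ‖X ω‖ₑ ^ p)
    (g := fun ω => ‖Y ω‖ₑ ^ p) (hX.meas.enorm.pow_const p) (hY.meas.enorm.pow_const p)
    (p := a / p) (q := b / p) (by positivity) (by positivity) (by field_simp; exact hab)
  simp only [← ENNReal.rpow_mul, mul_div_cancel₀ _ hp.ne'] at hol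
  have h1 := hX.lintegral_le hp
  have h2 := hY.lintegral_le hp
  calc ∫⁻ ω, ENNReal.ofReal (‖X ω‖ ^ a * ‖Y ω‖ ^ b) ∂P = ∫⁻ ω, ‖X ω‖ₑ ^ a * ‖Y ω‖ₑ ^ b ∂P := by
        congr 1; ext ω
        rw [ENNReal.ofReal_mul (by positivity), enorm_rpow_eq_ofReal ha, enorm_rpow_eq_ofReal hb]
    _ ≤ _ := hol
    _ ≤ ENNReal.ofReal (A ^ p) ^ (a / p) * ENNReal.ofReal (B ^ p) ^ (b / p) := by gcongr
    _ = _ := by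
        rw [ENNReal.ofReal_rpow_of_nonneg (Real.rpow_nonneg hX.nonneg _) (by positivity),
          ENNReal.ofReal_rpow_of_nonneg (Real.rpow_nonneg hY.nonneg _) (by positivity),
          ← Real.rpow_mul hX.nonneg, ← Real.rpow_mul hY.nonneg, mul_div_cancel₀ _ hp.ne',
          mul_div_cancel₀ _ hp.ne', ← ENNReal.ofReal_mul (Real.rpow_nonneg hX.nonneg _)]

theorem LpLe.integrable_rpow_mul_rpow {p A B a b : ℝ} {X : Ω → E} {Y : Ω → F}
    (hX : LpLe P p X A) (hY : LpLe P p Y B) (hp : 0 < p) (ha : 0 ≤ a) (hb : 0 ≤ b)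
    (hab : a + b = p) : Integrable (fun ω => ‖X ω‖ ^ a * ‖Y ω‖ ^ b) P := by
  refine ⟨((hX.meas.norm.aemeasurable.pow_const a).mul
    (hY.meas.norm.aemeasurable.pow_const b)).aestronglyMeasurable, ?_⟩
  rw [hasFiniteIntegral_iff_ofReal (Filter.Eventually.of_forall fun ω => by positivity)]
  exact (hX.lintegral_rpow_mul_rpow_le hY hp ha hb hab).trans_lt ENNReal.ofReal_lt_top

theorem LpLe.integral_rpow_mul_rpow_le {p A B a b : ℝ} {X : Ω → E} {Y : Ω → F}
    (hX : LpLe P p X A) (hY : LpLe P p Y B) (hp : 0 < p) (ha : 0 ≤ a) (hb : 0 ≤ b)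
    (hab : a + b = p) : ∫ ω, ‖X ω‖ ^ a * ‖Y ω‖ ^ b ∂P ≤ A ^ a * B ^ b := by
  rw [integral_eq_lintegral_of_nonneg_ae (Filter.Eventually.of_forall fun ω => by positivity)
    (hX.integrable_rpow_mul_rpow hY hp ha hb hab).aestronglyMeasurable]
  exact ENNReal.toReal_le_of_le_ofReal
    (mul_nonneg (Real.rpow_nonneg hX.nonneg _) (Real.rpow_nonneg hY.nonneg _))
    (hX.lintegral_rpow_mul_rpow_le hY hp ha hb hab)

theorem LpLe.integrable_sq_mul_rpow {p A B : ℝ} {s d : Ω → E} (hp : 2 ≤ p)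
    (hs : LpLe P p s A) (hd : LpLe P p d B) :
    Integrable (fun ω => ‖d ω‖ ^ 2 * (‖s ω‖ + ‖d ω‖) ^ (p - 2)) P := by
  have h := hd.integrable_rpow_mul_rpow (hs.norm.add hd.norm (by linarith)) (by linarith)
    (a := 2) (b := p - 2) (by linarith) (by linarith) (by ring)
  refine h.congr (Filter.Eventually.of_forall fun ω => ?_)
  have : (0 : ℝ) ≤ ‖s ω‖ + ‖d ω‖ := by positivity
  simp [abs_of_nonneg this]

end Holder

variable {E : Type*} [NormedAddCommGroup E] [InnerProductSpace ℝ E]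

theorem LpLe.integrable_rpow_mul_inner {p A B : ℝ} {s d : Ω → E} (hp : 2 ≤ p)
    (hs : LpLe P p s A) (hd : LpLe P p d B) :
    Integrable (fun ω => ‖s ω‖ ^ (p - 2) * inner ℝ (s ω) (d ω)) P := by
  have h := hs.integrable_rpow_mul_rpow hd (by linarith) (a := p - 1) (b := 1) (by linarith)
    zero_le_one (by ring)
  refine h.mono' ((hs.meas.norm.aemeasurable.pow_const _).aestronglyMeasurable.mul
    (hs.meas.inner hd.meas)) (Filter.Eventually.of_forall fun ω => ?_)
  have h1 := abs_real_inner_le_norm (s ω) (d ω)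
  rw [norm_mul, Real.norm_eq_abs, Real.norm_eq_abs, abs_of_nonneg (by positivity), Real.rpow_one]
  rcases (norm_nonneg (s ω)).eq_or_lt with h0 | h0
  · have : s ω = 0 := norm_eq_zero.1 h0.symm
    rw [this]
    simp
    positivity
  · have : ‖s ω‖ ^ (p - 1) = ‖s ω‖ ^ (p - 2) * ‖s ω‖ := by
      rw [← Real.rpow_add_one h0.ne']; congr 1; ring
    rw [this, mul_assoc]
    gcongr

theorem integral_norm_add_rpow_le {p A B : ℝ} {s d : Ω → E} (hp : 2 ≤ p)
    (hs : LpLe P p s A) (hd : LpLe P p d B)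
    (h : ∫ ω, ‖s ω‖ ^ (p - 2) * inner ℝ (s ω) (d ω) ∂P = 0) :
    ∫ ω, ‖s ω + d ω‖ ^ p ∂P ≤
      ∫ ω, ‖s ω‖ ^ p ∂P + p ^ 2 * ∫ ω, ‖d ω‖ ^ 2 * (‖s ω‖ + ‖d ω‖) ^ (p - 2) ∂P := by
  have i1 := hs.integrable_rpow (by linarith : 0 < p)
  have i2 := (hs.integrable_rpow_mul_inner hp hd).const_mul p
  have i3 := (hs.integrable_sq_mul_rpow hp hd).const_mul (p ^ 2)
  have i12 : Integrable (fun ω => ‖s ω‖ ^ p + p * (‖s ω‖ ^ (p - 2) * inner ℝ (s ω) (d ω))) P :=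
    i1.add i2
  calc ∫ ω, ‖s ω + d ω‖ ^ p ∂P ≤ ∫ ω, (‖s ω‖ ^ p + p * (‖s ω‖ ^ (p - 2) * inner ℝ (s ω) (d ω))
        + p ^ 2 * (‖d ω‖ ^ 2 * (‖s ω‖ + ‖d ω‖) ^ (p - 2))) ∂P :=
        integral_mono ((hs.add hd (by linarith)).integrable_rpow (by linarith)) (i12.add i3)
          fun ω => norm_add_rpow_le hp _ _
    _ = _ := by
        rw [integral_add i12 i3, integral_add i1 i2, integral_const_mul, integral_const_mul, h]
        ring

/-- The 2-smoothness inequality in `L^p` of a Hilbert space, for an increment that is orthogonal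
to the gradient of the norm. -/
theorem LpLe.add_of_orthogonal {p A B : ℝ} {s d : Ω → E} (hp : 2 ≤ p)
    (hs : LpLe P p s A) (hd : LpLe P p d B)
    (h : ∫ ω, ‖s ω‖ ^ (p - 2) * inner ℝ (s ω) (d ω) ∂P = 0) :
    LpLe P p (fun ω => s ω + d ω) √(A ^ 2 + 10 * p * B ^ 2) := by
  have hA := hs.nonneg
  have hB := hd.nonneg
  have hp0 : 0 < p := by linarith
  -- If `A ≤ p B`, the cross term `2 A B` of the triangle inequality is already at most `2 p B ^ 2`.
  -- Otherwise `B` is below `A / p`, so `(A + B) ^ (p - 2) ≤ 3 A ^ (p - 2)`, and Bernoulli with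
  -- exponent `p / 2` turns the additive error on `p`-th powers into one on squares.
  rcases le_or_gt A (p * B) with hAB | hAB
  · refine (hs.add hd (by linarith)).weaken (Real.le_sqrt_of_sq_le ?_)
    nlinarith [mul_nonneg hB hB]
  · have hA0 : 0 < A := lt_of_le_of_lt (by positivity) hAB
    refine .of_integral (hs.meas.add hd.meas) hp0 (Real.sqrt_nonneg _)
      ((hs.add hd (by linarith)).integrable_rpow hp0) ?_
    have h1 := integral_norm_add_rpow_le hp hs hd h
    have h2 := hs.integral_rpow_le hp0
    have h3 := hd.integral_rpow_mul_rpow_le (hs.norm.add hd.norm (by linarith)) hp0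
      (a := 2) (b := p - 2) (by linarith) (by linarith) (by ring)
    have h4 : ∫ ω, ‖d ω‖ ^ 2 * (‖s ω‖ + ‖d ω‖) ^ (p - 2) ∂P ≤ B ^ 2 * (3 * A ^ (p - 2)) := by
      refine le_trans (le_of_eq ?_) (h3.trans ?_)
      · congr 1; ext ω
        have : (0 : ℝ) ≤ ‖s ω‖ + ‖d ω‖ := by positivity
        simp [abs_of_nonneg this]
      · rw [Real.rpow_two]
        gcongr
        calc (A + B) ^ (p - 2) ≤ ((1 + 1 / p) * A) ^ (p - 2) := by
              apply Real.rpow_le_rpow (by positivity) _ (by linarith)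
              have : B ≤ A / p := by rw [le_div_iff₀ hp0]; linarith
              calc A + B ≤ A + A / p := by linarith
                _ = _ := by ring
          _ = (1 + 1 / p) ^ (p - 2) * A ^ (p - 2) := Real.mul_rpow (by positivity) hA
          _ ≤ _ := by gcongr; exact one_add_inv_rpow_le hp
    have hAp : A ^ p = A ^ (p - 2) * A ^ 2 := by
      rw [← Real.rpow_natCast A 2, ← Real.rpow_add hA0]; congr 1; push_cast; ring
    calc ∫ ω, ‖s ω + d ω‖ ^ p ∂P ≤ A ^ p + p ^ 2 * (B ^ 2 * (3 * A ^ (p - 2))) := by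
          have : 0 ≤ p ^ 2 := by positivity
          nlinarith [mul_le_mul_of_nonneg_left h4 this]
      _ ≤ A ^ p * (1 + p / 2 * (10 * p * B ^ 2 / A ^ 2)) := by
          have e : A ^ p * (1 + p / 2 * (10 * p * B ^ 2 / A ^ 2))
            = A ^ p + 5 * p ^ 2 * B ^ 2 * A ^ (p - 2) := by
            rw [hAp]; field_simp; ring
          rw [e]
          have : 0 ≤ p ^ 2 * B ^ 2 * A ^ (p - 2) := by positivity
          nlinarith
      _ ≤ A ^ p * (1 + 10 * p * B ^ 2 / A ^ 2) ^ (p / 2) := by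
          gcongr
          apply one_add_mul_self_le_rpow_one_add _ (by linarith)
          have : 0 ≤ 10 * p * B ^ 2 / A ^ 2 := by positivity
          linarith
      _ = √(A ^ 2 + 10 * p * B ^ 2) ^ p := by
          have e : A ^ 2 + 10 * p * B ^ 2 = A ^ 2 * (1 + 10 * p * B ^ 2 / A ^ 2) := by
            field_simp
          rw [e, Real.sqrt_mul (by positivity), Real.sqrt_sq hA,
            Real.mul_rpow hA (Real.sqrt_nonneg _), Real.sqrt_eq_rpow, ← Real.rpow_mul (by positivity)]
          congr 2; ring

/-- A Burkholder-type inequality for sums of increments that are orthogonal to the past. -/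
theorem LpLe.sum_of_orthogonal {p : ℝ} {d : ℕ → Ω → E} {B : ℕ → ℝ} (hp : 2 ≤ p) (N : ℕ)
    (hd : ∀ l < N, LpLe P p (d l) (B l))
    (h : ∀ l < N, ∫ ω, ‖∑ i ∈ Finset.range l, d i ω‖ ^ (p - 2) *
      inner ℝ (∑ i ∈ Finset.range l, d i ω) (d l ω) ∂P = 0) :
    LpLe P p (fun ω => ∑ l ∈ Finset.range N, d l ω)
      √(10 * p * ∑ l ∈ Finset.range N, B l ^ 2) := by
  induction N with
  | zero => simpa using LpLe.zero
  | succ N ih =>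
    have := (ih (fun l hl => hd l (by omega)) (fun l hl => h l (by omega))).add_of_orthogonal hp
      (hd N (by omega)) (h N (by omega))
    rw [Real.sq_sqrt (mul_nonneg (by linarith) (Finset.sum_nonneg fun i _ => sq_nonneg _)),
      ← mul_add] at this
    simpa only [Finset.sum_range_succ] using this

end Smoothness

/-! ### Rosenthal's inequality in Hilbert space. -/

section Rosenthal

/-- Separates the variance term from the `p`-th moment term. If `p b ≤ a`, adding `b` to `a` changes
the power by a factor at most `3`; otherwise `a < p b` and everything is a multiple of `b ^ p`. -/
theorem norm_sq_mul_add_rpow_le {p a b : ℝ} (hp : 2 ≤ p) (ha : 0 ≤ a) (hb : 0 ≤ b) :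
    b ^ 2 * (a + b) ^ (p - 2) ≤ 3 * (a ^ (p - 2) * b ^ 2) + (p + 1) ^ (p - 2) * b ^ p := by
  have hp0 : 0 < p := by linarith
  rcases le_or_gt (p * b) a with h | h
  · have : (a + b) ^ (p - 2) ≤ 3 * a ^ (p - 2) := by
      calc (a + b) ^ (p - 2) ≤ ((1 + 1 / p) * a) ^ (p - 2) := by
            apply Real.rpow_le_rpow (by positivity) _ (by linarith)
            have : b ≤ a / p := by rw [le_div_iff₀ hp0]; linarith
            calc a + b ≤ a + a / p := by linarith
              _ = _ := by ring
        _ = (1 + 1 / p) ^ (p - 2) * a ^ (p - 2) := Real.mul_rpow (by positivity) ha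
        _ ≤ _ := by gcongr; exact one_add_inv_rpow_le hp
    have h2 : 0 ≤ (p + 1) ^ (p - 2) * b ^ p := by positivity
    nlinarith [mul_le_mul_of_nonneg_left this (sq_nonneg b)]
  · have hb0 : 0 < b := by
      rcases hb.eq_or_lt with h0 | h0
      · simp [← h0] at h; linarith
      · exact h0
    have h1 : (a + b) ^ (p - 2) ≤ (p + 1) ^ (p - 2) * b ^ (p - 2) := by
      rw [← Real.mul_rpow (by positivity) hb]
      apply Real.rpow_le_rpow (by positivity) _ (by linarith)
      linarith
    have e : b ^ p = b ^ (p - 2) * b ^ 2 := by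
      rw [← Real.rpow_natCast b 2, ← Real.rpow_add hb0]; congr 1; push_cast; ring
    have h2 : 0 ≤ a ^ (p - 2) * b ^ 2 := by positivity
    rw [e]
    nlinarith [mul_le_mul_of_nonneg_left h1 (sq_nonneg b)]

/-- If `Y ^ (p / 2)` bounds the `p`-th moment of a partial sum, the left side bounds the next one.
Bernoulli with exponent `p / 2` converts this into a linear recursion for the squared level `Y`. -/
theorem rosenthal_step_le {p Y x s : ℝ} (hp : 2 ≤ p) (hY : 0 ≤ Y) (hx : 0 ≤ x) (hs : 0 ≤ s) :
    Y ^ (p / 2) * (1 + x) + 3 * p ^ 2 * s * Y ^ ((p - 2) / 2) ≤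
      (Y * (1 + 2 / p * x) + 6 * p * s) ^ (p / 2) := by
  have hp0 : 0 < p := by linarith
  rcases hY.eq_or_lt with h | h
  · rw [← h, Real.zero_rpow (by linarith)]
    rcases hp.eq_or_lt with h2 | h2
    · rw [← h2]; norm_num
    · rw [Real.zero_rpow (by linarith)]
      simp
      positivity
  · have e : Y * (1 + 2 / p * x) + 6 * p * s = Y * (1 + (2 / p * x + 6 * p * s / Y)) := by
      field_simp
      ring
    have e2 : Y ^ (p / 2) = Y ^ ((p - 2) / 2) * Y := by
      rw [← Real.rpow_add_one h.ne']; congr 1; ring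
    have hz : 0 ≤ 2 / p * x + 6 * p * s / Y := by positivity
    rw [e, Real.mul_rpow hY (by linarith)]
    calc Y ^ (p / 2) * (1 + x) + 3 * p ^ 2 * s * Y ^ ((p - 2) / 2)
        = Y ^ (p / 2) * (1 + p / 2 * (2 / p * x + 6 * p * s / Y)) := by
          rw [e2]; field_simp; ring
      _ ≤ _ := by
          gcongr
          exact one_add_mul_self_le_rpow_one_add (by linarith) (by linarith)

variable {Ω : Type*} [MeasurableSpace Ω] {P : Measure Ω} [IsProbabilityMeasure P]
variable {E : Type*} [NormedAddCommGroup E] [InnerProductSpace ℝ E]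

/-- Rosenthal's inequality for sums of centred increments in a Hilbert space. The hypotheses on the
increments hold when they are independent and centred. -/
theorem LpLe.sum_rosenthal {p t s : ℝ} {d : ℕ → Ω → E} (hp : 2 ≤ p) (N : ℕ) (hs : 0 ≤ s)
    (hd : ∀ l < N, LpLe P p (d l) t)
    (horth : ∀ l < N, ∫ ω, ‖∑ i ∈ Finset.range l, d i ω‖ ^ (p - 2) *
      inner ℝ (∑ i ∈ Finset.range l, d i ω) (d l ω) ∂P = 0)
    (hvar : ∀ l < N, ∫ ω, ‖∑ i ∈ Finset.range l, d i ω‖ ^ (p - 2) * ‖d l ω‖ ^ 2 ∂P ≤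
      s ^ 2 * ∫ ω, ‖∑ i ∈ Finset.range l, d i ω‖ ^ (p - 2) ∂P) :
    LpLe P p (fun ω => ∑ l ∈ Finset.range N, d l ω)
      (5 * (√p * √N * s) + 4 * (p * (N : ℝ) ^ (1 / p) * t)) := by
  have hp0 : 0 < p := by linarith
  rcases Nat.eq_zero_or_pos N with rfl | hN
  · simp only [Finset.range_zero, Finset.sum_empty]
    refine LpLe.zero.weaken ?_
    simp [Real.zero_rpow (inv_ne_zero hp0.ne')]
  have hN0 : (0 : ℝ) < N := by exact_mod_cast hN
  have ht : 0 ≤ t := (hd 0 hN).nonneg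
  -- `W` is chosen so that the `p`-th moment of one increment costs at most the fraction `1 / N` of
  -- `W ^ p`, as shown in `h5` below. Over `N` steps these relative errors multiply `Y` by at most
  -- `exp (2 / p) ≤ 3`, while the variances add up inside the bracket of `Y`.
  set W : ℝ := (N : ℝ) ^ (1 / p) * ((p + 1) * t) with hW
  have hW0 : 0 ≤ W := by positivity
  set Y : ℕ → ℝ := fun k => (1 + 2 / p * (1 / N)) ^ k * (W ^ 2 + 6 * p * k * s ^ 2) with hY
  have hfac : 1 ≤ 1 + 2 / p * (1 / (N : ℝ)) := by
    have : 0 ≤ 2 / p * (1 / (N : ℝ)) := by positivity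
    linarith
  have hYW : ∀ k, W ^ 2 ≤ Y k := by
    intro k
    have h1 : W ^ 2 ≤ W ^ 2 + 6 * p * k * s ^ 2 := by
      have : 0 ≤ 6 * p * k * s ^ 2 := by positivity
      linarith
    exact h1.trans (le_mul_of_one_le_left (by positivity) (one_le_pow₀ hfac))
  have hY0 : ∀ k, 0 ≤ Y k := fun k => (sq_nonneg W).trans (hYW k)
  have hYsucc : ∀ k, Y k * (1 + 2 / p * (1 / N)) + 6 * p * s ^ 2 ≤ Y (k + 1) := by
    intro k
    have h1 : 6 * p * s ^ 2 ≤ (1 + 2 / p * (1 / (N : ℝ))) ^ (k + 1) * (6 * p * s ^ 2) :=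
      le_mul_of_one_le_left (by positivity) (one_le_pow₀ hfac)
    have h2 : Y (k + 1) = Y k * (1 + 2 / p * (1 / N))
        + (1 + 2 / p * (1 / (N : ℝ))) ^ (k + 1) * (6 * p * s ^ 2) := by
      simp only [hY]; push_cast; ring
    linarith
  have main : ∀ k ≤ N, LpLe P p (fun ω => ∑ l ∈ Finset.range k, d l ω) √(Y k) := by
    intro k
    induction k with
    | zero => intro _; simpa using LpLe.zero.weaken (Real.sqrt_nonneg _)
    | succ k ih =>
      intro hk
      have hS := ih (by omega)
      have hdk := hd k (by omega)
      simp only [Finset.sum_range_succ]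
      refine .of_integral (hS.meas.add hdk.meas) hp0 (Real.sqrt_nonneg _)
        ((hS.add hdk (by linarith)).integrable_rpow hp0) ?_
      have h1 := integral_norm_add_rpow_le hp hS hdk (horth k (by omega))
      have h2 := hS.integral_rpow_le hp0
      -- Hölder against the constant function `1` plays the role of Jensen and includes `p = 2`.
      have h3 : ∫ ω, ‖∑ i ∈ Finset.range k, d i ω‖ ^ (p - 2) ∂P ≤ √(Y k) ^ (p - 2) := by
        have := hS.integral_rpow_mul_rpow_le (LpLe.const (P := P) (q := p) (1 : ℝ)) hp0
          (a := p - 2) (b := 2) (by linarith) (by linarith) (by ring)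
        simpa using this
      have hi2 : Integrable (fun ω => ‖∑ i ∈ Finset.range k, d i ω‖ ^ (p - 2) * ‖d k ω‖ ^ 2) P := by
        have := hS.integrable_rpow_mul_rpow hdk hp0
          (a := p - 2) (b := 2) (by linarith) (by linarith) (by ring)
        simpa only [Real.rpow_two] using this
      have hi3 := hdk.integrable_rpow hp0
      have h4 : ∫ ω, ‖d k ω‖ ^ 2 * (‖∑ i ∈ Finset.range k, d i ω‖ + ‖d k ω‖) ^ (p - 2) ∂P ≤
          3 * (s ^ 2 * √(Y k) ^ (p - 2)) + (p + 1) ^ (p - 2) * t ^ p := by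
        calc ∫ ω, ‖d k ω‖ ^ 2 * (‖∑ i ∈ Finset.range k, d i ω‖ + ‖d k ω‖) ^ (p - 2) ∂P
            ≤ ∫ ω, (3 * (‖∑ i ∈ Finset.range k, d i ω‖ ^ (p - 2) * ‖d k ω‖ ^ 2)
              + (p + 1) ^ (p - 2) * ‖d k ω‖ ^ p) ∂P :=
              integral_mono (hS.integrable_sq_mul_rpow hp hdk)
                ((hi2.const_mul 3).add (hi3.const_mul _))
                fun ω => norm_sq_mul_add_rpow_le hp (norm_nonneg _) (norm_nonneg _)
          _ = 3 * ∫ ω, ‖∑ i ∈ Finset.range k, d i ω‖ ^ (p - 2) * ‖d k ω‖ ^ 2 ∂P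
              + (p + 1) ^ (p - 2) * ∫ ω, ‖d k ω‖ ^ p ∂P := by
              rw [integral_add (hi2.const_mul 3) (hi3.const_mul _), integral_const_mul,
                integral_const_mul]
          _ ≤ _ := by
              have h5 := (hvar k (by omega)).trans (mul_le_mul_of_nonneg_left h3 (sq_nonneg s))
              have h6 := hdk.integral_rpow_le hp0
              gcongr
      have hsq : ∀ r : ℝ, √(Y k) ^ r = Y k ^ (r / 2) := by
        intro r
        rw [Real.sqrt_eq_rpow, ← Real.rpow_mul (hY0 k)]
        congr 1; ring
      have h5 : p ^ 2 * ((p + 1) ^ (p - 2) * t ^ p) ≤ Y k ^ (p / 2) * (1 / N) := by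
        have e1 : W ^ p = N * ((p + 1) ^ p * t ^ p) := by
          rw [hW, Real.mul_rpow (by positivity) (by positivity), ← Real.rpow_mul hN0.le,
            one_div_mul_cancel hp0.ne', Real.rpow_one, Real.mul_rpow (by positivity) ht]
        have e2 : W ^ p ≤ Y k ^ (p / 2) := by
          have := Real.rpow_le_rpow (sq_nonneg W) (hYW k) (by linarith : 0 ≤ p / 2)
          rwa [← Real.rpow_natCast_mul hW0, Nat.cast_ofNat, mul_div_cancel₀ _ two_ne_zero] at this
        have e3 : p ^ 2 * (p + 1) ^ (p - 2) ≤ (p + 1) ^ p := by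
          have : (p + 1) ^ p = (p + 1) ^ 2 * (p + 1) ^ (p - 2) := by
            rw [← Real.rpow_natCast (p + 1) 2, ← Real.rpow_add (by linarith)]
            congr 1; push_cast; ring
          rw [this]
          gcongr
          linarith
        calc p ^ 2 * ((p + 1) ^ (p - 2) * t ^ p) = p ^ 2 * (p + 1) ^ (p - 2) * t ^ p := by ring
          _ ≤ (p + 1) ^ p * t ^ p := by gcongr
          _ = W ^ p * (1 / N) := by rw [e1]; field_simp
          _ ≤ _ := by gcongr
      have h6 : Y k ^ (p / 2) * (1 + 1 / N) + 3 * p ^ 2 * s ^ 2 * Y k ^ ((p - 2) / 2)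
          ≤ √(Y (k + 1)) ^ p := by
        refine (rosenthal_step_le hp (hY0 k) (by positivity) (sq_nonneg s)).trans ?_
        rw [Real.sqrt_eq_rpow, ← Real.rpow_mul (hY0 (k + 1)), one_div_mul_eq_div]
        refine Real.rpow_le_rpow ?_ (hYsucc k) (by linarith)
        have := hY0 k
        positivity
      have h7 := mul_le_mul_of_nonneg_left h4 (sq_nonneg p)
      rw [hsq] at h2 h7
      linarith
  refine (main N le_rfl).weaken ?_
  have hexp : (1 + 2 / p * (1 / (N : ℝ))) ^ N ≤ 3 := by
    calc (1 + 2 / p * (1 / (N : ℝ))) ^ N ≤ Real.exp (2 / p * (1 / (N : ℝ))) ^ N := by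
          gcongr
          have := Real.add_one_le_exp (2 / p * (1 / (N : ℝ)))
          linarith
      _ = Real.exp (2 / p) := by
          rw [← Real.exp_nat_mul]; congr 1; field_simp
      _ ≤ Real.exp 1 := Real.exp_le_exp.2 (by rw [div_le_one hp0]; exact hp)
      _ ≤ 3 := by linarith [Real.exp_one_lt_d9]
  have hsq : √p * √(N : ℝ) * s = √(p * N * s ^ 2) := by
    rw [Real.sqrt_mul (by positivity), Real.sqrt_sq hs, Real.sqrt_mul hp0.le]
  have hW2 : 2 * W ≤ 4 * (p * (N : ℝ) ^ (1 / p) * t) := by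
    have : W ≤ (N : ℝ) ^ (1 / p) * (2 * p * t) := by
      rw [hW]; gcongr; linarith
    linarith
  refine le_trans ?_ (add_le_add_right hW2 _)
  rw [hsq]
  set v := √(p * N * s ^ 2)
  have hv : v ^ 2 = p * N * s ^ 2 := Real.sq_sqrt (by positivity)
  have hv0 : 0 ≤ v := Real.sqrt_nonneg _
  apply Real.sqrt_le_iff.2 ⟨by positivity, ?_⟩
  have hb : 0 ≤ W ^ 2 + 6 * p * N * s ^ 2 := by positivity
  calc Y N ≤ 3 * (W ^ 2 + 6 * p * N * s ^ 2) := mul_le_mul_of_nonneg_right hexp hb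
    _ = 3 * W ^ 2 + 18 * v ^ 2 := by rw [hv]; ring
    _ ≤ _ := by nlinarith [mul_nonneg hv0 hW0, sq_nonneg v, sq_nonneg W]

end Rosenthal

/-! ### The SGD chain, its past, and integration over fresh noise. -/

section Probability

variable {d : ℕ} {Z : Type*}

/-- The `k`-th SGD iterate as a random variable. -/
def chain {Ω : Type*} (g : Vec d → Z → Vec d) (h : ℝ) (θ₀ : Ω → Vec d) (ξ : ℕ → Ω → Z) (k : ℕ)
    (ω : Ω) : Vec d :=
  sgd g h (θ₀ ω) (fun k => ξ k ω) k

theorem chain_succ {Ω : Type*} {θ₀ : Ω → Vec d} {ξ : ℕ → Ω → Z} {g : Vec d → Z → Vec d} {h : ℝ}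
    (k : ℕ) (ω : Ω) :
    chain g h θ₀ ξ (k + 1) ω =
      chain g h θ₀ ξ k ω - h • g (chain g h θ₀ ξ k ω) (ξ (k + 1) ω) := rfl

variable [MeasurableSpace Z]

/-- The σ-algebra generated by the initial point and the noise up to time `k`. -/
@[reducible]
def past {Ω : Type*} (θ₀ : Ω → Vec d) (ξ : ℕ → Ω → Z) (k : ℕ) : MeasurableSpace Ω :=
  MeasurableSpace.comap (fun ω => (θ₀ ω, fun i : Finset.Iic k => ξ i ω)) inferInstance

section Past

variable {Ω : Type*} {θ₀ : Ω → Vec d} {ξ : ℕ → Ω → Z} {g : Vec d → Z → Vec d} {h : ℝ}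

theorem measurable_past_initial (k : ℕ) : Measurable[past θ₀ ξ k] θ₀ :=
  measurable_fst.comp (comap_measurable fun ω => (θ₀ ω, fun i : Finset.Iic k => ξ i ω))

theorem measurable_past_noise {j k : ℕ} (hj : j ≤ k) : Measurable[past θ₀ ξ k] (ξ j) :=
  ((measurable_pi_apply (⟨j, Finset.mem_Iic.2 hj⟩ : Finset.Iic k)).comp measurable_snd).comp
    (comap_measurable fun ω => (θ₀ ω, fun i : Finset.Iic k => ξ i ω))

theorem past_mono {j k : ℕ} (hjk : j ≤ k) : past θ₀ ξ j ≤ past θ₀ ξ k := by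
  let _ := past θ₀ ξ k
  refine Measurable.comap_le (Measurable.prodMk (measurable_past_initial k) ?_)
  exact measurable_pi_lambda _ fun i => measurable_past_noise ((Finset.mem_Iic.1 i.2).trans hjk)

theorem measurable_chain_past (hg : Measurable (fun x : Vec d × Z => g x.1 x.2)) (k : ℕ) :
    Measurable[past θ₀ ξ k] (chain g h θ₀ ξ k) := by
  induction k with
  | zero => exact measurable_past_initial 0
  | succ k ih =>
    let _ := past θ₀ ξ (k + 1)
    have h1 : Measurable (chain g h θ₀ ξ k) := ih.mono (past_mono k.le_succ) le_rfl
    have h2 : Measurable (ξ (k + 1)) := measurable_past_noise le_rfl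
    have h3 : Measurable (fun x : Vec d × Z => x.1 - h • g x.1 x.2) :=
      measurable_fst.sub (hg.const_smul h)
    exact h3.comp (h1.prodMk h2)

end Past

variable {Ω : Type*} [MeasurableSpace Ω] {θ₀ : Ω → Vec d} {ξ : ℕ → Ω → Z}
  {g : Vec d → Z → Vec d} {h : ℝ} {ν : Measure Z} {P : Measure Ω}

/-- A random initial point and an independent i.i.d. noise sequence with law `ν`. -/
structure NoiseModel (ν : Measure Z) (P : Measure Ω) (θ₀ : Ω → Vec d) (ξ : ℕ → Ω → Z) : Prop where
  meas₀ : Measurable θ₀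
  meas : ∀ k, Measurable (ξ k)
  law : ∀ k, P.map (ξ k) = ν
  iIndep : iIndepFun ξ P
  indep : IndepFun θ₀ (fun ω k => ξ k ω) P

namespace NoiseModel

variable (H : NoiseModel ν P θ₀ ξ)
include H

theorem past_le (k : ℕ) : past θ₀ ξ k ≤ ‹MeasurableSpace Ω› :=
  Measurable.comap_le (H.meas₀.prodMk (measurable_pi_lambda _ fun i => H.meas i))

theorem measurable_of_past {β : Type*} [MeasurableSpace β] {Y : Ω → β} {k : ℕ}
    (hY : Measurable[past θ₀ ξ k] Y) : Measurable Y :=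
  hY.mono (H.past_le k) le_rfl

theorem measurable_chain (hg : Measurable (fun x : Vec d × Z => g x.1 x.2)) (k : ℕ) :
    Measurable (chain g h θ₀ ξ k) :=
  H.measurable_of_past (measurable_chain_past hg k)

variable [IsProbabilityMeasure P]

/-- The law of `(θ₀, (V, ξ (k + 1)))` factors once because `θ₀` is independent of the whole noise,
and again because the noises are mutually independent. Reassociating the triple product measure
gives the claim. -/
theorem indepFun_past (k : ℕ) :
    IndepFun (fun ω => (θ₀ ω, fun i : Finset.Iic k => ξ i ω)) (ξ (k + 1)) P := by
  set V : Ω → (Finset.Iic k → Z) := fun ω i => ξ i ω with hV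
  have hVm : Measurable V := measurable_pi_lambda _ fun i => H.meas i
  have hW := H.meas (k + 1)
  have h1 : IndepFun V (ξ (k + 1)) P := by
    have h2 := H.iIndep.indepFun_finset (Finset.Iic k) {k + 1}
      (by simp) H.meas
    exact h2.comp measurable_id
      (measurable_pi_apply (⟨k + 1, by simp⟩ : ({k + 1} : Finset ℕ)))
  have h2 : IndepFun θ₀ (fun ω => (V ω, ξ (k + 1) ω)) P := by
    have hm : Measurable (fun x : ℕ → Z => ((fun i : Finset.Iic k => x i), x (k + 1))) :=
      (measurable_pi_lambda _ fun i => measurable_pi_apply _).prodMk (measurable_pi_apply _)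
    exact H.indep.comp measurable_id hm
  have h3 : IndepFun θ₀ V P := h2.comp measurable_id measurable_fst
  rw [indepFun_iff_map_prod_eq_prod_map_map (H.meas₀.prodMk hVm).aemeasurable hW.aemeasurable]
  rw [indepFun_iff_map_prod_eq_prod_map_map H.meas₀.aemeasurable
    (hVm.prodMk hW).aemeasurable] at h2
  rw [indepFun_iff_map_prod_eq_prod_map_map hVm.aemeasurable hW.aemeasurable] at h1
  rw [indepFun_iff_map_prod_eq_prod_map_map H.meas₀.aemeasurable hVm.aemeasurable] at h3
  have := Measure.isProbabilityMeasure_map (μ := P) hVm.aemeasurable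
  have := Measure.isProbabilityMeasure_map (μ := P) hW.aemeasurable
  have := Measure.isProbabilityMeasure_map (μ := P) H.meas₀.aemeasurable
  rw [h1, ← Measure.prodAssoc_prod, ← h3] at h2
  have h4 := (MeasurableEquiv.map_apply_eq_iff_map_symm_apply_eq MeasurableEquiv.prodAssoc).1 h2.symm
  rw [h4, Measure.map_map (MeasurableEquiv.measurable _) (H.meas₀.prodMk (hVm.prodMk hW))]
  rfl

variable {β : Type*} [MeasurableSpace β] {Y : Ω → β} {k : ℕ}

/-- This product law stands in for conditional expectations: every conditioning argument below
becomes Fubini for `(P.map Y).prod ν`. -/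
theorem map_prod (hY : Measurable[past θ₀ ξ k] Y) :
    P.map (fun ω => (Y ω, ξ (k + 1) ω)) = (P.map Y).prod ν := by
  have h1 : IndepFun Y (ξ (k + 1)) P :=
    indep_of_indep_of_le_left (H.indepFun_past k) hY.comap_le
  rw [(indepFun_iff_map_prod_eq_prod_map_map (H.measurable_of_past hY).aemeasurable
    (H.meas (k + 1)).aemeasurable).1 h1, H.law]

variable [IsProbabilityMeasure ν]

theorem lintegral_eq (hY : Measurable[past θ₀ ξ k] Y) {φ : β × Z → ℝ≥0∞} (hφ : Measurable φ) :
    ∫⁻ ω, φ (Y ω, ξ (k + 1) ω) ∂P = ∫⁻ ω, ∫⁻ z, φ (Y ω, z) ∂ν ∂P := by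
  have hYm := H.measurable_of_past hY
  rw [← lintegral_map hφ (hYm.prodMk (H.meas (k + 1))), H.map_prod hY,
    lintegral_prod _ hφ.aemeasurable, lintegral_map hφ.lintegral_prod_right' hYm]

variable {E : Type*} [NormedAddCommGroup E] [NormedSpace ℝ E]

theorem integrable_prod (hY : Measurable[past θ₀ ξ k] Y) {φ : β × Z → E}
    (hφ : StronglyMeasurable φ) (hi : Integrable (fun ω => φ (Y ω, ξ (k + 1) ω)) P) :
    Integrable φ ((P.map Y).prod ν) := by
  have hYm := H.measurable_of_past hY
  rw [← H.map_prod hY]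
  exact (integrable_map_measure hφ.aestronglyMeasurable
    (hYm.prodMk (H.meas (k + 1))).aemeasurable).2 hi

/-- Freezing: the noise at time `k + 1` may be integrated out given the past. -/
theorem integral_eq (hY : Measurable[past θ₀ ξ k] Y) {φ : β × Z → E}
    (hφ : StronglyMeasurable φ) (hi : Integrable (fun ω => φ (Y ω, ξ (k + 1) ω)) P) :
    ∫ ω, φ (Y ω, ξ (k + 1) ω) ∂P = ∫ ω, ∫ z, φ (Y ω, z) ∂ν ∂P := by
  have hYm := H.measurable_of_past hY
  rw [← integral_map (hYm.prodMk (H.meas (k + 1))).aemeasurable hφ.aestronglyMeasurable,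
    H.map_prod hY, integral_prod _ (H.integrable_prod hY hφ hi),
    integral_map hYm.aemeasurable hφ.integral_prod_right'.aestronglyMeasurable]

theorem integrable_integral (hY : Measurable[past θ₀ ξ k] Y) {φ : β × Z → E}
    (hφ : StronglyMeasurable φ) (hi : Integrable (fun ω => φ (Y ω, ξ (k + 1) ω)) P) :
    Integrable (fun ω => ∫ z, φ (Y ω, z) ∂ν) P :=
  (integrable_map_measure hφ.integral_prod_right'.aestronglyMeasurable
    (H.measurable_of_past hY).aemeasurable).1 (H.integrable_prod hY hφ hi).integral_prod_left

theorem lpLe_noise {q A : ℝ} {φ : Z → E} (hφ : StronglyMeasurable φ) (hi : LpLe ν q φ A) (k : ℕ) :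
    LpLe P q (fun ω => φ (ξ k ω)) A := by
  refine ⟨(hφ.comp_measurable (H.meas k)).aestronglyMeasurable, hi.nonneg, ?_⟩
  have h1 := hi.le
  rwa [← H.law k, eLpNorm_map_measure (hφ.aestronglyMeasurable) (H.meas k).aemeasurable] at h1

omit [IsProbabilityMeasure ν] in
theorem map_chain (hg : Measurable (fun x : Vec d × Z => g x.1 x.2)) (k : ℕ) :
    P.map (chain g h θ₀ ξ k) = sgdLaw g ν h (P.map θ₀) k := by
  induction k with
  | zero => rfl
  | succ k ih =>
    have h3 : Measurable (fun x : Vec d × Z => x.1 - h • g x.1 x.2) :=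
      measurable_fst.sub (hg.const_smul h)
    have hc := measurable_chain_past (θ₀ := θ₀) (ξ := ξ) (h := h) hg k
    rw [sgdLaw, Function.iterate_succ_apply', ← sgdLaw, ← ih, sgdStepLaw, ← H.map_prod hc,
      Measure.map_map h3 ((H.measurable_of_past hc).prodMk (H.meas _))]
    rfl

/-- Moment bounds that hold given the past, with a bound depending on the current state. -/
theorem lpLe_of_conditional {q A C : ℝ} (hq : 0 < q) (hC : 0 ≤ C)
    {F : Type*} [NormedAddCommGroup F] {w : β → F} {φ : β × Z → E}
    (hY : Measurable[past θ₀ ξ k] Y) (hw : LpLe P q (fun ω => w (Y ω)) A)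
    (hφ : StronglyMeasurable φ)
    (hle : ∀ y, ∫⁻ z, ‖φ (y, z)‖ₑ ^ q ∂ν ≤ ENNReal.ofReal ((C * ‖w y‖) ^ q)) :
    LpLe P q (fun ω => φ (Y ω, ξ (k + 1) ω)) (C * A) := by
  have hYm := H.measurable_of_past hY
  refine .of_lintegral (hφ.comp_measurable (hYm.prodMk (H.meas _))).aestronglyMeasurable hq
    (mul_nonneg hC hw.nonneg) ?_
  rw [H.lintegral_eq hY (φ := fun x => ‖φ x‖ₑ ^ q) (hφ.enorm.pow_const q)]
  calc ∫⁻ ω, ∫⁻ z, ‖φ (Y ω, z)‖ₑ ^ q ∂ν ∂P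
      ≤ ∫⁻ ω, ENNReal.ofReal (C ^ q) * ‖w (Y ω)‖ₑ ^ q ∂P := by
        refine lintegral_mono fun ω => (hle (Y ω)).trans (le_of_eq ?_)
        rw [enorm_rpow_eq_ofReal hq.le, ← ENNReal.ofReal_mul (by positivity),
          Real.mul_rpow hC (norm_nonneg _)]
    _ = ENNReal.ofReal (C ^ q) * ∫⁻ ω, ‖w (Y ω)‖ₑ ^ q ∂P :=
        lintegral_const_mul' _ _ ENNReal.ofReal_ne_top
    _ ≤ ENNReal.ofReal (C ^ q) * ENNReal.ofReal (A ^ q) := by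
        gcongr
        exact hw.lintegral_le hq
    _ = _ := by
        rw [← ENNReal.ofReal_mul (by positivity), Real.mul_rpow hC hw.nonneg]

/-- Centred increments are orthogonal to functions of the past. -/
theorem integral_inner_eq_zero {S : Ω → Vec d} (hS : Measurable[past θ₀ ξ k] S)
    (hY : Measurable[past θ₀ ξ k] Y) {φ : β × Z → Vec d} (hφ : Measurable φ)
    (hφi : ∀ y, Integrable (fun z => φ (y, z)) ν) (hφ0 : ∀ y, ∫ z, φ (y, z) ∂ν = 0) {r : ℝ}
    (hi : Integrable (fun ω => ‖S ω‖ ^ r * inner ℝ (S ω) (φ (Y ω, ξ (k + 1) ω))) P) :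
    ∫ ω, ‖S ω‖ ^ r * inner ℝ (S ω) (φ (Y ω, ξ (k + 1) ω)) ∂P = 0 := by
  have hpair : Measurable[past θ₀ ξ k] fun ω => (S ω, Y ω) :=
    hS.prodMk hY
  have hm : Measurable (fun x : (Vec d × β) × Z =>
      ‖x.1.1‖ ^ r * inner ℝ x.1.1 (φ (x.1.2, x.2))) := by
    have h1 : Measurable fun x : (Vec d × β) × Z => x.1.1 := measurable_fst.comp measurable_fst
    have h2 : Measurable fun x : (Vec d × β) × Z => φ (x.1.2, x.2) :=
      hφ.comp ((measurable_snd.comp measurable_fst).prodMk measurable_snd)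
    exact (h1.norm.pow_const r).mul (h1.inner h2)
  rw [H.integral_eq hpair (φ := fun x => ‖x.1.1‖ ^ r * inner ℝ x.1.1 (φ (x.1.2, x.2)))
    hm.stronglyMeasurable hi]
  have h0 : ∀ ω, ∫ z, ‖S ω‖ ^ r * inner ℝ (S ω) (φ (Y ω, z)) ∂ν = 0 := by
    intro ω
    rw [integral_const_mul, integral_inner (hφi (Y ω)), hφ0]
    simp
  simp only [h0, integral_zero]

end NoiseModel

end Probability

/-! ### Derivatives of the objective up to order four, and self-bounding estimates. -/

section Calculus

theorem norm_sub_sub_le_of_lipschitz_fderiv {E F : Type*} [NormedAddCommGroup E] [NormedSpace ℝ E]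
    [NormedAddCommGroup F] [NormedSpace ℝ F] {φ : E → F} {φ' : E → E →L[ℝ] F} {M : ℝ}
    (hM : 0 ≤ M) (hφ : ∀ x, HasFDerivAt φ (φ' x) x) (hL : ∀ x y, ‖φ' x - φ' y‖ ≤ M * ‖x - y‖)
    (x v : E) : ‖φ (x + v) - φ x - φ' x v‖ ≤ M * ‖v‖ ^ 2 := by
  have h := (convex_closedBall x ‖v‖).norm_image_sub_le_of_norm_hasFDerivWithin_le'
    (f := φ) (f' := φ') (φ := φ' x) (C := M * ‖v‖) (x := x) (y := x + v)
    (fun y _ => (hφ y).hasFDerivWithinAt)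
    (fun y hy => (hL y x).trans (by
      rw [Metric.mem_closedBall, dist_eq_norm] at hy
      gcongr))
    (Metric.mem_closedBall_self (norm_nonneg _)) (by simp)
  rw [add_sub_cancel_left] at h
  calc _ ≤ M * ‖v‖ * ‖v‖ := h
    _ = _ := by ring

theorem norm_sub_le_of_norm_iteratedFDeriv_one_le {E F : Type*} [NormedAddCommGroup E]
    [NormedSpace ℝ E] [NormedAddCommGroup F] [NormedSpace ℝ F] {φ : E → F} {M : ℝ}
    (hφ : Differentiable ℝ φ) (h : ∀ x, ‖iteratedFDeriv ℝ 1 φ x‖ ≤ M) (x y : E) :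
    ‖φ x - φ y‖ ≤ M * ‖x - y‖ :=
  convex_univ.norm_image_sub_le_of_norm_fderiv_le (fun z _ => hφ z)
    (fun z _ => (norm_iteratedFDeriv_one φ).symm.le.trans (h z)) (Set.mem_univ y) (Set.mem_univ x)

/-- The discriminant of a nonnegative quadratic. Applied along a line, it bounds a derivative by the
geometric mean of the value and a curvature bound; `third_sq_le` and `gradient_remainder_sq_le` both
use it. -/
theorem sq_le_of_forall_quadratic_nonneg {a b c : ℝ} (h : ∀ t : ℝ, 0 ≤ c + t * b + t ^ 2 * a) :
    b ^ 2 ≤ 4 * a * c := by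
  have := discrim_le_zero (a := a) (b := b) (c := c) fun t => by
    have := h t
    nlinarith
  rw [discrim] at this
  linarith

variable {d : ℕ} {f : Vec d → ℝ} {μ L : ℝ}

/-- The third derivative `∇³f(θ)`, as a bilinear map. -/
noncomputable def third (f : Vec d → ℝ) (θ : Vec d) : Vec d →L[ℝ] Vec d →L[ℝ] Vec d :=
  fderiv ℝ (hessian f) θ

/-- The Riesz isomorphism as a linear isometry over `ℝ`. -/
noncomputable def rieszIso (d : ℕ) : (Vec d →L[ℝ] ℝ) ≃ₗᵢ[ℝ] Vec d where
  toFun := (InnerProductSpace.toDual ℝ (Vec d)).symm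
  map_add' := map_add _
  map_smul' c x := by simp
  invFun := InnerProductSpace.toDual ℝ (Vec d)
  left_inv x := by simp
  right_inv x := by simp
  norm_map' x := by simp

theorem gradient_eq_comp (f : Vec d → ℝ) : gradient f = rieszIso d ∘ fderiv ℝ f := rfl

theorem SmoothBounded.mono {L₂ L₃ L₄ : ℝ} (hs : SmoothBounded f L₂ L₃ L₄) (h₂ : L₂ ≤ L)
    (h₃ : L₃ ≤ L) (h₄ : L₄ ≤ L) : SmoothBounded f L L L where
  nonneg₂ := hs.nonneg₂.trans h₂
  nonneg₃ := hs.nonneg₃.trans h₃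
  nonneg₄ := hs.nonneg₄.trans h₄
  contDiff := hs.contDiff
  lipschitz x y := (hs.lipschitz x y).trans (by gcongr)
  bound₃ x := (hs.bound₃ x).trans h₃
  bound₄ x := (hs.bound₄ x).trans h₄

namespace SmoothBounded

variable (hs : SmoothBounded f L L L)
include hs

theorem contDiff_gradient : ContDiff ℝ 3 (gradient f) := by
  rw [gradient_eq_comp]
  exact (rieszIso d).contDiff.comp (hs.contDiff.fderiv_right (by norm_num))

theorem contDiff_hessian : ContDiff ℝ 2 (hessian f) :=
  hs.contDiff_gradient.fderiv_right (by norm_num)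

theorem contDiff_third : ContDiff ℝ 1 (third f) :=
  hs.contDiff_hessian.fderiv_right (by norm_num)

theorem hasFDerivAt_gradient (x : Vec d) : HasFDerivAt (gradient f) (hessian f x) x :=
  (hs.contDiff_gradient.differentiable (by norm_num) x).hasFDerivAt

theorem hasFDerivAt_hessian (x : Vec d) : HasFDerivAt (hessian f) (third f x) x :=
  (hs.contDiff_hessian.differentiable (by norm_num) x).hasFDerivAt

theorem hasFDerivAt (x : Vec d) : HasFDerivAt f (innerSL ℝ (gradient f x)) x :=
  (hs.contDiff.differentiable (by norm_num) x).hasGradientAt.hasFDerivAt.congr_fderiv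
    (by ext a; simp)

theorem inner_hessian_left (x u w : Vec d) :
    inner ℝ (hessian f x u) w = inner ℝ u (hessian f x w) := by
  have hsym : IsSymmSndFDerivAt ℝ f x :=
    hs.contDiff.contDiffAt.isSymmSndFDerivAt (by simp; norm_num)
  have key : ∀ a b : Vec d, inner ℝ (hessian f x a) b = fderiv ℝ (fderiv ℝ f) x a b := by
    intro a b
    have h1 : HasFDerivAt (fderiv ℝ f) (fderiv ℝ (fderiv ℝ f) x) x :=
      ((hs.contDiff.fderiv_right (m := 3) (by norm_num)).differentiable (by norm_num) x).hasFDerivAt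
    have h2 : HasFDerivAt (gradient f)
        (((rieszIso d : (Vec d →L[ℝ] ℝ) ≃L[ℝ] Vec d) : (Vec d →L[ℝ] ℝ) →L[ℝ] Vec d).comp
          (fderiv ℝ (fderiv ℝ f) x)) x := by
      rw [gradient_eq_comp]
      exact (rieszIso d : (Vec d →L[ℝ] ℝ) ≃L[ℝ] Vec d).hasFDerivAt.comp x h1
    rw [hessian, h2.fderiv]
    exact InnerProductSpace.toDual_symm_apply
  rw [key u w, hsym u w, ← key w u, real_inner_comm]

theorem third_comm (x u w : Vec d) : third f x u w = third f x w u :=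
  (hs.contDiff_gradient.contDiffAt.isSymmSndFDerivAt (by simp; norm_num) :
    IsSymmSndFDerivAt ℝ (gradient f) x) u w

/-- Differentiate the symmetry of the Hessian in direction `a`. With `third_comm` this makes the
third derivative fully symmetric. -/
theorem inner_third_left (x a u w : Vec d) :
    inner ℝ (third f x a u) w = inner ℝ u (third f x a w) := by
  have h1 : HasFDerivAt (fun y => inner ℝ w (hessian f y u))
      ((innerSL ℝ w).comp ((ContinuousLinearMap.apply ℝ (Vec d) u).comp (third f x))) x :=
    (innerSL ℝ w).hasFDerivAt.comp x
      ((ContinuousLinearMap.apply ℝ (Vec d) u).hasFDerivAt.comp x (hs.hasFDerivAt_hessian x))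
  have h2 : HasFDerivAt (fun y => inner ℝ u (hessian f y w))
      ((innerSL ℝ u).comp ((ContinuousLinearMap.apply ℝ (Vec d) w).comp (third f x))) x :=
    (innerSL ℝ u).hasFDerivAt.comp x
      ((ContinuousLinearMap.apply ℝ (Vec d) w).hasFDerivAt.comp x (hs.hasFDerivAt_hessian x))
  have e : (fun y => inner ℝ w (hessian f y u)) = fun y => inner ℝ u (hessian f y w) := by
    ext y
    rw [real_inner_comm, hs.inner_hessian_left]
  rw [e] at h1
  have := congrArg (fun T : Vec d →L[ℝ] ℝ => T a) (h1.unique h2)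
  rw [real_inner_comm]
  simpa using this

theorem norm_iteratedFDeriv_gradient (x : Vec d) (n : ℕ) :
    ‖iteratedFDeriv ℝ n (gradient f) x‖ = ‖iteratedFDeriv ℝ (n + 1) f x‖ := by
  rw [gradient_eq_comp, LinearIsometryEquiv.norm_iteratedFDeriv_comp_left,
    norm_iteratedFDeriv_fderiv]

theorem norm_third_le (x : Vec d) : ‖third f x‖ ≤ L := by
  have h := hs.bound₃ x
  rw [← hs.norm_iteratedFDeriv_gradient, ← norm_iteratedFDeriv_fderiv,
    norm_iteratedFDeriv_one] at h
  exact h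

theorem third_lipschitz (x y : Vec d) : ‖third f x - third f y‖ ≤ L * ‖x - y‖ := by
  refine norm_sub_le_of_norm_iteratedFDeriv_one_le
    (hs.contDiff_third.differentiable (by norm_num)) (fun z => ?_) x y
  have h := hs.bound₄ z
  rw [← hs.norm_iteratedFDeriv_gradient, ← norm_iteratedFDeriv_fderiv,
    ← norm_iteratedFDeriv_fderiv] at h
  exact h

theorem hessian_lipschitz (x y : Vec d) : ‖hessian f x - hessian f y‖ ≤ L * ‖x - y‖ :=
  convex_univ.norm_image_sub_le_of_norm_fderiv_le
    (fun z _ => (hs.hasFDerivAt_hessian z).differentiableAt)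
    (fun z _ => hs.norm_third_le z) (Set.mem_univ y) (Set.mem_univ x)

theorem norm_hessian_le (x : Vec d) : ‖hessian f x‖ ≤ L :=
  norm_fderiv_le_of_lip' ℝ hs.nonneg₂ (Filter.Eventually.of_forall fun y => hs.lipschitz y x)

theorem hessian_taylor (x v : Vec d) :
    ‖hessian f (x + v) - hessian f x - third f x v‖ ≤ L * ‖v‖ ^ 2 :=
  norm_sub_sub_le_of_lipschitz_fderiv hs.nonneg₂ hs.hasFDerivAt_hessian hs.third_lipschitz x v

theorem gradient_taylor (x v : Vec d) :
    ‖gradient f (x + v) - gradient f x - hessian f x v‖ ≤ L * ‖v‖ ^ 2 :=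
  norm_sub_sub_le_of_lipschitz_fderiv hs.nonneg₂ hs.hasFDerivAt_gradient hs.hessian_lipschitz x v

theorem gradient_taylor_two (x v : Vec d) :
    ‖gradient f (x + v) - gradient f x - hessian f x v - (1 / 2 : ℝ) • third f x v v‖
      ≤ L * ‖v‖ ^ 3 := by
  -- The quadratic term is subtracted before the mean value inequality is applied. By symmetry its
  -- derivative at `w` is `third f x w`, without the factor `1 / 2`, so what remains is the Taylor
  -- remainder of the Hessian.
  have hder : ∀ w : Vec d, HasFDerivAt (fun w => gradient f (x + w) - (1 / 2 : ℝ) • third f x w w)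
      (hessian f (x + w) - third f x w) w := by
    intro w
    have h1 : HasFDerivAt (fun w => gradient f (x + w)) (hessian f (x + w)) w := by
      exact ((hs.hasFDerivAt_gradient (x + w)).comp w ((hasFDerivAt_id w).const_add x)).congr_fderiv
        (ContinuousLinearMap.comp_id _)
    have h2 : HasFDerivAt (fun w => third f x w w)
        ((third f x w).comp (ContinuousLinearMap.id ℝ (Vec d)) +
          (third f x).flip w) w :=
      (third f x).hasFDerivAt.clm_apply (hasFDerivAt_id w)
    refine (h1.sub (h2.const_smul (1 / 2 : ℝ))).congr_fderiv ?_
    congr 1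
    ext1 a
    simp only [smul_apply, add_apply,
      ContinuousLinearMap.comp_apply, ContinuousLinearMap.id_apply, ContinuousLinearMap.flip_apply]
    rw [hs.third_comm x a w, ← two_smul ℝ (third f x w a), smul_smul]
    norm_num
  have h := (convex_closedBall (0 : Vec d) ‖v‖).norm_image_sub_le_of_norm_hasFDerivWithin_le'
    (φ := hessian f x) (C := L * ‖v‖ ^ 2) (x := 0) (y := v)
    (fun y _ => (hder y).hasFDerivWithinAt)
    (fun y hy => by
      rw [mem_closedBall_zero_iff] at hy
      have := hs.hessian_taylor x y
      have hL := hs.nonneg₂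
      calc ‖hessian f (x + y) - third f x y - hessian f x‖
          = ‖hessian f (x + y) - hessian f x - third f x y‖ := by congr 1; abel
        _ ≤ L * ‖y‖ ^ 2 := this
        _ ≤ _ := by gcongr)
    (by simp) (by simp)
  simp only [add_zero, sub_zero, map_zero, smul_zero] at h
  calc _ = ‖gradient f (x + v) - (1 / 2 : ℝ) • third f x v v - gradient f x - hessian f x v‖ := by
        congr 1; abel
    _ ≤ L * ‖v‖ ^ 2 * ‖v‖ := h
    _ = _ := by ring

end SmoothBounded

theorem StronglyConvex.monotone (hc : StronglyConvex f μ) (x y : Vec d) :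
    μ * ‖x - y‖ ^ 2 ≤ inner ℝ (gradient f x - gradient f y) (x - y) := by
  have h1 := hc.lower x y
  have h2 := hc.lower y x
  have e1 : ‖y - x‖ = ‖x - y‖ := norm_sub_rev _ _
  have e2 : inner ℝ (gradient f x) (y - x) = -inner ℝ (gradient f x) (x - y) := by
    rw [← inner_neg_right, neg_sub]
  rw [e1, e2] at h2
  rw [inner_sub_left]
  linarith

section Convex

variable (hc : StronglyConvex f μ) (hs : SmoothBounded f L L L)
include hc hs

theorem hessian_lower (x u : Vec d) : μ * ‖u‖ ^ 2 ≤ inner ℝ (hessian f x u) u := by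
  have h1 : HasDerivAt (fun t : ℝ => inner ℝ (gradient f (x + t • u)) u)
      (inner ℝ (hessian f x u) u) 0 := by
    have h2 : HasDerivAt (fun t : ℝ => x + t • u) u 0 := by
      simpa using ((hasDerivAt_id (0 : ℝ)).smul_const u).const_add x
    have h3 : HasFDerivAt (gradient f) (hessian f x) (x + (0 : ℝ) • u) := by
      simpa using hs.hasFDerivAt_gradient x
    have h4 := (innerSL ℝ u).hasFDerivAt.comp_hasDerivAt (0 : ℝ) (h3.comp_hasDerivAt (0 : ℝ) h2)
    simpa [Function.comp_def, real_inner_comm] using h4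
  have h2 := hasDerivAt_iff_tendsto_slope_zero.1 h1
  refine ge_of_tendsto h2 (eventually_nhdsWithin_of_forall fun t ht => ?_)
  have ht0 : t ≠ 0 := ht
  have h3 := hc.monotone (x + t • u) x
  simp only [add_sub_cancel_left, norm_smul, inner_smul_right, Real.norm_eq_abs, mul_pow,
    sq_abs] at h3
  have ht2 : 0 < t ^ 2 := by positivity
  simp only [zero_add, zero_smul, add_zero, smul_eq_mul]
  rw [← inner_sub_left]
  have e : t⁻¹ * inner ℝ (gradient f (x + t • u) - gradient f x) u
      = (t * inner ℝ (gradient f (x + t • u) - gradient f x) u) / t ^ 2 := by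
    field_simp
  rw [e, le_div_iff₀ ht2]
  linarith

/-- The Hessian at `x + t • v` is positive for every real `t` and equals the Hessian at `x` plus `t`
times the third derivative, up to `L t ^ 2 ‖v‖ ^ 2`. Tested on `u`, this is a nonnegative quadratic
in `t`. -/
theorem third_sq_le (x u v : Vec d) :
    inner ℝ (third f x v u) u ^ 2 ≤ 4 * (L * ‖v‖ ^ 2 * ‖u‖ ^ 2) * inner ℝ (hessian f x u) u := by
  refine sq_le_of_forall_quadratic_nonneg fun t => ?_
  have h1 : 0 ≤ inner ℝ (hessian f (x + t • v) u) u :=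
    le_trans (mul_nonneg hc.pos.le (sq_nonneg _)) (hessian_lower hc hs _ u)
  have h2 := hs.hessian_taylor x (t • v)
  set R := hessian f (x + t • v) - hessian f x - third f x (t • v) with hR
  have h3 : inner ℝ (R u) u ≤ L * ‖t • v‖ ^ 2 * ‖u‖ ^ 2 := by
    calc inner ℝ (R u) u ≤ ‖R u‖ * ‖u‖ := real_inner_le_norm _ _
      _ ≤ ‖R‖ * ‖u‖ * ‖u‖ := by gcongr; exact R.le_opNorm u
      _ ≤ L * ‖t • v‖ ^ 2 * ‖u‖ * ‖u‖ := by gcongr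
      _ = _ := by ring
  have h4 : inner ℝ (R u) u = inner ℝ (hessian f (x + t • v) u) u - inner ℝ (hessian f x u) u
      - t * inner ℝ (third f x v u) u := by
    simp [hR, inner_sub_left, inner_smul_left]
  rw [norm_smul, mul_pow, Real.norm_eq_abs, sq_abs] at h3
  nlinarith

/-- Strong convexity replaces one factor `‖u‖ ^ 2` by the Hessian form divided by `μ`. Bounding the
third derivative by its norm would give `L / μ` in place of `√(L / μ)`. -/
theorem abs_inner_third_le (x u v : Vec d) :
    |inner ℝ (third f x v u) u| ≤ 2 * √(L / μ) * ‖v‖ * inner ℝ (hessian f x u) u := by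
  have h1 := third_sq_le hc hs x u v
  have h2 := hessian_lower hc hs x u
  have hμ := hc.pos
  have hL := hs.nonneg₂
  have h0 : 0 ≤ inner ℝ (hessian f x u) u := le_trans (by positivity) h2
  apply abs_le_of_sq_le_sq _ (by positivity)
  have e : (2 * √(L / μ) * ‖v‖ * inner ℝ (hessian f x u) u) ^ 2
      = 4 * (L * ‖v‖ ^ 2 * (inner ℝ (hessian f x u) u / μ)) * inner ℝ (hessian f x u) u := by
    rw [mul_pow, mul_pow, mul_pow, Real.sq_sqrt (by positivity)]
    field_simp
    ring
  rw [e]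
  refine h1.trans ?_
  gcongr
  rw [le_div_iff₀ hμ]
  linarith

/-- The nonlinear part of the gradient is controlled by the Bregman divergence. -/
theorem gradient_remainder_sq_le (x e : Vec d) :
    ‖gradient f (x + e) - gradient f x - hessian f x e‖ ^ 2 ≤
      4 * (L * ‖e‖ ^ 2) * (f (x + e) - f x - inner ℝ (gradient f x) e) := by
  -- The displacement `e` is frozen and the base point `w` varies. The Bregman divergence `Φ` is
  -- nonnegative, its gradient in `w` is exactly `N`, and `N` is Lipschitz with constant `L ‖e‖ ^ 2`
  -- by the Taylor bound for the Hessian.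
  set N : Vec d → Vec d := fun w => gradient f (w + e) - gradient f w - hessian f w e with hN
  set Φ : Vec d → ℝ := fun w => f (w + e) - f w - inner ℝ (gradient f w) e with hΦ
  have hL := hs.nonneg₂
  have hΦ0 : ∀ w, 0 ≤ Φ w := by
    intro w
    have h := hc.lower (w + e) w
    rw [add_sub_cancel_left] at h
    exact le_trans (by have := hc.pos; positivity) h
  have hNd : ∀ w, HasFDerivAt N (hessian f (w + e) - hessian f w - third f w e) w := by
    intro w
    have h1 : HasFDerivAt (fun w => gradient f (w + e)) (hessian f (w + e)) w := by
      exact ((hs.hasFDerivAt_gradient (w + e)).comp w ((hasFDerivAt_id w).add_const e)).congr_fderiv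
        (ContinuousLinearMap.comp_id _)
    have h2 : HasFDerivAt (fun w => hessian f w e) (third f w e) w := by
      have := (ContinuousLinearMap.apply ℝ (Vec d) e).hasFDerivAt.comp w (hs.hasFDerivAt_hessian w)
      refine this.congr_fderiv ?_
      ext1 a
      simp [hs.third_comm w e a]
    exact (h1.sub (hs.hasFDerivAt_gradient w)).sub h2
  have hNL : ∀ w w', ‖N w - N w'‖ ≤ L * ‖e‖ ^ 2 * ‖w - w'‖ := fun w w' =>
    convex_univ.norm_image_sub_le_of_norm_hasFDerivWithin_le
      (fun z _ => (hNd z).hasFDerivWithinAt) (fun z _ => hs.hessian_taylor z e)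
      (Set.mem_univ w') (Set.mem_univ w)
  have hΦd : ∀ w, HasFDerivAt Φ (innerSL ℝ (N w)) w := by
    intro w
    have h1 : HasFDerivAt (fun w => f (w + e)) (innerSL ℝ (gradient f (w + e))) w := by
      exact ((hs.hasFDerivAt (w + e)).comp w ((hasFDerivAt_id w).add_const e)).congr_fderiv
        (ContinuousLinearMap.comp_id _)
    have h3 : HasFDerivAt (fun w => inner ℝ e (gradient f w)) (innerSL ℝ (hessian f w e)) w := by
      have := (innerSL ℝ e).hasFDerivAt.comp w (hs.hasFDerivAt_gradient w)
      refine this.congr_fderiv ?_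
      ext1 a
      simp [hs.inner_hessian_left]
    have e1 : Φ = fun w => f (w + e) - f w - inner ℝ e (gradient f w) := by
      ext y; rw [hΦ, real_inner_comm]
    rw [e1]
    refine ((h1.sub (hs.hasFDerivAt w)).sub h3).congr_fderiv ?_
    rw [hN, ← map_sub, ← map_sub]
  have hstep := norm_sub_sub_le_of_lipschitz_fderiv (M := L * ‖e‖ ^ 2) (by positivity) hΦd
    (fun w w' => by
      rw [← map_sub, innerSL_apply_norm]
      exact hNL w w') x
  -- Moving the base point along its own gradient `N x` gives the quadratic; its discriminant is the
  -- claim times `‖N x‖ ^ 2`.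
  have hq : ∀ t : ℝ, 0 ≤ Φ x + t * ‖N x‖ ^ 2 + t ^ 2 * (L * ‖e‖ ^ 2 * ‖N x‖ ^ 2) := by
    intro t
    have h1 := (le_abs_self _).trans (hstep (t • N x))
    have h2 := hΦ0 (x + t • N x)
    rw [innerSL_apply_apply, inner_smul_right, real_inner_self_eq_norm_sq, norm_smul, mul_pow,
      Real.norm_eq_abs, sq_abs] at h1
    linarith
  have h := sq_le_of_forall_quadratic_nonneg hq
  rcases eq_or_ne (N x) 0 with h0 | h0
  · change ‖N x‖ ^ 2 ≤ 4 * (L * ‖e‖ ^ 2) * Φ x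
    rw [h0, norm_zero, zero_pow two_ne_zero]
    have := hΦ0 x
    exact mul_nonneg (by positivity) this
  · have hp : 0 < ‖N x‖ ^ 2 := by positivity
    change ‖N x‖ ^ 2 ≤ 4 * (L * ‖e‖ ^ 2) * Φ x
    nlinarith

/-- The Bregman divergence is at most its symmetrization, since the divergence with exchanged
arguments is nonnegative. -/
theorem gradient_remainder_sq_le_inner (x e : Vec d) :
    ‖gradient f (x + e) - gradient f x - hessian f x e‖ ^ 2 ≤
      4 * (L * ‖e‖ ^ 2) * inner ℝ (gradient f (x + e) - gradient f x) e := by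
  refine (gradient_remainder_sq_le hc hs x e).trans ?_
  have hL := hs.nonneg₂
  gcongr
  have h := hc.lower x (x + e)
  have h2 : 0 ≤ μ / 2 * ‖x - (x + e)‖ ^ 2 := by have := hc.pos; positivity
  rw [inner_sub_left]
  have e1 : x - (x + e) = -e := by abel
  rw [e1, inner_neg_right] at h
  rw [e1] at h2
  linarith

end Convex

end Calculus

/-! ### The Lyapunov equation for symmetric operators. -/

section Lyapunov

variable {E : Type*} [NormedAddCommGroup E] [InnerProductSpace ℝ E] [FiniteDimensional ℝ E]

/-- A symmetric solution of the Lyapunov equation `H X + X H = Q`, with an operator norm bound for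
a right-hand side that is dominated by `H`. -/
theorem exists_lyapunov {μ κ : ℝ} (hμ : 0 < μ) (hκ : 0 ≤ κ) {H Q : E →ₗ[ℝ] E}
    (hH : H.IsSymmetric) (hQ : Q.IsSymmetric) (hpos : ∀ u, μ * ‖u‖ ^ 2 ≤ inner ℝ (H u) u)
    (hQH : ∀ u, |inner ℝ (Q u) u| ≤ κ * inner ℝ (H u) u) :
    ∃ X : E →ₗ[ℝ] E, X.IsSymmetric ∧ (∀ u, 2 * inner ℝ (H u) (X u) = inner ℝ (Q u) u) ∧
      ∀ u, ‖X u‖ ≤ κ / 2 * ‖u‖ := by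
  let T : (E →ₗ[ℝ] E) →ₗ[ℝ] (E →ₗ[ℝ] E) := LinearMap.mulLeft ℝ H + LinearMap.mulRight ℝ H
  have hT : ∀ X u, T X u = H (X u) + X (H u) := fun X u => rfl
  -- If `T X = 0` and `b` is an eigenvector of `H` with eigenvalue `l ≥ μ`, then `H (X b) = -l X b`,
  -- which positivity of `H` permits only for `X b = 0`. In finite dimension injectivity yields a
  -- solution.
  have hinj : Function.Injective T := by
    rw [injective_iff_map_eq_zero]
    intro X hX
    refine (hH.eigenvectorBasis rfl).toBasis.ext fun i => ?_
    rw [OrthonormalBasis.coe_toBasis, LinearMap.zero_apply]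
    set b := hH.eigenvectorBasis rfl i
    have hb : H b = (hH.eigenvalues rfl i : ℝ) • b := hH.apply_eigenvectorBasis rfl i
    set l := hH.eigenvalues rfl i
    have hb1 : ‖b‖ = 1 := (hH.eigenvectorBasis rfl).orthonormal.1 i
    have hl : μ ≤ l := by
      have := hpos b
      rw [hb, inner_smul_left, real_inner_self_eq_norm_sq, hb1] at this
      simpa using this
    have h1 : H (X b) = -(l • X b) := by
      have h2 := hT X b
      rw [hX, LinearMap.zero_apply, hb, map_smul] at h2
      exact eq_neg_of_add_eq_zero_left h2.symm
    have h2 := hpos (X b)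
    rw [h1, inner_neg_left, inner_smul_left, real_inner_self_eq_norm_sq] at h2
    simp only [conj_trivial] at h2
    have h3 : ‖X b‖ ^ 2 = 0 := by
      have := sq_nonneg ‖X b‖
      nlinarith
    simpa using h3
  obtain ⟨X, hX⟩ := LinearMap.injective_iff_surjective.1 hinj Q
  have hXu : ∀ u, H (X u) + X (H u) = Q u := fun u => by rw [← hT, hX]
  -- The adjoint solves the same equation, and solutions are unique.
  have hsym : X.IsSymmetric := by
    have hadj : LinearMap.adjoint X = X := by
      apply hinj
      rw [hX]
      ext1 u
      refine ext_inner_right ℝ fun w => ?_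
      rw [hT, inner_add_left, hH, LinearMap.adjoint_inner_left, LinearMap.adjoint_inner_left, hH,
        ← inner_add_right, add_comm, hXu, hQ]
    intro u w
    conv_lhs => rw [← hadj]
    exact LinearMap.adjoint_inner_left X w u
  refine ⟨X, hsym, fun u => ?_, ?_⟩
  · rw [← hXu u, inner_add_left, hH (X u) u, hsym (H u) u, real_inner_comm]
    ring
  · let c := hsym.eigenvectorBasis rfl
    -- At an eigenvector of `X` the equation reads `⟨Q c, c⟩ = 2 λ ⟨H c, c⟩`, and the positive
    -- factor `⟨H c, c⟩` cancels against the domination hypothesis.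
    have hc : ∀ i, |hsym.eigenvalues rfl i| ≤ κ / 2 := by
      intro i
      have hci : X (c i) = (hsym.eigenvalues rfl i : ℝ) • c i := hsym.apply_eigenvectorBasis rfl i
      have hc1 : ‖c i‖ = 1 := c.orthonormal.1 i
      have h1 := hQH (c i)
      have h2 := hpos (c i)
      rw [hc1] at h2
      rw [← hXu, inner_add_left, hH (X (c i)), hsym (H (c i)), hci, inner_smul_left,
        inner_smul_right, real_inner_comm] at h1
      simp only [conj_trivial] at h1
      rw [← two_mul, abs_mul, abs_mul, abs_of_nonneg (by linarith : 0 ≤ inner ℝ (H (c i)) (c i)),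
        ← mul_assoc, abs_two] at h1
      have := le_of_mul_le_mul_right h1 (by linarith)
      linarith
    intro u
    have h1 := c.sum_sq_norm_inner_right (X u)
    have h2 := c.sum_sq_norm_inner_right u
    refine abs_le_of_sq_le_sq' ?_ (by positivity) |>.2
    rw [← h1, mul_pow, ← h2, Finset.mul_sum]
    refine Finset.sum_le_sum fun i _ => ?_
    rw [← hsym (c i) u, show X (c i) = (hsym.eigenvalues rfl i : ℝ) • c i from
      hsym.apply_eigenvectorBasis rfl i, inner_smul_left, norm_mul, mul_pow]
    gcongr
    simpa using hc i

end Lyapunov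

/-! ### One SGD step: mean-square estimates and contraction of the kernel. -/

section OneStep

variable {d : ℕ} {Z : Type*} [MeasurableSpace Z]

/-- The `L²` consequences of the assumptions on the objective and on the stochastic gradient;
`σ²` is the variance of the stochastic gradient at the minimizer. -/
structure SgdSetting (f : Vec d → ℝ) (g : Vec d → Z → Vec d) (ν : Measure Z) (θs : Vec d)
    (μ L σ : ℝ) : Prop where
  convex : StronglyConvex f μ
  smooth : SmoothBounded f L L L
  pos : 0 < L
  le : μ ≤ L
  crit : gradient f θs = 0
  meas : Measurable (fun x : Vec d × Z => g x.1 x.2)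
  integrable : ∀ θ, Integrable (g θ) ν
  unbiased : ∀ θ, ∫ z, g θ z ∂ν = gradient f θ
  integrable_sq : ∀ x y, Integrable (fun z => ‖g x z - g y z‖ ^ 2) ν
  cocoercive : ∀ x y, ∫ z, ‖g x z - g y z‖ ^ 2 ∂ν ≤
    L * inner ℝ (gradient f x - gradient f y) (x - y)
  integrable_var : Integrable (fun z => ‖g θs z‖ ^ 2) ν
  nonneg : 0 ≤ σ
  var : ∫ z, ‖g θs z‖ ^ 2 ∂ν = σ ^ 2

variable {f : Vec d → ℝ} {g : Vec d → Z → Vec d} {ν : Measure Z} [IsProbabilityMeasure ν]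
  {θs : Vec d} {μ L σ h : ℝ}

/-- One SGD step. -/
def step (g : Vec d → Z → Vec d) (h : ℝ) (x : Vec d) (z : Z) : Vec d := x - h • g x z

/-- The action of the SGD kernel on vector-valued functions. -/
noncomputable def kernelOp (g : Vec d → Z → Vec d) (ν : Measure Z) (h : ℝ) (v : Vec d → Vec d)
    (x : Vec d) : Vec d :=
  ∫ z, v (step g h x z) ∂ν

theorem integral_const_sub_add {a b : Z → ℝ} (ha : Integrable a ν) (hb : Integrable b ν)
    (c r t : ℝ) : ∫ z, (c - r * a z + t * b z) ∂ν = c - r * ∫ z, a z ∂ν + t * ∫ z, b z ∂ν := by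
  have i1 : Integrable (fun z => c - r * a z) ν := (integrable_const c).sub (ha.const_mul r)
  rw [integral_add i1 (hb.const_mul t), integral_sub (integrable_const c) (ha.const_mul r),
    integral_const_mul, integral_const_mul, integral_const, probReal_univ, one_smul]

namespace SgdSetting

variable (S : SgdSetting f g ν θs μ L σ)
include S

theorem measurable_apply (x : Vec d) : Measurable (g x) := S.meas.comp measurable_prodMk_left

theorem measurable_step : Measurable (fun x : Vec d × Z => step g h x.1 x.2) :=
  measurable_fst.sub (S.meas.const_smul h)

theorem measurable_step_apply (x : Vec d) : Measurable (step g h x) :=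
  S.measurable_step.comp measurable_prodMk_left

theorem monotone_crit (x : Vec d) : μ * ‖x - θs‖ ^ 2 ≤ inner ℝ (gradient f x) (x - θs) := by
  have := S.convex.monotone x θs
  rwa [S.crit, sub_zero] at this

theorem inner_nonneg (x : Vec d) : 0 ≤ inner ℝ (gradient f x) (x - θs) :=
  le_trans (mul_nonneg S.convex.pos.le (sq_nonneg _)) (S.monotone_crit x)

theorem integrable_norm_sq (x : Vec d) : Integrable (fun z => ‖g x z‖ ^ 2) ν := by
  refine (((S.integrable_sq x θs).const_mul 2).add (S.integrable_var.const_mul 2)).mono'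
    ((S.measurable_apply x).norm.pow_const 2).aestronglyMeasurable
    (Filter.Eventually.of_forall fun z => ?_)
  have h1 : ‖g x z‖ ≤ ‖g x z - g θs z‖ + ‖g θs z‖ := by
    simpa using norm_add_le (g x z - g θs z) (g θs z)
  rw [Real.norm_eq_abs, abs_of_nonneg (by positivity)]
  simp only [Pi.add_apply]
  nlinarith [norm_nonneg (g x z), sq_nonneg (‖g x z - g θs z‖ - ‖g θs z‖)]

theorem integral_norm_sq_le (x : Vec d) :
    ∫ z, ‖g x z‖ ^ 2 ∂ν ≤ 2 * L * inner ℝ (gradient f x) (x - θs) + 2 * σ ^ 2 := by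
  have h1 : ∫ z, ‖g x z‖ ^ 2 ∂ν ≤ ∫ z, (2 * ‖g x z - g θs z‖ ^ 2 + 2 * ‖g θs z‖ ^ 2) ∂ν := by
    refine integral_mono (S.integrable_norm_sq x)
      (((S.integrable_sq x θs).const_mul 2).add (S.integrable_var.const_mul 2)) fun z => ?_
    have h1 : ‖g x z‖ ≤ ‖g x z - g θs z‖ + ‖g θs z‖ := by
      simpa using norm_add_le (g x z - g θs z) (g θs z)
    simp only
    nlinarith [norm_nonneg (g x z), sq_nonneg (‖g x z - g θs z‖ - ‖g θs z‖)]
  rw [integral_add ((S.integrable_sq x θs).const_mul 2) (S.integrable_var.const_mul 2),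
    integral_const_mul, integral_const_mul, S.var] at h1
  have h2 := S.cocoercive x θs
  rw [S.crit, sub_zero] at h2
  linarith

theorem norm_sub_smul_sq (a b : Vec d) :
    ‖a - h • b‖ ^ 2 = ‖a‖ ^ 2 - 2 * h * inner ℝ a b + h ^ 2 * ‖b‖ ^ 2 := by
  rw [norm_sub_sq_real, inner_smul_right, norm_smul, mul_pow, Real.norm_eq_abs, sq_abs]
  ring

theorem integrable_step_sub_sq (x y : Vec d) :
    Integrable (fun z => ‖step g h x z - step g h y z‖ ^ 2) ν := by
  have e : ∀ z, ‖step g h x z - step g h y z‖ ^ 2 =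
      ‖x - y‖ ^ 2 - 2 * h * inner ℝ (x - y) (g x z - g y z) + h ^ 2 * ‖g x z - g y z‖ ^ 2 := by
    intro z
    rw [← S.norm_sub_smul_sq]
    congr 2
    simp only [step, smul_sub]
    abel
  simp only [e]
  exact ((integrable_const _).sub
    ((((S.integrable x).sub (S.integrable y)).const_inner (x - y)).const_mul _)).add
    ((S.integrable_sq x y).const_mul _)

/-- Both points are moved with the same noise. Co-coercivity bounds the second-order term by a
quarter of the drift `2 h ⟨∇f x - ∇f y, x - y⟩`, and strong convexity of the rest gives the factor.
-/
theorem integral_step_sub_sq_le (hh : 0 < h) (hL : h * L ≤ 1 / 2) (x y : Vec d) :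
    ∫ z, ‖step g h x z - step g h y z‖ ^ 2 ∂ν ≤ (1 - h * μ) * ‖x - y‖ ^ 2 := by
  have e : ∀ z, ‖step g h x z - step g h y z‖ ^ 2 =
      ‖x - y‖ ^ 2 - 2 * h * inner ℝ (x - y) (g x z - g y z) + h ^ 2 * ‖g x z - g y z‖ ^ 2 := by
    intro z
    rw [← S.norm_sub_smul_sq]
    congr 2
    simp only [step, smul_sub]
    abel
  simp only [e]
  have i0 : Integrable (fun z => g x z - g y z) ν := (S.integrable x).sub (S.integrable y)
  rw [integral_const_sub_add (i0.const_inner (x - y)) (S.integrable_sq x y), integral_inner i0,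
    integral_sub (S.integrable x) (S.integrable y), S.unbiased, S.unbiased]
  have h1 := S.cocoercive x y
  have h2 := S.convex.monotone x y
  rw [real_inner_comm] at h1 h2
  have h3 : h ^ 2 * ∫ z, ‖g x z - g y z‖ ^ 2 ∂ν ≤
      h ^ 2 * (L * inner ℝ (x - y) (gradient f x - gradient f y)) := by gcongr
  have h0 : 0 ≤ inner ℝ (x - y) (gradient f x - gradient f y) :=
    le_trans (mul_nonneg S.convex.pos.le (sq_nonneg _)) h2
  have h4 : h * (h * L) * inner ℝ (x - y) (gradient f x - gradient f y) ≤
      h * (1 / 2) * inner ℝ (x - y) (gradient f x - gradient f y) := by gcongr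
  have h5 : h * (μ * ‖x - y‖ ^ 2) ≤ h * inner ℝ (x - y) (gradient f x - gradient f y) := by
    gcongr
  have h6 : 0 ≤ h * inner ℝ (x - y) (gradient f x - gradient f y) := mul_nonneg hh.le h0
  nlinarith

theorem integrable_step_sq (x y : Vec d) : Integrable (fun z => ‖step g h x z - y‖ ^ 2) ν := by
  have e : ∀ z, ‖step g h x z - y‖ ^ 2 =
      ‖x - y‖ ^ 2 - 2 * h * inner ℝ (x - y) (g x z) + h ^ 2 * ‖g x z‖ ^ 2 := by
    intro z
    rw [← S.norm_sub_smul_sq]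
    congr 2
    simp only [step]
    abel
  simp only [e]
  exact ((integrable_const _).sub (((S.integrable x).const_inner (x - y)).const_mul _)).add
    ((S.integrable_norm_sq x).const_mul _)

/-- The drift is kept as `⟨∇f x, x - θs⟩` and not weakened to `μ ‖x - θs‖ ^ 2`: summed along the
chain it is the dissipation that controls the nonlinear part. -/
theorem integral_step_sq_le_sub (hh : 0 < h) (hL : h * L ≤ 1 / 2) (x : Vec d) :
    ∫ z, ‖step g h x z - θs‖ ^ 2 ∂ν ≤
      ‖x - θs‖ ^ 2 - h * inner ℝ (gradient f x) (x - θs) + 2 * h ^ 2 * σ ^ 2 := by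
  have e : ∀ z, ‖step g h x z - θs‖ ^ 2 =
      ‖x - θs‖ ^ 2 - 2 * h * inner ℝ (x - θs) (g x z) + h ^ 2 * ‖g x z‖ ^ 2 := by
    intro z
    rw [← S.norm_sub_smul_sq]
    congr 2
    simp only [step]
    abel
  simp only [e]
  rw [integral_const_sub_add ((S.integrable x).const_inner (x - θs)) (S.integrable_norm_sq x),
    integral_inner (S.integrable x), S.unbiased, real_inner_comm]
  have h1 := S.integral_norm_sq_le x
  have h3 : h ^ 2 * ∫ z, ‖g x z‖ ^ 2 ∂ν ≤
      h ^ 2 * (2 * L * inner ℝ (gradient f x) (x - θs) + 2 * σ ^ 2) := by gcongr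
  have h0 := S.inner_nonneg x
  have h4 : h * (h * L) * inner ℝ (gradient f x) (x - θs) ≤
      h * (1 / 2) * inner ℝ (gradient f x) (x - θs) := by gcongr
  nlinarith

theorem integral_step_sq_le (hh : 0 < h) (hL : h * L ≤ 1 / 2) (x : Vec d) :
    ∫ z, ‖step g h x z - θs‖ ^ 2 ∂ν ≤ (1 - h * μ) * ‖x - θs‖ ^ 2 + 2 * h ^ 2 * σ ^ 2 := by
  have h1 := S.integral_step_sq_le_sub hh hL x
  have h2 := mul_le_mul_of_nonneg_left (S.monotone_crit x) hh.le
  linarith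

end SgdSetting

/-- Local Lipschitz continuity with a linearly growing constant. -/
structure QuadLip (θs : Vec d) (s A : ℝ) (v : Vec d → Vec d) : Prop where
  nonneg : 0 ≤ A
  le : ∀ x y, ‖v x - v y‖ ≤ A * (‖x - y‖ * √(‖x - θs‖ ^ 2 + ‖y - θs‖ ^ 2 + s ^ 2))

namespace QuadLip

variable {s A B : ℝ} {v w : Vec d → Vec d}

theorem continuous (hv : QuadLip θs s A v) : Continuous v := by
  rw [continuous_iff_continuousAt]
  intro x
  refine tendsto_iff_norm_sub_tendsto_zero.2 (squeeze_zero (fun _ => norm_nonneg _)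
    (fun y => hv.le y x) ?_)
  have : Continuous fun y => A * (‖y - x‖ * √(‖y - θs‖ ^ 2 + ‖x - θs‖ ^ 2 + s ^ 2)) := by
    fun_prop
  simpa using this.tendsto x

theorem weaken (hv : QuadLip θs s A v) (h : A ≤ B) : QuadLip θs s B v :=
  ⟨hv.nonneg.trans h, fun x y => (hv.le x y).trans (by gcongr)⟩

theorem add (hv : QuadLip θs s A v) (hw : QuadLip θs s B w) :
    QuadLip θs s (A + B) (fun x => v x + w x) := by
  refine ⟨add_nonneg hv.nonneg hw.nonneg, fun x y => ?_⟩
  rw [add_sub_add_comm, add_mul]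
  exact (norm_add_le _ _).trans (add_le_add (hv.le x y) (hw.le x y))

theorem zero : QuadLip θs s 0 (fun _ => (0 : Vec d)) := ⟨le_rfl, by simp⟩

theorem norm_sub_le (hv : QuadLip θs s A v) (x : Vec d) :
    ‖v x - v θs‖ ≤ A * (‖x - θs‖ ^ 2 + s ^ 2) := by
  refine (hv.le x θs).trans ?_
  have hA := hv.nonneg
  gcongr
  rw [sub_self, norm_zero, zero_pow two_ne_zero, add_zero]
  set a := ‖x - θs‖
  have ha : 0 ≤ a := norm_nonneg _
  have h1 : a ≤ √(a ^ 2 + s ^ 2) := Real.le_sqrt_of_sq_le (by nlinarith [sq_nonneg s])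
  calc a * √(a ^ 2 + s ^ 2) ≤ √(a ^ 2 + s ^ 2) * √(a ^ 2 + s ^ 2) := by gcongr
    _ = _ := Real.mul_self_sqrt (by positivity)

theorem integrable_step (S : SgdSetting f g ν θs μ L σ) (hv : QuadLip θs s A v) (x : Vec d) :
    Integrable (fun z => v (step g h x z)) ν := by
  have h1 : Integrable (fun z => v (step g h x z) - v θs) ν := by
    refine (((S.integrable_step_sq x θs).add (integrable_const (s ^ 2))).const_mul A).mono'
      (((hv.continuous.measurable.comp (S.measurable_step_apply x)).sub_const
        (v θs)).aestronglyMeasurable) (Filter.Eventually.of_forall fun z => hv.norm_sub_le _)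
  exact (h1.add (integrable_const (v θs))).congr (Filter.Eventually.of_forall fun z => by simp)

/-- The SGD kernel is a contraction on functions with linearly growing Lipschitz constant. -/
theorem kernelOp (S : SgdSetting f g ν θs μ L σ) (hv : QuadLip θs s A v) (hh : 0 < h)
    (hL : h * L ≤ 1 / 2) (hs : 8 * h * σ ^ 2 ≤ μ * s ^ 2) :
    QuadLip θs s (√(1 - h * μ / 2) * A) (kernelOp g ν h v) := by
  refine ⟨mul_nonneg (Real.sqrt_nonneg _) hv.nonneg, fun x y => ?_⟩
  have hμ := S.convex.pos
  have hhμ : h * μ ≤ 1 / 2 := le_trans (by have := S.le; gcongr) hL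
  have hA := hv.nonneg
  have hX : LpLe ν 2 (fun z => step g h x z - step g h y z) (√(1 - h * μ) * ‖x - y‖) := by
    refine .of_integral ((S.measurable_step_apply x).sub
      (S.measurable_step_apply y)).aestronglyMeasurable two_pos (by positivity) ?_ ?_
    · simpa using S.integrable_step_sub_sq (h := h) x y
    · rw [Real.rpow_two, mul_pow, Real.sq_sqrt (by linarith)]
      simpa using S.integral_step_sub_sq_le hh hL x y
  set a := ‖x - θs‖ ^ 2 + ‖y - θs‖ ^ 2 + s ^ 2 with ha
  have ha0 : 0 ≤ a := by positivity
  have hYm : Measurable fun z => √(‖step g h x z - θs‖ ^ 2 + ‖step g h y z - θs‖ ^ 2 + s ^ 2) :=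
    ((((S.measurable_step_apply x).sub_const θs).norm.pow_const 2).add
      (((S.measurable_step_apply y).sub_const θs).norm.pow_const 2) |>.add_const _).sqrt
  have hsq : ∀ z, ‖√(‖step g h x z - θs‖ ^ 2 + ‖step g h y z - θs‖ ^ 2 + s ^ 2)‖ ^ (2 : ℝ) =
      ‖step g h x z - θs‖ ^ 2 + ‖step g h y z - θs‖ ^ 2 + s ^ 2 := by
    intro z
    rw [Real.rpow_two, Real.norm_eq_abs, sq_abs, Real.sq_sqrt (by positivity)]
  have i1 := S.integrable_step_sq (h := h) x θs
  have i2 := S.integrable_step_sq (h := h) y θs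
  have i3 : Integrable (fun z => ‖step g h x z - θs‖ ^ 2 + ‖step g h y z - θs‖ ^ 2) ν := i1.add i2
  -- The condition on `s` makes the noise `4 h ^ 2 σ ^ 2` of the two moved points at most `(h μ / 2)
  -- s ^ 2`, so the mean square of the weight grows by at most `1 + h μ / 2`.
  have hY : LpLe ν 2
      (fun z => √(‖step g h x z - θs‖ ^ 2 + ‖step g h y z - θs‖ ^ 2 + s ^ 2))
      (√(1 + h * μ / 2) * √a) := by
    refine .of_integral hYm.aestronglyMeasurable two_pos (by positivity) ?_ ?_
    · simp only [hsq]
      exact i3.add (integrable_const _)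
    · simp only [hsq]
      rw [integral_add i3 (integrable_const _), integral_add i1 i2, integral_const,
        probReal_univ, one_smul, Real.rpow_two, mul_pow, Real.sq_sqrt (by positivity),
        Real.sq_sqrt ha0]
      have h1 := S.integral_step_sq_le hh hL x
      have h2 := S.integral_step_sq_le hh hL y
      have h3 := mul_le_mul_of_nonneg_left hs hh.le
      have h4 : 0 ≤ h * μ * (‖x - θs‖ ^ 2 + ‖y - θs‖ ^ 2) := by positivity
      rw [ha]
      nlinarith
  -- Cauchy–Schwarz: the distance shrinks by `√(1 - h μ)`, the weight grows by at most `√(1 + h μ /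
  -- 2)`, and the product is at most `√(1 - h μ / 2)`.
  have hXY := hX.norm_mul_norm hY two_pos two_pos one_pos (by norm_num)
  have iv := fun x => hv.integrable_step (h := h) S x
  rw [RichardsonRomberg.kernelOp, RichardsonRomberg.kernelOp, ← integral_sub (iv x) (iv y)]
  calc ‖∫ z, (v (step g h x z) - v (step g h y z)) ∂ν‖
      ≤ ∫ z, ‖v (step g h x z) - v (step g h y z)‖ ∂ν := norm_integral_le_integral_norm _
    _ ≤ ∫ z, A * ‖‖step g h x z - step g h y z‖ *
        ‖√(‖step g h x z - θs‖ ^ 2 + ‖step g h y z - θs‖ ^ 2 + s ^ 2)‖‖ ∂ν := by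
        refine integral_mono ((iv x).sub (iv y)).norm ((hXY.integrable le_rfl).norm.const_mul A)
          fun z => ?_
        simp only [norm_mul, norm_norm]
        rw [Real.norm_eq_abs (√_), abs_of_nonneg (Real.sqrt_nonneg _)]
        exact hv.le _ _
    _ ≤ A * (√(1 - h * μ) * ‖x - y‖ * (√(1 + h * μ / 2) * √a)) := by
        rw [integral_const_mul]
        gcongr
        exact hXY.integral_norm_le le_rfl
    _ = √((1 - h * μ) * (1 + h * μ / 2)) * A * (‖x - y‖ * √a) := by
        rw [Real.sqrt_mul (by linarith)]; ring
    _ ≤ _ := by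
        gcongr
        nlinarith [mul_pos hh hμ]

theorem kernelOp_iterate (S : SgdSetting f g ν θs μ L σ) (hv : QuadLip θs s A v) (hh : 0 < h)
    (hL : h * L ≤ 1 / 2) (hs : 8 * h * σ ^ 2 ≤ μ * s ^ 2) (j : ℕ) :
    QuadLip θs s (√(1 - h * μ / 2) ^ j * A) ((RichardsonRomberg.kernelOp g ν h)^[j] v) := by
  induction j with
  | zero => simpa using hv
  | succ j ih =>
    rw [Function.iterate_succ_apply', pow_succ', mul_assoc]
    exact ih.kernelOp S hh hL hs

end QuadLip

end OneStep

/-! ### Martingale approximation along a subsampled chain. -/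

section Fluctuation

variable {d : ℕ} {Z : Type*} [MeasurableSpace Z] {Ω : Type*} [MeasurableSpace Ω]
  {f : Vec d → ℝ} {g : Vec d → Z → Vec d} {ν : Measure Z} [IsProbabilityMeasure ν]
  {P : Measure Ω} [IsProbabilityMeasure P] {θ₀ : Ω → Vec d} {ξ : ℕ → Ω → Z}
  {θs : Vec d} {μ L σ h s A p : ℝ} {v : Vec d → Vec d} {a : ℕ → ℝ}

theorem enorm_integral_rpow_le {E : Type*} [NormedAddCommGroup E] [NormedSpace ℝ E] {φ : Z → E}
    (hφ : AEStronglyMeasurable φ ν) (hp : 1 ≤ p) :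
    ‖∫ z, φ z ∂ν‖ₑ ^ p ≤ ∫⁻ z, ‖φ z‖ₑ ^ p ∂ν := by
  have hp0 : 0 < p := by linarith
  rw [← ENNReal.le_rpow_inv_iff hp0, ← one_div, ← eLpNorm_ofReal_eq hp0]
  calc ‖∫ z, φ z ∂ν‖ₑ ≤ ∫⁻ z, ‖φ z‖ₑ ∂ν := enorm_integral_le_lintegral_enorm _
    _ = eLpNorm φ 1 ν := eLpNorm_one_eq_lintegral_enorm.symm
    _ ≤ _ := eLpNorm_le_eLpNorm_of_exponent_le (by simpa using hp) hφ

variable (S : SgdSetting f g ν θs μ L σ) (H : NoiseModel ν P θ₀ ξ)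

section
include S H

theorem QuadLip.lpLe (hv : QuadLip θs s A v) (hp : 1 ≤ p) {k : ℕ} {b : ℝ}
    (ha : LpLe P (2 * p) (fun ω => chain g h θ₀ ξ k ω - θs) b) :
    LpLe P p (fun ω => v (chain g h θ₀ ξ k ω) - v θs) (A * (b ^ 2 + s ^ 2)) := by
  have h1 := ha.norm_pow two_pos (by linarith)
  rw [Nat.cast_ofNat, mul_div_cancel_left₀ _ two_ne_zero] at h1
  have h2 := (h1.add (LpLe.const (P := P) (q := p) (s ^ 2)) hp).const_smul A
  rw [abs_of_nonneg hv.nonneg, Real.norm_eq_abs, abs_of_nonneg (sq_nonneg s)] at h2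
  refine h2.mono ((hv.continuous.measurable.comp (H.measurable_chain S.meas k)).sub_const
    (v θs)).aestronglyMeasurable fun ω => (hv.norm_sub_le _).trans (le_abs_self _)

/-- Averaging over the next noise is a conditional expectation, so by Jensen it does not increase
the `L^p` distance to a constant. -/
theorem lpLe_kernelOp (hv : QuadLip θs s A v) (hp : 1 ≤ p) {k : ℕ} {c : Vec d} {B : ℝ}
    (hB : LpLe P p (fun ω => v (chain g h θ₀ ξ (k + 1) ω) - c) B) :
    LpLe P p (fun ω => kernelOp g ν h v (chain g h θ₀ ξ k ω) - c) B := by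
  have hm : Measurable (fun x : Vec d × Z => v (step g h x.1 x.2) - c) :=
    (hv.continuous.measurable.comp S.measurable_step).sub_const c
  have e : ∀ x, kernelOp g ν h v x - c = ∫ z, (v (step g h x z) - c) ∂ν := by
    intro x
    rw [integral_sub (hv.integrable_step S x) (integrable_const c), integral_const,
      probReal_univ, one_smul]
    rfl
  simp only [e]
  have hc := measurable_chain_past (θ₀ := θ₀) (ξ := ξ) (h := h) S.meas k
  have hm2 : StronglyMeasurable fun x : Vec d => ∫ z, (v (step g h x z) - c) ∂ν :=
    hm.stronglyMeasurable.integral_prod_right'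
  refine .of_lintegral (hm2.comp_measurable (H.measurable_chain S.meas k)).aestronglyMeasurable
    (by linarith) hB.nonneg ?_
  have h1 := hB.lintegral_le (by linarith)
  have h2 := H.lintegral_eq hc (φ := fun x => ‖v (step g h x.1 x.2) - c‖ₑ ^ p)
    (hm.enorm.pow_const p)
  refine le_trans (lintegral_mono fun ω => ?_) (h2.symm.le.trans h1)
  exact enorm_integral_rpow_le
    (hm.comp measurable_prodMk_left).aestronglyMeasurable hp

variable (hh : 0 < h) (hL : h * L ≤ 1 / 2) (hs : 8 * h * σ ^ 2 ≤ μ * s ^ 2)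
include hh hL hs

theorem lpLe_kernelOp_iterate (hp : 1 ≤ p) (m : ℕ) :
    ∀ {v : Vec d → Vec d} {A : ℝ}, QuadLip θs s A v → ∀ {k : ℕ} {c : Vec d} {B : ℝ},
    LpLe P p (fun ω => v (chain g h θ₀ ξ (k + m) ω) - c) B →
    LpLe P p (fun ω => (kernelOp g ν h)^[m] v (chain g h θ₀ ξ k ω) - c) B := by
  induction m with
  | zero => intro v A _ k c B hB; simpa using hB
  | succ m ih =>
    intro v A hv k c B hB
    rw [Function.iterate_succ_apply]
    exact ih (hv.kernelOp S hh hL hs) (lpLe_kernelOp S H hv hp hB)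

/-- An `m`-step increment is a telescoping sum of one-step increments, each centred given a past
that contains the past at time `k` and hence `T`. -/
theorem integral_inner_kernelOp_eq_zero (hp : 2 ≤ p)
    (ha : ∀ k, LpLe P (2 * p) (fun ω => chain g h θ₀ ξ k ω - θs) (a k)) {k : ℕ} {T : Ω → Vec d}
    {B : ℝ} (hT : Measurable[past θ₀ ξ k] T) (hTB : LpLe P p T B) (m : ℕ) :
    ∀ {v : Vec d → Vec d} {A : ℝ}, QuadLip θs s A v →
    ∫ ω, ‖T ω‖ ^ (p - 2) * inner ℝ (T ω) (v (chain g h θ₀ ξ (k + m) ω) -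
      (kernelOp g ν h)^[m] v (chain g h θ₀ ξ k ω)) ∂P = 0 := by
  have hp1 : 1 ≤ p := by linarith
  induction m with
  | zero => intro v A _; simp
  | succ m ih =>
    intro v A hv
    rw [Function.iterate_succ_apply]
    have hv' := hv.kernelOp S hh hL hs
    have hb1 := hv.lpLe S H hp1 (ha (k + m + 1))
    have hb2 := lpLe_kernelOp S H hv hp1 hb1
    have hb3 := lpLe_kernelOp_iterate S H hh hL hs hp1 m hv' hb2
    have hd1 : LpLe P p (fun ω => v (chain g h θ₀ ξ (k + m + 1) ω) -
        kernelOp g ν h v (chain g h θ₀ ξ (k + m) ω))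
        (A * (a (k + m + 1) ^ 2 + s ^ 2) + A * (a (k + m + 1) ^ 2 + s ^ 2)) := by
      simpa only [sub_sub_sub_cancel_right] using hb1.sub hb2 hp1
    have hd2 : LpLe P p (fun ω => kernelOp g ν h v (chain g h θ₀ ξ (k + m) ω) -
        (kernelOp g ν h)^[m] (kernelOp g ν h v) (chain g h θ₀ ξ k ω))
        (A * (a (k + m + 1) ^ 2 + s ^ 2) + A * (a (k + m + 1) ^ 2 + s ^ 2)) := by
      simpa only [sub_sub_sub_cancel_right] using hb2.sub hb3 hp1
    have h0 : ∫ ω, ‖T ω‖ ^ (p - 2) * inner ℝ (T ω) (v (chain g h θ₀ ξ (k + m + 1) ω) -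
        kernelOp g ν h v (chain g h θ₀ ξ (k + m) ω)) ∂P = 0 := by
      refine H.integral_inner_eq_zero (hT.mono (past_mono (Nat.le_add_right k m)) le_rfl)
        (measurable_chain_past S.meas (k + m))
        (φ := fun x => v (step g h x.1 x.2) - kernelOp g ν h v x.1) ?_ ?_ ?_ ?_
      · exact (hv.continuous.measurable.comp S.measurable_step).sub
          (hv'.continuous.measurable.comp measurable_fst)
      · exact fun y => (hv.integrable_step S y).sub (integrable_const (kernelOp g ν h v y))
      · intro y
        simp only
        rw [integral_sub (hv.integrable_step S y) (integrable_const _), integral_const,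
          probReal_univ, one_smul, kernelOp, sub_self]
      · exact hTB.integrable_rpow_mul_inner hp hd1
    have h1 := ih hv'
    have e : ∀ ω, ‖T ω‖ ^ (p - 2) * inner ℝ (T ω) (v (chain g h θ₀ ξ (k + (m + 1)) ω) -
        (kernelOp g ν h)^[m] (kernelOp g ν h v) (chain g h θ₀ ξ k ω)) =
        ‖T ω‖ ^ (p - 2) * inner ℝ (T ω) (v (chain g h θ₀ ξ (k + m + 1) ω) -
          kernelOp g ν h v (chain g h θ₀ ξ (k + m) ω)) +
        ‖T ω‖ ^ (p - 2) * inner ℝ (T ω) (kernelOp g ν h v (chain g h θ₀ ξ (k + m) ω) -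
          (kernelOp g ν h)^[m] (kernelOp g ν h v) (chain g h θ₀ ξ k ω)) := by
      intro ω
      rw [← mul_add, ← inner_add_right, sub_add_sub_cancel, add_assoc]
    simp only [e]
    rw [integral_add (hTB.integrable_rpow_mul_inner hp hd1)
      (hTB.integrable_rpow_mul_inner hp hd2), h0, h1, add_zero]

end

/-- Finite-horizon Poisson solutions for the `m`-step kernel. -/
noncomputable def poisson (g : Vec d → Z → Vec d) (ν : Measure Z) (h : ℝ) (m : ℕ)
    (v : Vec d → Vec d) : ℕ → Vec d → Vec d
  | 0 => fun _ => 0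
  | j + 1 => fun x => v x + (kernelOp g ν h)^[m] (poisson g ν h m v j) x

section
include S H
variable (hh : 0 < h) (hL : h * L ≤ 1 / 2) (hs : 8 * h * σ ^ 2 ≤ μ * s ^ 2)
include hh hL hs

omit H in
theorem poisson_quadLip (hv : QuadLip θs s A v) {m : ℕ} {r : ℝ} (hr1 : r < 1)
    (hr : √(1 - h * μ / 2) ^ m ≤ r) (j : ℕ) :
    QuadLip θs s (A / (1 - r)) (poisson g ν h m v j) := by
  have h1r : 0 < 1 - r := by linarith
  have hA := hv.nonneg
  induction j with
  | zero => exact QuadLip.zero.weaken (by positivity)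
  | succ j ih =>
    -- `A / (1 - r)` is the fixed point of `B ↦ A + r B`, so the bound does not depend on the
    -- horizon.
    refine (hv.add (ih.kernelOp_iterate S hh hL hs m)).weaken ?_
    calc A + √(1 - h * μ / 2) ^ m * (A / (1 - r)) ≤ A + r * (A / (1 - r)) := by gcongr
      _ = A / (1 - r) := by field_simp; ring

/-- The sum is an exact martingale sum. With the Poisson solutions `W j` of horizon `j`, the
increment at index `l ≥ 1` is `W (N - l)` at the new point minus its prediction from the previous
one, and the increment at index `0` is the centred `W N`. The shrinking horizon avoids a terminal
term, and the centring constant is `c`. -/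
theorem lpLe_subchain_sum (hp : 2 ≤ p) (hv : QuadLip θs s A v) {m : ℕ} (hm : 1 ≤ m) {r : ℝ}
    (hr1 : r < 1) (hr : √(1 - h * μ / 2) ^ m ≤ r)
    (ha : ∀ k, LpLe P (2 * p) (fun ω => chain g h θ₀ ξ k ω - θs) (a k)) (k₀ N : ℕ) :
    ∃ c : Vec d, LpLe P p
      (fun ω => ∑ l ∈ Finset.range N, v (chain g h θ₀ ξ (k₀ + l * m) ω) - c)
      √(10 * p * ∑ l ∈ Finset.range N, (2 * (A / (1 - r) * (a (k₀ + l * m) ^ 2 + s ^ 2))) ^ 2) := by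
  have hp1 : 1 ≤ p := by linarith
  set W := poisson g ν h m v with hW
  have hWq : ∀ j, QuadLip θs s (A / (1 - r)) (W j) := poisson_quadLip S hh hL hs hv hr1 hr
  set Y : ℕ → Ω → Vec d := fun l => chain g h θ₀ ξ (k₀ + l * m) with hY
  set D : ℕ → Ω → Vec d := fun l ω => match l with
    | 0 => W N (Y 0 ω) - ∫ ω', W N (Y 0 ω') ∂P
    | l + 1 => W (N - (l + 1)) (Y (l + 1) ω) - (kernelOp g ν h)^[m] (W (N - (l + 1))) (Y l ω)
    with hD
  have hYs : ∀ l, k₀ + (l + 1) * m = k₀ + l * m + m := fun l => by ring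
  have hWl : ∀ j l, LpLe P p (fun ω => W j (Y l ω) - W j θs)
      (A / (1 - r) * (a (k₀ + l * m) ^ 2 + s ^ 2)) := fun j l =>
    (hWq j).lpLe S H hp1 (ha _)
  have hDle : ∀ l, LpLe P p (D l) (2 * (A / (1 - r) * (a (k₀ + l * m) ^ 2 + s ^ 2))) := by
    intro l
    cases l with
    | zero =>
      have h1 := (hWl N 0).sub_integral hp1
      have hi : Integrable (fun ω => W N (Y 0 ω)) P := by
        have := ((hWl N 0).integrable hp1).add (integrable_const (W N θs))
        exact this.congr (Filter.Eventually.of_forall fun ω => by simp)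
      rw [integral_sub hi (integrable_const _), integral_const, probReal_univ, one_smul] at h1
      simpa only [hD, sub_sub_sub_cancel_right] using h1
    | succ l =>
      have h1 := hWl (N - (l + 1)) (l + 1)
      have h2 := h1
      simp only [hY, hYs] at h2
      have h3 := lpLe_kernelOp_iterate S H hh hL hs hp1 m (hWq (N - (l + 1))) h2
      have h4 := h1.sub (by simpa only [← hYs] using h3) hp1
      rw [← two_mul] at h4
      simpa only [hD, sub_sub_sub_cancel_right] using h4
  have hDpast : ∀ l, Measurable[past θ₀ ξ (k₀ + l * m)] (D l) := by
    intro l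
    cases l with
    | zero =>
      exact ((hWq N).continuous.measurable.comp (measurable_chain_past S.meas _)).sub_const _
    | succ l =>
      have h1 : Measurable[past θ₀ ξ (k₀ + (l + 1) * m)] (Y (l + 1)) :=
        measurable_chain_past S.meas _
      have h2 : Measurable[past θ₀ ξ (k₀ + (l + 1) * m)] (Y l) :=
        (measurable_chain_past S.meas (k₀ + l * m)).mono (past_mono (by rw [hYs]; omega)) le_rfl
      exact ((hWq _).continuous.measurable.comp h1).sub
        (((hWq _).kernelOp_iterate S hh hL hs m).continuous.measurable.comp h2)
  have horth : ∀ l < N, ∫ ω, ‖∑ i ∈ Finset.range l, D i ω‖ ^ (p - 2) *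
      inner ℝ (∑ i ∈ Finset.range l, D i ω) (D l ω) ∂P = 0 := by
    intro l _
    cases l with
    | zero => simp
    | succ l =>
      have hT : Measurable[past θ₀ ξ (k₀ + l * m)]
          (fun ω => ∑ i ∈ Finset.range (l + 1), D i ω) := by
        refine Finset.measurable_fun_sum _ fun i hi => ?_
        refine (hDpast i).mono (past_mono ?_) le_rfl
        have : i ≤ l := by simpa [Nat.lt_succ_iff] using hi
        gcongr
      have hTB := LpLe.sum (Finset.range (l + 1)) (fun i _ => hDle i) hp1
      have := integral_inner_kernelOp_eq_zero S H hh hL hs hp ha hT hTB m (hWq (N - (l + 1)))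
      simpa only [hD, hY, hYs] using this
  have hsum := LpLe.sum_of_orthogonal hp N (fun l _ => hDle l) horth
  refine ⟨∫ ω', W N (Y 0 ω') ∂P, ?_⟩
  rcases Nat.eq_zero_or_pos N with rfl | hN
  · have h0 : ∫ ω', W 0 (Y 0 ω') ∂P = 0 := by
      simp only [hW, poisson, integral_zero]
    rw [h0]
    simpa using LpLe.zero
  -- The recursion `W (j + 1) = v + Q^m (W j)`, with `Q` the kernel operator, cancels each
  -- prediction against the previous residue. The last residue has horizon `0` and vanishes.
  · have htel : ∀ j ≤ N - 1, ∀ ω, ∑ l ∈ Finset.range (j + 1), D l ω =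
        ∑ l ∈ Finset.range (j + 1), v (Y l ω) - ∫ ω', W N (Y 0 ω') ∂P
          + (kernelOp g ν h)^[m] (W (N - (j + 1))) (Y j ω) := by
      intro j
      induction j with
      | zero =>
        intro _ ω
        have e : W N = fun x => v x + (kernelOp g ν h)^[m] (W (N - 1)) x := by
          obtain ⟨M, rfl⟩ : ∃ M, N = M + 1 := ⟨N - 1, by omega⟩
          rfl
        simp only [zero_add, Finset.sum_range_one, hD]
        rw [congrFun e (Y 0 ω)]
        abel
      | succ j ih =>
        intro hj ω
        rw [Finset.sum_range_succ, ih (by omega), Finset.sum_range_succ _ (j + 1)]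
        have e : W (N - (j + 1)) =
            fun x => v x + (kernelOp g ν h)^[m] (W (N - (j + 1 + 1))) x := by
          obtain ⟨M, hM⟩ : ∃ M, N - (j + 1) = M + 1 := ⟨N - (j + 2), by omega⟩
          have hM' : N - (j + 1 + 1) = M := by omega
          rw [hM, hM']
          rfl
        have e2 : D (j + 1) ω = W (N - (j + 1)) (Y (j + 1) ω) -
            (kernelOp g ν h)^[m] (W (N - (j + 1))) (Y j ω) := rfl
        rw [e2, congrFun e (Y (j + 1) ω)]
        abel
    have hlast : ∀ ω, ∑ l ∈ Finset.range N, D l ω =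
        ∑ l ∈ Finset.range N, v (Y l ω) - ∫ ω', W N (Y 0 ω') ∂P := by
      intro ω
      have h1 := htel (N - 1) le_rfl ω
      rw [Nat.sub_add_cancel hN, Nat.sub_self] at h1
      have h2 : ∀ j, (kernelOp g ν h)^[j] (W 0) = fun _ => 0 := by
        intro j
        induction j with
        | zero => rfl
        | succ j ih =>
          rw [Function.iterate_succ_apply', ih]
          ext1 x
          simp [kernelOp]
      rw [h1, h2, add_zero]
    simpa only [hlast] using hsum

end

end Fluctuation

/-! ### Fluctuations of the full chain, by residue classes of the time index. -/

section ResidueClasses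

theorem sum_range_mul_eq {E : Type*} [AddCommMonoid E] (f : ℕ → E) (N m : ℕ) :
    ∑ k ∈ Finset.range (N * m), f k =
      ∑ s ∈ Finset.range m, ∑ l ∈ Finset.range N, f (s + l * m) := by
  induction N with
  | zero => simp
  | succ N ih =>
    rw [Nat.add_mul, one_mul, Finset.sum_range_add, ih]
    simp only [Finset.sum_range_succ, Finset.sum_add_distrib]
    congr 1
    exact Finset.sum_congr rfl fun s _ => by rw [add_comm]

/-- The transient `u` is measured in `ℓ¹`, where it is summable; only the constant level `w` pays
the factor `√N`. -/
theorem sqrt_sum_add_sq_le {u : ℕ → ℝ} (hu : ∀ l, 0 ≤ u l) {w : ℝ} (hw : 0 ≤ w) (N : ℕ) :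
    √(∑ l ∈ Finset.range N, (u l + w) ^ 2) ≤ ∑ l ∈ Finset.range N, u l + √N * w := by
  have hU : 0 ≤ ∑ l ∈ Finset.range N, u l := Finset.sum_nonneg fun l _ => hu l
  rw [Real.sqrt_le_left (by positivity)]
  rcases Nat.eq_zero_or_pos N with rfl | hN
  · simp
  have h1 : (1 : ℝ) ≤ √N := Real.one_le_sqrt.2 (by exact_mod_cast hN)
  have h2 : √(N : ℝ) ^ 2 = N := Real.sq_sqrt (by positivity)
  have h3 := Finset.sum_sq_le_sq_sum_of_nonneg (s := Finset.range N) (f := u) fun l _ => hu l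
  have h4 : ∑ l ∈ Finset.range N, (u l + w) ^ 2 =
      ∑ l ∈ Finset.range N, u l ^ 2 + 2 * w * ∑ l ∈ Finset.range N, u l + N * w ^ 2 := by
    rw [Finset.mul_sum, ← nsmul_eq_mul, ← Finset.card_range N, ← Finset.sum_const,
      Finset.card_range, ← Finset.sum_add_distrib, ← Finset.sum_add_distrib]
    exact Finset.sum_congr rfl fun l _ => by ring
  have h5 : w * (∑ l ∈ Finset.range N, u l) ≤ √N * (w * ∑ l ∈ Finset.range N, u l) :=
    le_mul_of_one_le_left (by positivity) h1
  rw [h4]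
  nlinarith

theorem sum_pow_le_inv {δ : ℝ} (hδ : 0 < δ) (hδ1 : δ ≤ 1) (n : ℕ) :
    ∑ k ∈ Finset.range n, (1 - δ) ^ k ≤ 1 / δ := by
  have h := mul_neg_geom_sum (1 - δ) n
  rw [sub_sub_cancel] at h
  rw [le_div_iff₀ hδ, mul_comm, h]
  have := pow_nonneg (sub_nonneg.2 hδ1) n
  linarith

/-- After `4 / δ` steps the kernel contracts by one half. -/
theorem sqrt_one_sub_pow_le {x δ : ℝ} (hx : δ ≤ x) {m : ℕ} (hm : 4 ≤ δ * m) :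
    √(1 - x / 2) ^ m ≤ 1 / 2 := by
  have h1 : √(1 - x / 2) ≤ Real.exp (-(δ / 4)) := by
    rw [Real.sqrt_le_left (Real.exp_pos _).le, ← Real.exp_nat_mul]
    have := Real.add_one_le_exp (-(δ / 2))
    refine le_trans (by linarith) (this.trans (le_of_eq ?_))
    congr 1
    push_cast
    ring
  have h2 : 2 ≤ Real.exp 1 := by linarith [Real.add_one_le_exp (1 : ℝ)]
  calc √(1 - x / 2) ^ m ≤ Real.exp (-(δ / 4)) ^ m := by gcongr
    _ = Real.exp (m * -(δ / 4)) := (Real.exp_nat_mul _ _).symm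
    _ ≤ Real.exp (-1) := by
        apply Real.exp_le_exp.2
        linarith
    _ = (Real.exp 1)⁻¹ := Real.exp_neg 1
    _ ≤ (2 : ℝ)⁻¹ := by gcongr
    _ = 1 / 2 := by norm_num

variable {d : ℕ} {Z : Type*} [MeasurableSpace Z] {Ω : Type*} [MeasurableSpace Ω]
  {f : Vec d → ℝ} {g : Vec d → Z → Vec d} {ν : Measure Z} [IsProbabilityMeasure ν]
  {P : Measure Ω} [IsProbabilityMeasure P] {θ₀ : Ω → Vec d} {ξ : ℕ → Ω → Z}
  {θs : Vec d} {μ L σ h s A p : ℝ} {v : Vec d → Vec d} {a : ℕ → ℝ}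

/-- Fluctuations of additive functionals of the SGD chain. -/
theorem lpLe_chain_sum_sub (S : SgdSetting f g ν θs μ L σ) (H : NoiseModel ν P θ₀ ξ)
    (hh : 0 < h) (hL : h * L ≤ 1 / 2) (hs : 8 * h * σ ^ 2 ≤ μ * s ^ 2) (hp : 2 ≤ p)
    (hv : QuadLip θs s A v) {δ T β : ℝ} (hδ : 0 < δ) (hδ1 : δ ≤ 1) (hδh : δ ≤ h * μ)
    (hT : 0 ≤ T) (hβ : 0 ≤ β)
    (ha : ∀ k, LpLe P (2 * p) (fun ω => chain g h θ₀ ξ k ω - θs) (a k))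
    (hat : ∀ k, a k ^ 2 ≤ (1 - δ) ^ k * T + β) (k₀ n : ℕ) :
    ∃ c : Vec d, LpLe P p
      (fun ω => ∑ k ∈ Finset.range n, v (chain g h θ₀ ξ (k₀ + k) ω) - c)
      (40 * √p * A * ((1 - δ) ^ k₀ * T / δ + √n / √δ * (β + s ^ 2))) := by
  have hp1 : 1 ≤ p := by linarith
  have hA := hv.nonneg
  have h1δ : 0 ≤ 1 - δ := by linarith
  have hsp : 1 ≤ √p := Real.one_le_sqrt.2 hp1
  set w := β + s ^ 2 with hw
  have hw0 : 0 ≤ w := by positivity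
  -- Solving the Poisson equation for single steps would cost a factor `1 / δ`. Along every `m`-th
  -- iterate the solutions have constant `2 A`, and the triangle inequality over `m` classes of
  -- length `n / m` gives `m √(n / m) = √(m n)`, of order `√(n / δ)`.
  set m := ⌈4 / δ⌉₊ with hmdef
  have hm4 : 4 ≤ δ * m := by
    have := Nat.le_ceil (4 / δ)
    rwa [div_le_iff₀ hδ, mul_comm] at this
  have hm5 : (m : ℝ) ≤ 5 / δ := by
    have h1 := (Nat.ceil_lt_add_one (a := 4 / δ) (by positivity)).le
    have h2 : 1 ≤ 1 / δ := by rwa [le_div_iff₀ hδ, one_mul]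
    calc (m : ℝ) ≤ 4 / δ + 1 := h1
      _ ≤ 4 / δ + 1 / δ := by linarith
      _ = 5 / δ := by ring
  have hm1 : 1 ≤ m := Nat.one_le_iff_ne_zero.2 fun h0 => by
    rw [h0] at hm4; norm_num at hm4
  have hr := sqrt_one_sub_pow_le hδh hm4
  set N := n / m with hN
  set R := n % m with hR
  have hn : N * m + R = n := Nat.div_add_mod' n m
  set t : ℕ → ℝ := fun k => (1 - δ) ^ (k₀ + k) * T with ht
  have ht0 : ∀ k, 0 ≤ t k := fun k => mul_nonneg (pow_nonneg h1δ _) hT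
  have hsub := fun i => lpLe_subchain_sum S H hh hL hs hp hv hm1 (r := 1 / 2) (by norm_num) hr ha
    (k₀ + i) N
  choose c hc using hsub
  have hc' : ∀ i, LpLe P p
      (fun ω => ∑ l ∈ Finset.range N, v (chain g h θ₀ ξ (k₀ + (i + l * m)) ω) - c i)
      (13 * √p * A * (∑ l ∈ Finset.range N, t (i + l * m) + √N * w)) := by
    intro i
    have h1 := hc i
    simp only [add_assoc k₀] at h1
    refine h1.weaken ?_
    have h2 : ∀ l, 2 * (A / (1 - 1 / 2) * (a (k₀ + (i + l * m)) ^ 2 + s ^ 2)) ≤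
        4 * A * (t (i + l * m) + w) := by
      intro l
      have h3 := hat (k₀ + (i + l * m))
      calc 2 * (A / (1 - 1 / 2) * (a (k₀ + (i + l * m)) ^ 2 + s ^ 2))
          = 4 * A * (a (k₀ + (i + l * m)) ^ 2 + s ^ 2) := by ring
        _ ≤ 4 * A * (t (i + l * m) + w) := by
          refine mul_le_mul_of_nonneg_left ?_ (by positivity)
          change _ ≤ (1 - δ) ^ (k₀ + (i + l * m)) * T + (β + s ^ 2)
          linarith
    calc √(10 * p * ∑ l ∈ Finset.range N,
          (2 * (A / (1 - 1 / 2) * (a (k₀ + (i + l * m)) ^ 2 + s ^ 2))) ^ 2)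
        ≤ √(10 * p * ∑ l ∈ Finset.range N, (4 * A * (t (i + l * m) + w)) ^ 2) := by
          have h0 : ∀ l, 0 ≤ 2 * (A / (1 - 1 / 2) * (a (k₀ + (i + l * m)) ^ 2 + s ^ 2)) := by
            intro l
            have : (0 : ℝ) ≤ A / (1 - 1 / 2) := div_nonneg hA (by norm_num)
            positivity
          refine Real.sqrt_le_sqrt (mul_le_mul_of_nonneg_left
            (Finset.sum_le_sum fun l _ => pow_le_pow_left₀ (h0 l) (h2 l) 2) (by positivity))
      _ = √(160 * p * A ^ 2 * ∑ l ∈ Finset.range N, (t (i + l * m) + w) ^ 2) := by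
          congr 1
          rw [Finset.mul_sum, Finset.mul_sum]
          exact Finset.sum_congr rfl fun l _ => by ring
      _ = √160 * √p * A * √(∑ l ∈ Finset.range N, (t (i + l * m) + w) ^ 2) := by
          rw [Real.sqrt_mul (by positivity), Real.sqrt_mul (by positivity),
            Real.sqrt_mul (by norm_num), Real.sqrt_sq hA]
      _ ≤ 13 * √p * A * (∑ l ∈ Finset.range N, t (i + l * m) + √N * w) := by
          have h160 : √160 ≤ 13 := by rw [Real.sqrt_le_left] <;> norm_num
          gcongr
          exact sqrt_sum_add_sq_le (fun l => ht0 _) hw0 N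
  have hmain := LpLe.sum (Finset.range m) (fun i _ => hc' i) hp1
  have hrem := LpLe.sum (Finset.range R)
    (fun i _ => hv.lpLe S H hp1 (ha (k₀ + (N * m + i)))) hp1
  refine ⟨∑ i ∈ Finset.range m, c i + ∑ i ∈ Finset.range R, v θs, ?_⟩
  have hsum := hmain.add hrem hp1
  have e : ∀ ω, ∑ k ∈ Finset.range n, v (chain g h θ₀ ξ (k₀ + k) ω) -
      (∑ i ∈ Finset.range m, c i + ∑ i ∈ Finset.range R, v θs) =
      ∑ i ∈ Finset.range m,
        (∑ l ∈ Finset.range N, v (chain g h θ₀ ξ (k₀ + (i + l * m)) ω) - c i) +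
      ∑ i ∈ Finset.range R, (v (chain g h θ₀ ξ (k₀ + (N * m + i)) ω) - v θs) := by
    intro ω
    rw [Finset.sum_sub_distrib, Finset.sum_sub_distrib, ← hn, Finset.sum_range_add,
      sum_range_mul_eq (fun k => v (chain g h θ₀ ξ (k₀ + k) ω))]
    abel
  simp only [e]
  refine hsum.weaken ?_
  have hmn : √((m : ℝ) * n) ≤ 5 / 2 * (√n / √δ) := by
    rw [Real.sqrt_le_left (by positivity), mul_pow, div_pow √(n : ℝ),
      Real.sq_sqrt (by positivity), Real.sq_sqrt hδ.le]
    calc (m : ℝ) * n ≤ 5 / δ * n := by gcongr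
      _ ≤ 25 / 4 * (n / δ) := by
        rw [div_mul_eq_mul_div, mul_div_assoc]
        have : (0 : ℝ) ≤ n / δ := by positivity
        linarith
      _ = _ := by norm_num
  have hmN : (m : ℝ) * √N ≤ √((m : ℝ) * n) := by
    refine Real.le_sqrt_of_sq_le ?_
    rw [mul_pow, Real.sq_sqrt (by positivity)]
    have : (N : ℝ) * m ≤ n := by exact_mod_cast (by omega : N * m ≤ n)
    calc (m : ℝ) ^ 2 * N = m * (N * m) := by ring
      _ ≤ m * n := by gcongr
  -- The `R` leftover terms are estimated one by one. As `R` is at most both `m` and `n`, they do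
  -- not exceed the main order.
  have hRmn : (R : ℝ) ≤ √((m : ℝ) * n) := by
    refine Real.le_sqrt_of_sq_le ?_
    have h1 : (R : ℝ) ≤ m := by exact_mod_cast (Nat.mod_lt n hm1).le
    have h2 : (R : ℝ) ≤ n := by exact_mod_cast Nat.mod_le n m
    rw [sq]
    gcongr
  have hS1 : ∑ i ∈ Finset.range m, ∑ l ∈ Finset.range N, t (i + l * m) =
      ∑ k ∈ Finset.range (N * m), t k := (sum_range_mul_eq t N m).symm
  have hS : ∑ k ∈ Finset.range (N * m), t k + ∑ i ∈ Finset.range R, t (N * m + i) ≤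
      (1 - δ) ^ k₀ * T / δ := by
    rw [← Finset.sum_range_add, hn]
    have h1 := mul_le_mul_of_nonneg_left (sum_pow_le_inv hδ hδ1 n)
      (mul_nonneg (pow_nonneg h1δ k₀) hT)
    rw [mul_one_div, Finset.mul_sum] at h1
    refine le_trans (le_of_eq (Finset.sum_congr rfl fun k _ => ?_)) h1
    rw [ht]
    simp only [pow_add]
    ring
  have hB1 : ∑ i ∈ Finset.range m,
      13 * √p * A * (∑ l ∈ Finset.range N, t (i + l * m) + √N * w) =
      13 * √p * A * (∑ k ∈ Finset.range (N * m), t k + m * √N * w) := by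
    rw [← Finset.mul_sum, Finset.sum_add_distrib, hS1, Finset.sum_const, Finset.card_range,
      nsmul_eq_mul, mul_assoc (m : ℝ)]
  have hB2 : ∑ i ∈ Finset.range R, A * (a (k₀ + (N * m + i)) ^ 2 + s ^ 2) ≤
      √p * A * (∑ i ∈ Finset.range R, t (N * m + i) + R * w) := by
    calc ∑ i ∈ Finset.range R, A * (a (k₀ + (N * m + i)) ^ 2 + s ^ 2)
        ≤ ∑ i ∈ Finset.range R, A * (t (N * m + i) + w) := by
          refine Finset.sum_le_sum fun i _ => mul_le_mul_of_nonneg_left ?_ hA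
          have h3 := hat (k₀ + (N * m + i))
          change _ ≤ (1 - δ) ^ (k₀ + (N * m + i)) * T + (β + s ^ 2)
          linarith
      _ = A * (∑ i ∈ Finset.range R, t (N * m + i) + R * w) := by
          rw [← Finset.mul_sum, Finset.sum_add_distrib, Finset.sum_const, Finset.card_range,
            nsmul_eq_mul]
      _ ≤ _ := by
          have h0 : 0 ≤ ∑ i ∈ Finset.range R, t (N * m + i) :=
            Finset.sum_nonneg fun i _ => ht0 _
          rw [mul_assoc]
          exact le_mul_of_one_le_left (by positivity) hsp
  rw [hB1]
  refine (add_le_add_right hB2 _).trans ?_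
  have hS0 : 0 ≤ ∑ k ∈ Finset.range (N * m), t k := Finset.sum_nonneg fun i _ => ht0 _
  have hS2 : 0 ≤ ∑ i ∈ Finset.range R, t (N * m + i) := Finset.sum_nonneg fun i _ => ht0 _
  have hpA : 0 ≤ √p * A := by positivity
  have hfin : 13 * (∑ k ∈ Finset.range (N * m), t k + m * √N * w) +
      (∑ i ∈ Finset.range R, t (N * m + i) + R * w) ≤
      40 * ((1 - δ) ^ k₀ * T / δ + √n / √δ * w) := by
    have h1 : m * √N * w ≤ 5 / 2 * (√n / √δ) * w :=
      mul_le_mul_of_nonneg_right (hmN.trans hmn) hw0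
    have h2 : R * w ≤ 5 / 2 * (√n / √δ) * w :=
      mul_le_mul_of_nonneg_right (hRmn.trans hmn) hw0
    have h3 : 0 ≤ √n / √δ * w := by positivity
    linarith
  have := mul_le_mul_of_nonneg_left hfin hpA
  linarith

end ResidueClasses

/-! ### The Lyapunov identity for one step from a fixed point. -/

section MeanBias

variable {d : ℕ} {Z : Type*} [MeasurableSpace Z] {Ω : Type*} [MeasurableSpace Ω]
  {f : Vec d → ℝ} {g : Vec d → Z → Vec d} {ν : Measure Z} [IsProbabilityMeasure ν]
  {P : Measure Ω} [IsProbabilityMeasure P] {θ₀ : Ω → Vec d} {ξ : ℕ → Ω → Z}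
  {θs : Vec d} {μ L σ h s : ℝ}

/-- The quadratic term in the expansion of the gradient at `θs`. -/
noncomputable def quadPart (f : Vec d → ℝ) (θs x : Vec d) : Vec d :=
  (1 / 2 : ℝ) • third f θs (x - θs) (x - θs)

/-- The nonlinear part of the gradient at `θs`. -/
noncomputable def nonlinPart (f : Vec d → ℝ) (θs x : Vec d) : Vec d :=
  gradient f x - hessian f θs (x - θs)

theorem quadLip_quadPart (hs : SmoothBounded f L L L) : QuadLip θs s L (quadPart f θs) := by
  refine ⟨hs.nonneg₂, fun x y => ?_⟩
  set a := x - θs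
  set b := y - θs
  have hxy : x - y = a - b := by simp [a, b]
  have e : quadPart f θs x - quadPart f θs y =
      (1 / 2 : ℝ) • (third f θs (a - b) a + third f θs b (a - b)) := by
    simp only [quadPart, a, b, ← smul_sub, map_sub, _root_.sub_apply]
    congr 1
    abel
  have h3 := hs.norm_third_le θs
  have hL := hs.nonneg₂
  have h1 : ∀ u w : Vec d, ‖third f θs u w‖ ≤ L * ‖u‖ * ‖w‖ := fun u w =>
    ((third f θs).le_opNorm₂ u w).trans (by gcongr)
  have h2 : (‖a‖ + ‖b‖) / 2 ≤ √(‖a‖ ^ 2 + ‖b‖ ^ 2 + s ^ 2) := by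
    refine Real.le_sqrt_of_sq_le ?_
    nlinarith [sq_nonneg (‖a‖ - ‖b‖), sq_nonneg s, sq_nonneg (‖a‖ + ‖b‖)]
  rw [e, norm_smul, hxy]
  calc ‖(1 / 2 : ℝ)‖ * ‖third f θs (a - b) a + third f θs b (a - b)‖
      ≤ 1 / 2 * (L * ‖a - b‖ * ‖a‖ + L * ‖b‖ * ‖a - b‖) := by
        rw [Real.norm_of_nonneg (by norm_num)]
        gcongr
        exact (norm_add_le _ _).trans (add_le_add (h1 _ _) (h1 _ _))
    _ = L * (‖a - b‖ * ((‖a‖ + ‖b‖) / 2)) := by ring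
    _ ≤ _ := by gcongr

namespace SgdSetting

variable (S : SgdSetting f g ν θs μ L σ)
include S

theorem norm_nonlinPart_le (x : Vec d) : ‖nonlinPart f θs x‖ ≤ L * ‖x - θs‖ ^ 2 := by
  have := S.smooth.gradient_taylor θs (x - θs)
  rwa [add_sub_cancel, S.crit, sub_zero] at this

theorem norm_nonlinPart_sub_le (x : Vec d) :
    ‖nonlinPart f θs x - quadPart f θs x‖ ≤ L * ‖x - θs‖ ^ 3 := by
  have := S.smooth.gradient_taylor_two θs (x - θs)
  rwa [add_sub_cancel, S.crit, sub_zero] at this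

/-- The self-bounding estimate gives `‖nonlinPart‖ ≤ 2 √L ‖e‖ √B` with `B = ⟨∇f x, e⟩`, and Young
splits the product. Paired with an `X` of norm `√(L / μ) ‖v‖`, the direct bound `L ‖e‖ ^ 3` would
lose a factor `√(L / μ)`, whereas here the dissipation `B` absorbs it. -/
theorem norm_nonlinPart_mul_norm_le {w : ℝ} (hw : 0 < w) (x : Vec d) :
    ‖nonlinPart f θs x‖ * ‖x - θs‖ ≤
      √L * (w * ‖x - θs‖ ^ 4 + inner ℝ (gradient f x) (x - θs) / w) := by
  have h := gradient_remainder_sq_le_inner S.convex S.smooth θs (x - θs)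
  rw [add_sub_cancel, S.crit, sub_zero] at h
  change ‖nonlinPart f θs x‖ ^ 2 ≤ _ at h
  have hB := S.inner_nonneg x
  have hL := S.pos
  set B := inner ℝ (gradient f x) (x - θs)
  set e := ‖x - θs‖
  have he : 0 ≤ e := norm_nonneg _
  have h1 : ‖nonlinPart f θs x‖ ≤ 2 * √L * e * √B := by
    refine abs_le_of_sq_le_sq' ?_ (by positivity) |>.2
    rw [mul_pow, mul_pow, mul_pow, Real.sq_sqrt hB, Real.sq_sqrt hL.le]
    linarith
  have h2 : 2 * e ^ 2 * √B ≤ w * e ^ 4 + B / w := by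
    have h3 : B / w = w * (√B / w) ^ 2 := by
      rw [div_pow, Real.sq_sqrt hB]; field_simp
    have h4 : 2 * e ^ 2 * √B = 2 * w * (e ^ 2 * (√B / w)) := by field_simp
    rw [h3, h4]
    nlinarith [mul_nonneg hw.le (sq_nonneg (e ^ 2 - √B / w))]
  calc ‖nonlinPart f θs x‖ * e ≤ 2 * √L * e * √B * e := by gcongr
    _ = √L * (2 * e ^ 2 * √B) := by ring
    _ ≤ _ := by gcongr

variable {X : Vec d →ₗ[ℝ] Vec d} {χ : ℝ}

theorem integrable_inner_apply (hXn : ∀ u, ‖X u‖ ≤ χ * ‖u‖) (x : Vec d) :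
    Integrable (fun z => inner ℝ (g x z) (X (g x z))) ν := by
  have hXc : Continuous X := X.continuous_of_finiteDimensional
  have hm := S.measurable_apply x
  refine ((S.integrable_norm_sq x).const_mul χ).mono'
    (hm.inner (hXc.measurable.comp hm)).aestronglyMeasurable
    (Filter.Eventually.of_forall fun z => ?_)
  calc ‖inner ℝ (g x z) (X (g x z))‖ ≤ ‖g x z‖ * ‖X (g x z)‖ := norm_inner_le_norm _ _
    _ ≤ ‖g x z‖ * (χ * ‖g x z‖) := by gcongr; exact hXn _
    _ = _ := by ring

/-- Expand the form around `g θs z`: the square of the difference is handled by co-coercivity, and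
the cross term by Young with a weight `l` left free for later balancing. -/
theorem abs_integral_inner_sub_le (hX : X.IsSymmetric) (hχ : 0 ≤ χ) (hXn : ∀ u, ‖X u‖ ≤ χ * ‖u‖)
    {l : ℝ} (hl : 0 < l) (x : Vec d) :
    |∫ z, inner ℝ (g x z) (X (g x z)) ∂ν - ∫ z, inner ℝ (g θs z) (X (g θs z)) ∂ν| ≤
      χ * ((L + L / l) * inner ℝ (gradient f x) (x - θs) + l * σ ^ 2) := by
  rw [← integral_sub (S.integrable_inner_apply hXn x) (S.integrable_inner_apply hXn θs),
    ← Real.norm_eq_abs]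
  have hpt : ∀ z, ‖inner ℝ (g x z) (X (g x z)) - inner ℝ (g θs z) (X (g θs z))‖ ≤
      χ * ((1 + 1 / l) * ‖g x z - g θs z‖ ^ 2 + l * ‖g θs z‖ ^ 2) := by
    intro z
    set a := g x z
    set b := g θs z
    have e : inner ℝ a (X a) - inner ℝ b (X b) =
        inner ℝ (a - b) (X (a - b)) + 2 * inner ℝ (a - b) (X b) := by
      have h1 : inner ℝ b (X a) = inner ℝ a (X b) := by
        rw [← hX b a, real_inner_comm]
      simp only [map_sub, inner_sub_left, inner_sub_right, h1]
      ring
    have h1 : |inner ℝ (a - b) (X (a - b))| ≤ χ * ‖a - b‖ ^ 2 := by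
      calc |inner ℝ (a - b) (X (a - b))| ≤ ‖a - b‖ * ‖X (a - b)‖ := abs_real_inner_le_norm _ _
        _ ≤ ‖a - b‖ * (χ * ‖a - b‖) := by gcongr; exact hXn _
        _ = _ := by ring
    have h2 : |inner ℝ (a - b) (X b)| ≤ χ * (‖a - b‖ * ‖b‖) := by
      calc |inner ℝ (a - b) (X b)| ≤ ‖a - b‖ * ‖X b‖ := abs_real_inner_le_norm _ _
        _ ≤ ‖a - b‖ * (χ * ‖b‖) := by gcongr; exact hXn _
        _ = _ := by ring
    have h3 : 2 * (‖a - b‖ * ‖b‖) ≤ 1 / l * ‖a - b‖ ^ 2 + l * ‖b‖ ^ 2 := by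
      have h4 : 1 / l * ‖a - b‖ ^ 2 = l * (‖a - b‖ / l) ^ 2 := by field_simp
      have h5 : 2 * (‖a - b‖ * ‖b‖) = 2 * l * ((‖a - b‖ / l) * ‖b‖) := by field_simp
      rw [h4, h5]
      nlinarith [mul_nonneg hl.le (sq_nonneg (‖a - b‖ / l - ‖b‖))]
    rw [e, Real.norm_eq_abs]
    refine (abs_add_le _ _).trans ?_
    rw [abs_mul, abs_two]
    have h6 := mul_le_mul_of_nonneg_left h3 hχ
    linarith
  have i1 := (S.integrable_sq x θs).const_mul (1 + 1 / l)
  have i2 := S.integrable_var.const_mul l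
  refine (norm_integral_le_integral_norm _).trans ?_
  calc ∫ z, ‖inner ℝ (g x z) (X (g x z)) - inner ℝ (g θs z) (X (g θs z))‖ ∂ν
      ≤ ∫ z, χ * ((1 + 1 / l) * ‖g x z - g θs z‖ ^ 2 + l * ‖g θs z‖ ^ 2) ∂ν :=
        integral_mono ((S.integrable_inner_apply hXn x).sub (S.integrable_inner_apply hXn θs)).norm
          ((i1.add i2).const_mul χ) hpt
    _ = χ * ((1 + 1 / l) * ∫ z, ‖g x z - g θs z‖ ^ 2 ∂ν + l * σ ^ 2) := by
        rw [integral_const_mul, integral_add i1 i2, integral_const_mul, integral_const_mul, S.var]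
    _ ≤ χ * ((1 + 1 / l) * (L * inner ℝ (gradient f x) (x - θs)) + l * σ ^ 2) := by
        have h2 := S.cocoercive x θs
        rw [S.crit, sub_zero] at h2
        gcongr
    _ = _ := by ring

theorem inner_step_eq (hX : X.IsSymmetric) (x : Vec d) (z : Z) :
    inner ℝ (step g h x z - θs) (X (step g h x z - θs)) =
      inner ℝ (x - θs) (X (x - θs)) - 2 * h * inner ℝ (X (x - θs)) (g x z) +
        h ^ 2 * inner ℝ (g x z) (X (g x z)) := by
  have e : step g h x z - θs = (x - θs) - h • g x z := by simp only [step]; abel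
  have h1 : inner ℝ (x - θs) (X (g x z)) = inner ℝ (X (x - θs)) (g x z) := (hX _ _).symm
  have h2 : inner ℝ (g x z) (X (x - θs)) = inner ℝ (X (x - θs)) (g x z) := real_inner_comm _ _
  rw [e, map_sub, map_smul]
  simp only [inner_sub_left, inner_sub_right, inner_smul_left, inner_smul_right, h1, h2]
  simp
  ring

/-- One step of the Lyapunov identity for the mean of the quadratic part. -/
theorem abs_lyapunov_step_le (hh : 0 < h) (hX : X.IsSymmetric) (hχ : 0 ≤ χ)
    (hXn : ∀ u, ‖X u‖ ≤ χ * ‖u‖) {v : Vec d}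
    (hXH : ∀ u, 2 * inner ℝ (hessian f θs u) (X u) = inner ℝ (third f θs v u) u)
    {w l : ℝ} (hw : 0 < w) (hl : 0 < l) (x : Vec d) :
    |2 * h * inner ℝ (quadPart f θs x) v - (inner ℝ (x - θs) (X (x - θs)) -
        ∫ z, inner ℝ (step g h x z - θs) (X (step g h x z - θs)) ∂ν) -
        h ^ 2 * ∫ z, inner ℝ (g θs z) (X (g θs z)) ∂ν| ≤
      χ * (2 * h * √L * w * ‖x - θs‖ ^ 4 +
        (2 * h * √L / w + h ^ 2 * (L + L / l)) * inner ℝ (gradient f x) (x - θs) +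
        h ^ 2 * (l * σ ^ 2)) := by
  simp only [S.inner_step_eq hX x]
  rw [integral_const_sub_add ((S.integrable x).const_inner _) (S.integrable_inner_apply hXn x),
    integral_inner (S.integrable x), S.unbiased]
  have h1 := S.abs_integral_inner_sub_le hX hχ hXn hl x
  have h2 := S.norm_nonlinPart_mul_norm_le hw x
  have h3 : |inner ℝ (X (x - θs)) (nonlinPart f θs x)| ≤
      χ * (‖nonlinPart f θs x‖ * ‖x - θs‖) := by
    calc |inner ℝ (X (x - θs)) (nonlinPart f θs x)|
        ≤ ‖X (x - θs)‖ * ‖nonlinPart f θs x‖ := abs_real_inner_le_norm _ _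
      _ ≤ χ * ‖x - θs‖ * ‖nonlinPart f θs x‖ := by gcongr; exact hXn _
      _ = _ := by ring
  -- This is the purpose of `X`: by the Lyapunov equation and the symmetry of the third derivative,
  -- `⟨X e, H e⟩ = ⟨quadPart, v⟩`.
  have h4 : inner ℝ (X (x - θs)) (nonlinPart f θs x) =
      inner ℝ (X (x - θs)) (gradient f x) - inner ℝ (quadPart f θs x) v := by
    rw [nonlinPart, inner_sub_right, real_inner_comm _ (hessian f θs (x - θs)) |>.symm]
    have h5 := hXH (x - θs)
    rw [S.smooth.third_comm, S.smooth.inner_third_left, S.smooth.third_comm] at h5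
    have h6 : inner ℝ (quadPart f θs x) v = 1 / 2 * inner ℝ v (third f θs (x - θs) (x - θs)) := by
      rw [quadPart, inner_smul_left, real_inner_comm]; simp
    rw [h6]
    linarith
  set a := ∫ z, inner ℝ (g x z) (X (g x z)) ∂ν
  set b := ∫ z, inner ℝ (g θs z) (X (g θs z)) ∂ν
  have e : 2 * h * inner ℝ (quadPart f θs x) v - (inner ℝ (x - θs) (X (x - θs)) -
        (inner ℝ (x - θs) (X (x - θs)) - 2 * h * inner ℝ (X (x - θs)) (gradient f x) +
          h ^ 2 * a)) - h ^ 2 * b =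
      -(2 * h * inner ℝ (X (x - θs)) (nonlinPart f θs x)) + h ^ 2 * (a - b) := by
    rw [h4]; ring
  rw [e]
  refine (abs_add_le _ _).trans ?_
  rw [abs_neg, abs_mul (2 * h), abs_mul (h ^ 2), abs_of_pos (by positivity : 0 < 2 * h),
    abs_of_pos (by positivity : 0 < h ^ 2)]
  have h7 := h3.trans (mul_le_mul_of_nonneg_left h2 hχ)
  have h8 := mul_le_mul_of_nonneg_left h7 (by positivity : 0 ≤ 2 * h)
  have h9 := mul_le_mul_of_nonneg_left h1 (by positivity : 0 ≤ h ^ 2)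
  refine (add_le_add h8 h9).trans (le_of_eq ?_)
  ring

end SgdSetting

end MeanBias

/-! ### The Lyapunov identity in expectation along the chain. -/

section MeanBias

variable {d : ℕ} {Z : Type*} [MeasurableSpace Z] {Ω : Type*} [MeasurableSpace Ω]
  {f : Vec d → ℝ} {g : Vec d → Z → Vec d} {ν : Measure Z} [IsProbabilityMeasure ν]
  {P : Measure Ω} [IsProbabilityMeasure P] {θ₀ : Ω → Vec d} {ξ : ℕ → Ω → Z}
  {θs : Vec d} {μ L σ h s : ℝ} {b : ℕ → ℝ}

theorem quadPart_self (f : Vec d → ℝ) (θs : Vec d) : quadPart f θs θs = 0 := by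
  simp [quadPart]

theorem lpLe_quadPart (S : SgdSetting f g ν θs μ L σ) (H : NoiseModel ν P θ₀ ξ) {p B : ℝ}
    (hp : 1 ≤ p) {k : ℕ} (ha : LpLe P (2 * p) (fun ω => chain g h θ₀ ξ k ω - θs) B) :
    LpLe P p (fun ω => quadPart f θs (chain g h θ₀ ξ k ω)) (L * B ^ 2) := by
  have := (quadLip_quadPart (s := 0) (θs := θs) S.smooth).lpLe S H hp ha
  simpa [quadPart_self] using this

variable (S : SgdSetting f g ν θs μ L σ) (H : NoiseModel ν P θ₀ ξ)
include S H

theorem integrable_inner_gradient {k : ℕ} {B : ℝ}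
    (ha : LpLe P 2 (fun ω => chain g h θ₀ ξ k ω - θs) B) :
    Integrable (fun ω => inner ℝ (gradient f (chain g h θ₀ ξ k ω)) (chain g h θ₀ ξ k ω - θs))
      P := by
  have h2 := (ha.integrable_rpow two_pos).const_mul L
  simp only [Real.rpow_two] at h2
  have hc : Continuous fun x => inner ℝ (gradient f x) (x - θs) :=
    S.smooth.contDiff_gradient.continuous.inner (continuous_id.sub continuous_const)
  refine h2.mono' (hc.measurable.comp (H.measurable_chain S.meas k)).aestronglyMeasurable
    (Filter.Eventually.of_forall fun ω => ?_)
  have h3 := S.smooth.lipschitz (chain g h θ₀ ξ k ω) θs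
  rw [S.crit, sub_zero] at h3
  refine (norm_inner_le_norm _ _).trans ?_
  calc _ ≤ L * ‖chain g h θ₀ ξ k ω - θs‖ * ‖chain g h θ₀ ξ k ω - θs‖ := by gcongr
    _ = _ := by ring

/-- Dissipation of the mean squared error in one step. -/
theorem mul_integral_inner_gradient_le (hh : 0 < h) (hL : h * L ≤ 1 / 2)
    (ha : ∀ k, LpLe P 2 (fun ω => chain g h θ₀ ξ k ω - θs) (b k)) (k : ℕ) :
    h * ∫ ω, inner ℝ (gradient f (chain g h θ₀ ξ k ω)) (chain g h θ₀ ξ k ω - θs) ∂P ≤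
      ∫ ω, ‖chain g h θ₀ ξ k ω - θs‖ ^ 2 ∂P - ∫ ω, ‖chain g h θ₀ ξ (k + 1) ω - θs‖ ^ 2 ∂P +
        2 * h ^ 2 * σ ^ 2 := by
  have i2 : ∀ k, Integrable (fun ω => ‖chain g h θ₀ ξ k ω - θs‖ ^ 2) P := fun k => by
    simpa using (ha k).integrable_rpow two_pos
  have iB := integrable_inner_gradient S H (ha k)
  have hc := measurable_chain_past (θ₀ := θ₀) (ξ := ξ) (h := h) S.meas k
  have hm : Measurable (fun x : Vec d × Z => ‖step g h x.1 x.2 - θs‖ ^ 2) :=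
    (S.measurable_step.sub_const θs).norm.pow_const 2
  have e1 := H.integral_eq hc hm.stronglyMeasurable (i2 (k + 1))
  have i3 := H.integrable_integral hc hm.stronglyMeasurable (i2 (k + 1))
  have e2 : ∫ ω, ‖chain g h θ₀ ξ (k + 1) ω - θs‖ ^ 2 ∂P =
      ∫ ω, ∫ z, ‖step g h (chain g h θ₀ ξ k ω) z - θs‖ ^ 2 ∂ν ∂P := e1
  have i4 : Integrable (fun ω => ‖chain g h θ₀ ξ k ω - θs‖ ^ 2 -
      h * inner ℝ (gradient f (chain g h θ₀ ξ k ω)) (chain g h θ₀ ξ k ω - θs)) P :=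
    (i2 k).sub (iB.const_mul h)
  have h1 := integral_mono i3 (i4.add (integrable_const (2 * h ^ 2 * σ ^ 2)))
    fun ω => S.integral_step_sq_le_sub hh hL (chain g h θ₀ ξ k ω)
  rw [integral_add' i4 (integrable_const _), integral_sub (i2 k) (iB.const_mul h),
    integral_const_mul, integral_const, probReal_univ, one_smul] at h1
  rw [e2]
  change ∫ ω, ∫ z, ‖step g h (chain g h θ₀ ξ k ω) z - θs‖ ^ 2 ∂ν ∂P ≤ _ at h1
  linarith

variable {X : Vec d →ₗ[ℝ] Vec d} {χ : ℝ}

theorem integrable_inner_chain (hXn : ∀ u, ‖X u‖ ≤ χ * ‖u‖)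
    (ha : ∀ k, LpLe P 2 (fun ω => chain g h θ₀ ξ k ω - θs) (b k)) (k : ℕ) :
    Integrable (fun ω => inner ℝ (chain g h θ₀ ξ k ω - θs) (X (chain g h θ₀ ξ k ω - θs))) P := by
  have hXc : Continuous X := X.continuous_of_finiteDimensional
  have hm := (H.measurable_chain (h := h) S.meas k).sub_const θs
  have h2 := ((ha k).integrable_rpow two_pos).const_mul χ
  simp only [Real.rpow_two] at h2
  refine h2.mono' (hm.inner (hXc.measurable.comp hm)).aestronglyMeasurable
    (Filter.Eventually.of_forall fun ω => ?_)
  refine (norm_inner_le_norm _ _).trans ?_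
  calc _ ≤ ‖chain g h θ₀ ξ k ω - θs‖ * (χ * ‖chain g h θ₀ ξ k ω - θs‖) := by gcongr; exact hXn _
    _ = _ := by ring

theorem abs_integral_inner_chain_le (hXn : ∀ u, ‖X u‖ ≤ χ * ‖u‖)
    (ha : ∀ k, LpLe P 2 (fun ω => chain g h θ₀ ξ k ω - θs) (b k)) (k : ℕ) :
    |∫ ω, inner ℝ (chain g h θ₀ ξ k ω - θs) (X (chain g h θ₀ ξ k ω - θs)) ∂P| ≤
      χ * ∫ ω, ‖chain g h θ₀ ξ k ω - θs‖ ^ 2 ∂P := by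
  have i2 : Integrable (fun ω => ‖chain g h θ₀ ξ k ω - θs‖ ^ 2) P := by
    simpa using (ha k).integrable_rpow two_pos
  rw [← integral_const_mul]
  refine (norm_integral_le_integral_norm _).trans
    (integral_mono (integrable_inner_chain S H hXn ha k).norm (i2.const_mul χ) fun ω => ?_)
  refine (norm_inner_le_norm _ _).trans ?_
  calc _ ≤ ‖chain g h θ₀ ξ k ω - θs‖ * (χ * ‖chain g h θ₀ ξ k ω - θs‖) := by gcongr; exact hXn _
    _ = _ := by ring

/-- In expectation the dissipation is replaced by the one-step drop of the mean squared error, so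
every part of the bound is a telescoping difference, a constant or a fourth moment. -/
theorem abs_lyapunov_mean_step_le (hh : 0 < h) (hL : h * L ≤ 1 / 2) (hX : X.IsSymmetric)
    (hχ : 0 ≤ χ) (hXn : ∀ u, ‖X u‖ ≤ χ * ‖u‖) {v : Vec d}
    (hXH : ∀ u, 2 * inner ℝ (hessian f θs u) (X u) = inner ℝ (third f θs v u) u)
    {w l : ℝ} (hw : 0 < w) (hl : 0 < l)
    (ha : ∀ k, LpLe P 4 (fun ω => chain g h θ₀ ξ k ω - θs) (b k)) (k : ℕ) :
    |2 * h * inner ℝ v (∫ ω, quadPart f θs (chain g h θ₀ ξ k ω) ∂P) -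
        (∫ ω, inner ℝ (chain g h θ₀ ξ k ω - θs) (X (chain g h θ₀ ξ k ω - θs)) ∂P -
        ∫ ω, inner ℝ (chain g h θ₀ ξ (k + 1) ω - θs) (X (chain g h θ₀ ξ (k + 1) ω - θs)) ∂P) -
        h ^ 2 * ∫ z, inner ℝ (g θs z) (X (g θs z)) ∂ν| ≤
      χ * (2 * h * √L * w * b k ^ 4 + (2 * √L / w + h * (L + L / l)) *
        (∫ ω, ‖chain g h θ₀ ξ k ω - θs‖ ^ 2 ∂P - ∫ ω, ‖chain g h θ₀ ξ (k + 1) ω - θs‖ ^ 2 ∂P +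
        2 * h ^ 2 * σ ^ 2) + h ^ 2 * (l * σ ^ 2)) := by
  have ha2 : ∀ k, LpLe P 2 (fun ω => chain g h θ₀ ξ k ω - θs) (b k) := fun k =>
    (ha k).exponent_mono (by norm_num)
  have hXc : Continuous X := X.continuous_of_finiteDimensional
  have hc := measurable_chain_past (θ₀ := θ₀) (ξ := ξ) (h := h) S.meas k
  have hm1 : Measurable (fun x : Vec d × Z => step g h x.1 x.2 - θs) :=
    S.measurable_step.sub_const θs
  have hm : Measurable (fun x : Vec d × Z =>
      inner ℝ (step g h x.1 x.2 - θs) (X (step g h x.1 x.2 - θs))) :=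
    hm1.inner (hXc.measurable.comp hm1)
  have iΦ := integrable_inner_chain S H hXn ha2
  have e1 : ∫ ω, inner ℝ (chain g h θ₀ ξ (k + 1) ω - θs) (X (chain g h θ₀ ξ (k + 1) ω - θs)) ∂P =
      ∫ ω, ∫ z, inner ℝ (step g h (chain g h θ₀ ξ k ω) z - θs)
        (X (step g h (chain g h θ₀ ξ k ω) z - θs)) ∂ν ∂P :=
    H.integral_eq hc hm.stronglyMeasurable (iΦ (k + 1))
  have i1 : Integrable (fun ω => ∫ z, inner ℝ (step g h (chain g h θ₀ ξ k ω) z - θs)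
        (X (step g h (chain g h θ₀ ξ k ω) z - θs)) ∂ν) P :=
    H.integrable_integral hc hm.stronglyMeasurable (iΦ (k + 1))
  have hψ : Integrable (fun ω => quadPart f θs (chain g h θ₀ ξ k ω)) P :=
    (lpLe_quadPart S H (p := 2) one_le_two (by norm_num; exact ha k)).integrable one_le_two
  have iψ : Integrable (fun ω => inner ℝ (quadPart f θs (chain g h θ₀ ξ k ω)) v) P :=
    hψ.inner_const v
  have e2 : inner ℝ v (∫ ω, quadPart f θs (chain g h θ₀ ξ k ω) ∂P) =
      ∫ ω, inner ℝ (quadPart f θs (chain g h θ₀ ξ k ω)) v ∂P := by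
    rw [← integral_inner hψ]
    exact integral_congr_ae (Filter.Eventually.of_forall fun ω => real_inner_comm _ _)
  have iB := integrable_inner_gradient S H (ha2 k)
  have hB := mul_integral_inner_gradient_le S H hh hL ha2 k
  have i4 : Integrable (fun ω => ‖chain g h θ₀ ξ k ω - θs‖ ^ 4) P := by
    have := (ha k).integrable_rpow (by norm_num)
    exact_mod_cast this
  have h4 : ∫ ω, ‖chain g h θ₀ ξ k ω - θs‖ ^ 4 ∂P ≤ b k ^ 4 := by
    have := (ha k).integral_rpow_le (by norm_num)
    exact_mod_cast this
  set G := ∫ z, inner ℝ (g θs z) (X (g θs z)) ∂ν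
  have i5 : Integrable (fun ω => inner ℝ (chain g h θ₀ ξ k ω - θs) (X (chain g h θ₀ ξ k ω - θs)) -
      ∫ z, inner ℝ (step g h (chain g h θ₀ ξ k ω) z - θs)
        (X (step g h (chain g h θ₀ ξ k ω) z - θs)) ∂ν) P := (iΦ k).sub i1
  have i6 : Integrable (fun ω => 2 * h * inner ℝ (quadPart f θs (chain g h θ₀ ξ k ω)) v -
      (inner ℝ (chain g h θ₀ ξ k ω - θs) (X (chain g h θ₀ ξ k ω - θs)) -
      ∫ z, inner ℝ (step g h (chain g h θ₀ ξ k ω) z - θs)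
        (X (step g h (chain g h θ₀ ξ k ω) z - θs)) ∂ν)) P := (iψ.const_mul (2 * h)).sub i5
  have i7 : Integrable (fun ω => 2 * h * √L * w * ‖chain g h θ₀ ξ k ω - θs‖ ^ 4 +
      (2 * h * √L / w + h ^ 2 * (L + L / l)) *
        inner ℝ (gradient f (chain g h θ₀ ξ k ω)) (chain g h θ₀ ξ k ω - θs)) P :=
    (i4.const_mul _).add (iB.const_mul _)
  have e3 : 2 * h * inner ℝ v (∫ ω, quadPart f θs (chain g h θ₀ ξ k ω) ∂P) -
        (∫ ω, inner ℝ (chain g h θ₀ ξ k ω - θs) (X (chain g h θ₀ ξ k ω - θs)) ∂P -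
        ∫ ω, inner ℝ (chain g h θ₀ ξ (k + 1) ω - θs) (X (chain g h θ₀ ξ (k + 1) ω - θs)) ∂P) -
        h ^ 2 * G =
      ∫ ω, (2 * h * inner ℝ (quadPart f θs (chain g h θ₀ ξ k ω)) v -
        (inner ℝ (chain g h θ₀ ξ k ω - θs) (X (chain g h θ₀ ξ k ω - θs)) -
        ∫ z, inner ℝ (step g h (chain g h θ₀ ξ k ω) z - θs)
          (X (step g h (chain g h θ₀ ξ k ω) z - θs)) ∂ν) - h ^ 2 * G) ∂P := by
    rw [integral_sub i6 (integrable_const _), integral_sub (iψ.const_mul (2 * h)) i5,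
      integral_sub (iΦ k) i1, integral_const_mul, integral_const, probReal_univ, one_smul, e1, e2]
  rw [e3, ← Real.norm_eq_abs]
  refine (norm_integral_le_integral_norm _).trans ?_
  refine (integral_mono (i6.sub (integrable_const _)).norm
    ((i7.add (integrable_const (h ^ 2 * (l * σ ^ 2)))).const_mul χ)
    fun ω => S.abs_lyapunov_step_le hh hX hχ hXn hXH hw hl (chain g h θ₀ ξ k ω)).trans ?_
  rw [integral_const_mul, integral_add' i7 (integrable_const _),
    integral_add (i4.const_mul _) (iB.const_mul _), integral_const_mul, integral_const_mul,
    integral_const, probReal_univ, one_smul]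
  have hLp := S.pos
  have e4 : (2 * h * √L / w + h ^ 2 * (L + L / l)) *
      ∫ ω, inner ℝ (gradient f (chain g h θ₀ ξ k ω)) (chain g h θ₀ ξ k ω - θs) ∂P =
      (2 * √L / w + h * (L + L / l)) *
      (h * ∫ ω, inner ℝ (gradient f (chain g h θ₀ ξ k ω)) (chain g h θ₀ ξ k ω - θs) ∂P) := by
    ring
  rw [e4]
  gcongr

end MeanBias

/-! ### The mean of the quadratic part is linear in the step size. -/

section MeanBias

variable {d : ℕ} {Z : Type*} [MeasurableSpace Z] {Ω : Type*} [MeasurableSpace Ω]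
  {f : Vec d → ℝ} {g : Vec d → Z → Vec d} {ν : Measure Z} [IsProbabilityMeasure ν]
  {P : Measure Ω} [IsProbabilityMeasure P] {θ₀ : Ω → Vec d} {ξ : ℕ → Ω → Z}
  {θs : Vec d} {μ L σ : ℝ}

theorem exists_lyapunov_third (hc : StronglyConvex f μ) (hs : SmoothBounded f L L L)
    (x v : Vec d) : ∃ X : Vec d →ₗ[ℝ] Vec d, X.IsSymmetric ∧
      (∀ u, 2 * inner ℝ (hessian f x u) (X u) = inner ℝ (third f x v u) u) ∧
      ∀ u, ‖X u‖ ≤ √(L / μ) * ‖v‖ * ‖u‖ := by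
  obtain ⟨X, hX, h1, h2⟩ := exists_lyapunov hc.pos (κ := 2 * √(L / μ) * ‖v‖) (by positivity)
    (H := (hessian f x).toLinearMap) (Q := (third f x v).toLinearMap)
    (fun u w => hs.inner_hessian_left x u w) (fun u w => hs.inner_third_left x v u w)
    (hessian_lower hc hs x) (fun u => abs_inner_third_le hc hs x u v)
  refine ⟨X, hX, h1, fun u => (h2 u).trans (le_of_eq ?_)⟩
  ring

/-- Up to an error of higher order, the bias of the quadratic part is linear in the step size. -/
theorem exists_mean_bias (S : SgdSetting f g ν θs μ L σ) (H : NoiseModel ν P θ₀ ξ) (v : Vec d) :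
    ∃ c : ℝ, ∀ {h E u : ℝ} {b : ℕ → ℝ} {k₀ n : ℕ}, 0 < h → h * L ≤ 1 / 2 → 0 < u →
      1 ≤ n * (h * μ) → (∀ k, LpLe P 4 (fun ω => chain g h θ₀ ξ k ω - θs) (b k)) →
      (∀ k, k₀ ≤ k → b k ^ 2 ≤ E) → E ≤ 2 * u ^ 2 →
      ∑ k ∈ Finset.range n, b (k₀ + k) ^ 4 ≤ 8 * n * u ^ 4 → h * σ ^ 2 ≤ μ * u ^ 2 →
      |inner ℝ v (∑ k ∈ Finset.range n, ∫ ω, quadPart f θs (chain g h θ₀ ξ (k₀ + k) ω) ∂P) -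
        n * (h * c)| ≤
        n * (2 * (L * E / (n * (h * μ))) + 12 * L * u ^ 3 +
          5 / 2 * (√(L / μ) * √(L * h) * (h * σ ^ 2))) * ‖v‖ := by
  obtain ⟨X, hX, hXH, hXn⟩ := exists_lyapunov_third S.convex S.smooth θs v
  set χ := √(L / μ) * ‖v‖ with hχdef
  have hχ : 0 ≤ χ := by positivity
  set G := ∫ z, inner ℝ (g θs z) (X (g θs z)) ∂ν
  -- `G` involves only `v` and the noise at `θs`. The constant is thus fixed before the step size
  -- and the moment bounds, as extrapolation requires.
  refine ⟨G / 2, ?_⟩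
  intro h E u b k₀ n hh hL hu hy ha hbE hEu hb4 hhσ
  have hLp := S.pos
  have hμ := S.convex.pos
  have ha2 : ∀ k, LpLe P 2 (fun ω => chain g h θ₀ ξ k ω - θs) (b k) := fun k =>
    (ha k).exponent_mono (by norm_num)
  -- With this `w` the fourth-moment term and the dissipation term are both of order `n h √(L μ) u ^
  -- 3`. With `l = √(L h)`, where `h L = l ^ 2`, the two parts of the noise error are both of order
  -- `n h ^ 2 l σ ^ 2`.
  set w := √μ / u with hwdef
  set l := √(L * h) with hldef
  have hw : 0 < w := by positivity
  have hl : 0 < l := by positivity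
  set Φ : ℕ → ℝ := fun k =>
    ∫ ω, inner ℝ (chain g h θ₀ ξ k ω - θs) (X (chain g h θ₀ ξ k ω - θs)) ∂P with hΦ
  set V : ℕ → ℝ := fun k => ∫ ω, ‖chain g h θ₀ ξ k ω - θs‖ ^ 2 ∂P with hV
  set M : ℕ → Vec d := fun k => ∫ ω, quadPart f θs (chain g h θ₀ ξ k ω) ∂P with hM
  have hstep : ∀ k, |2 * h * inner ℝ v (M k) - (Φ k - Φ (k + 1)) - h ^ 2 * G| ≤
      χ * (2 * h * √L * w * b k ^ 4 + (2 * √L / w + h * (L + L / l)) *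
        (V k - V (k + 1) + 2 * h ^ 2 * σ ^ 2) + h ^ 2 * (l * σ ^ 2)) :=
    abs_lyapunov_mean_step_le S H hh hL hX hχ hXn hXH hw hl ha
  have hVE : ∀ k, k₀ ≤ k → V k ≤ E := fun k hk => ((ha2 k).integral_sq_le le_rfl).trans (hbE k hk)
  have hV0 : ∀ k, 0 ≤ V k := fun k => integral_nonneg fun ω => by positivity
  have hΦV : ∀ k, k₀ ≤ k → |Φ k| ≤ χ * E := fun k hk =>
    (abs_integral_inner_chain_le S H hXn ha2 k).trans (by gcongr; exact hVE k hk)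
  have htel : ∀ F : ℕ → ℝ, ∑ k ∈ Finset.range n, (F (k₀ + k) - F (k₀ + k + 1)) =
      F k₀ - F (k₀ + n) := fun F => Finset.sum_range_sub' (fun k => F (k₀ + k)) n
  have hsum : |2 * h * inner ℝ v (∑ k ∈ Finset.range n, M (k₀ + k)) - (Φ k₀ - Φ (k₀ + n)) -
      n * (h ^ 2 * G)| ≤ χ * (2 * h * √L * w * ∑ k ∈ Finset.range n, b (k₀ + k) ^ 4 +
        (2 * √L / w + h * (L + L / l)) * (V k₀ - V (k₀ + n) + n * (2 * h ^ 2 * σ ^ 2)) +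
        n * (h ^ 2 * (l * σ ^ 2))) := by
    have h1 := (Finset.abs_sum_le_sum_abs
      (fun k => 2 * h * inner ℝ v (M (k₀ + k)) - (Φ (k₀ + k) - Φ (k₀ + k + 1)) - h ^ 2 * G)
      (Finset.range n)).trans (Finset.sum_le_sum fun k _ => hstep (k₀ + k))
    have h2 : ∑ k ∈ Finset.range n,
        (2 * h * inner ℝ v (M (k₀ + k)) - (Φ (k₀ + k) - Φ (k₀ + k + 1)) - h ^ 2 * G) =
        2 * h * inner ℝ v (∑ k ∈ Finset.range n, M (k₀ + k)) - (Φ k₀ - Φ (k₀ + n)) -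
          n * (h ^ 2 * G) := by
      rw [Finset.sum_sub_distrib, Finset.sum_sub_distrib, htel, ← Finset.mul_sum, ← inner_sum,
        Finset.sum_const, Finset.card_range, nsmul_eq_mul]
    rw [h2] at h1
    refine h1.trans (le_of_eq ?_)
    rw [← Finset.mul_sum, Finset.sum_add_distrib, Finset.sum_add_distrib, ← Finset.mul_sum,
      ← Finset.mul_sum, Finset.sum_add_distrib, htel, Finset.sum_const, Finset.sum_const,
      Finset.card_range, nsmul_eq_mul, nsmul_eq_mul]
  have hn0 : (0 : ℝ) < n := by
    rcases Nat.eq_zero_or_pos n with h0 | h0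
    · rw [h0] at hy; norm_num at hy
    · exact_mod_cast h0
  have hE0 : 0 ≤ E := (hV0 k₀).trans (hVE k₀ le_rfl)
  have hl1 : l ≤ 1 := by
    rw [hldef, Real.sqrt_le_left zero_le_one]
    linarith [mul_comm h L]
  have hl2 : h * L = l ^ 2 := by rw [hldef, Real.sq_sqrt (by positivity)]; ring
  -- A window longer than the relaxation time makes the initial error comparable with the
  -- accumulated noise contribution.
  have hEy : E ≤ 2 * (n * (h * μ)) * u ^ 2 := by
    have : 2 * u ^ 2 * 1 ≤ 2 * u ^ 2 * (n * (h * μ)) := by gcongr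
    linarith
  have hσn : n * (2 * h ^ 2 * σ ^ 2) ≤ 2 * (n * (h * μ)) * u ^ 2 := by
    have := mul_le_mul_of_nonneg_left hhσ (by positivity : 0 ≤ 2 * (n * h))
    linarith
  have hsL : √L ^ 2 = L := Real.sq_sqrt hLp.le
  have hsμ : √μ ^ 2 = μ := Real.sq_sqrt hμ.le
  have hsL0 : 0 < √L := by positivity
  have hsμ0 : 0 < √μ := by positivity
  set Y := V k₀ - V (k₀ + n) + n * (2 * h ^ 2 * σ ^ 2) with hY
  have hYE : Y ≤ E + n * (2 * h ^ 2 * σ ^ 2) := by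
    have h1 := hVE k₀ le_rfl
    have h2 := hV0 (k₀ + n)
    linarith
  have hT1 : 2 * h * √L * w * ∑ k ∈ Finset.range n, b (k₀ + k) ^ 4 ≤
      16 * (n * h) * (√L * √μ * u ^ 3) := by
    calc 2 * h * √L * w * ∑ k ∈ Finset.range n, b (k₀ + k) ^ 4
        ≤ 2 * h * √L * w * (8 * n * u ^ 4) := by gcongr
      _ = _ := by rw [hwdef]; field_simp; ring
  have hT2 : 2 * √L / w * Y ≤ 8 * (n * h) * (√L * √μ * u ^ 3) := by
    calc 2 * √L / w * Y ≤ 2 * √L / w * (4 * (n * (h * μ)) * u ^ 2) := by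
          gcongr
          linarith
      _ = 2 * √L / w * (4 * (n * (h * √μ ^ 2)) * u ^ 2) := by rw [hsμ]
      _ = _ := by rw [hwdef]; field_simp; ring
  have hT3 : h * (L + L / l) * Y ≤ 2 * E + 4 * (n * h) * (l * (h * σ ^ 2)) := by
    have h1 : h * (L + L / l) = l ^ 2 + l := by
      rw [mul_add, mul_div_assoc', hl2]; field_simp
    have h2 : l ^ 2 + l ≤ 2 * l := by nlinarith
    have h3 : 0 ≤ E + n * (2 * h ^ 2 * σ ^ 2) := by positivity
    rw [h1]
    calc (l ^ 2 + l) * Y ≤ (l ^ 2 + l) * (E + n * (2 * h ^ 2 * σ ^ 2)) := by gcongr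
      _ ≤ 2 * l * (E + n * (2 * h ^ 2 * σ ^ 2)) := by gcongr
      _ = 2 * (l * E) + 4 * (n * h) * (l * (h * σ ^ 2)) := by ring
      _ ≤ 2 * (1 * E) + 4 * (n * h) * (l * (h * σ ^ 2)) := by gcongr
      _ = _ := by ring
  have hkey : |2 * h * (inner ℝ v (∑ k ∈ Finset.range n, M (k₀ + k)) - n * (h * (G / 2)))| ≤
      χ * (4 * E + 24 * (n * h) * (√L * √μ * u ^ 3) + 5 * (n * h) * (l * (h * σ ^ 2))) := by
    have e : 2 * h * (inner ℝ v (∑ k ∈ Finset.range n, M (k₀ + k)) - n * (h * (G / 2))) =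
        (2 * h * inner ℝ v (∑ k ∈ Finset.range n, M (k₀ + k)) - (Φ k₀ - Φ (k₀ + n)) -
          n * (h ^ 2 * G)) + Φ k₀ + -Φ (k₀ + n) := by ring
    rw [e]
    refine (abs_add_three _ _ _).trans ?_
    rw [abs_neg]
    have h1 := hΦV k₀ le_rfl
    have h2 := hΦV (k₀ + n) (Nat.le_add_right _ _)
    have h3 : χ * (2 * h * √L * w * ∑ k ∈ Finset.range n, b (k₀ + k) ^ 4 +
        (2 * √L / w + h * (L + L / l)) * Y + n * (h ^ 2 * (l * σ ^ 2))) ≤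
        χ * (2 * E + 24 * (n * h) * (√L * √μ * u ^ 3) + 5 * (n * h) * (l * (h * σ ^ 2))) := by
      refine mul_le_mul_of_nonneg_left ?_ hχ
      rw [add_mul]
      linarith
    linarith
  rw [abs_mul, abs_of_pos (by positivity : 0 < 2 * h)] at hkey
  have hLμ : √(L / μ) * (√L * √μ) = L := by
    rw [Real.sqrt_div hLp.le]
    field_simp
    exact hsL
  have hLμ1 : √(L / μ) ≤ L / μ := by
    have h1 : 1 ≤ L / μ := by rw [le_div_iff₀ hμ, one_mul]; exact S.le
    rw [Real.sqrt_le_left (by positivity), sq]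
    exact le_mul_of_one_le_right (by positivity) h1
  have hfin : √(L / μ) *
      (4 * E + 24 * (n * h) * (√L * √μ * u ^ 3) + 5 * (n * h) * (l * (h * σ ^ 2))) ≤
      2 * h * (n * (2 * (L * E / (n * (h * μ))) + 12 * L * u ^ 3 +
          5 / 2 * (√(L / μ) * l * (h * σ ^ 2)))) := by
    have e1 : 2 * h * (n * (2 * (L * E / (n * (h * μ))) + 12 * L * u ^ 3 +
          5 / 2 * (√(L / μ) * l * (h * σ ^ 2)))) =
        L / μ * (4 * E) + 24 * (n * h) * (L * u ^ 3) +
          √(L / μ) * (5 * (n * h) * (l * (h * σ ^ 2))) := by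
      field_simp
      ring
    have e2 : √(L / μ) *
      (4 * E + 24 * (n * h) * (√L * √μ * u ^ 3) + 5 * (n * h) * (l * (h * σ ^ 2))) =
        √(L / μ) * (4 * E) + 24 * (n * h) * (√(L / μ) * (√L * √μ) * u ^ 3) +
          √(L / μ) * (5 * (n * h) * (l * (h * σ ^ 2))) := by ring
    rw [e1, e2, hLμ]
    gcongr
  refine le_of_mul_le_mul_left (hkey.trans ?_) (by positivity : 0 < 2 * h)
  have := mul_le_mul_of_nonneg_right hfin (norm_nonneg v)
  rw [hχdef]
  linarith

end MeanBias

/-! ### The noise at the minimizer and the martingale part. -/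

section NoiseSums

variable {d : ℕ} {Z : Type*} [MeasurableSpace Z] {Ω : Type*} [MeasurableSpace Ω]
  {f : Vec d → ℝ} {g : Vec d → Z → Vec d} {ν : Measure Z} [IsProbabilityMeasure ν]
  {P : Measure Ω} [IsProbabilityMeasure P] {θ₀ : Ω → Vec d} {ξ : ℕ → Ω → Z}
  {θs : Vec d} {μ L σ h p : ℝ} {a : ℕ → ℝ}

/-- Rosenthal's inequality for the independent noise. -/
theorem NoiseModel.lpLe_noise_sum (H : NoiseModel ν P θ₀ ξ) (hp : 2 ≤ p) {φ : Z → Vec d}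
    (hφ : Measurable φ) {t s : ℝ} (ht : LpLe ν p φ t) (h0 : ∫ z, φ z ∂ν = 0) (hs : 0 ≤ s)
    (hvar : ∫ z, ‖φ z‖ ^ 2 ∂ν ≤ s ^ 2) (k₀ n : ℕ) :
    LpLe P p (fun ω => ∑ l ∈ Finset.range n, φ (ξ (k₀ + l + 1) ω))
      (5 * (√p * √n * s) + 4 * (p * (n : ℝ) ^ (1 / p) * t)) := by
  have hd : ∀ l, LpLe P p (fun ω => φ (ξ (k₀ + l + 1) ω)) t := fun l =>
    H.lpLe_noise hφ.stronglyMeasurable ht _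
  have hS : ∀ l, Measurable[past θ₀ ξ (k₀ + l)]
      (fun ω => ∑ i ∈ Finset.range l, φ (ξ (k₀ + i + 1) ω)) := by
    intro l
    refine Finset.measurable_fun_sum _ fun i hi => hφ.comp (measurable_past_noise ?_)
    have := Finset.mem_range.1 hi
    omega
  have hSp : ∀ l, LpLe P p (fun ω => ∑ i ∈ Finset.range l, φ (ξ (k₀ + i + 1) ω))
      (∑ _i ∈ Finset.range l, t) := fun l => LpLe.sum _ (fun i _ => hd i) (by linarith)
  refine LpLe.sum_rosenthal hp n hs (fun l _ => hd l) (fun l _ => ?_) (fun l _ => ?_)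
  · exact H.integral_inner_eq_zero (hS l) (hS l) (φ := fun x => φ x.2) (hφ.comp measurable_snd)
      (fun _ => ht.integrable (by linarith)) (fun _ => h0)
      ((hSp l).integrable_rpow_mul_inner hp (hd l))
  · have hi := (hSp l).integrable_rpow_mul_rpow (hd l) (by linarith) (a := p - 2) (b := 2)
      (by linarith) (by norm_num) (by ring)
    simp only [Real.rpow_two] at hi
    have hm : Measurable fun x : Vec d × Z => ‖x.1‖ ^ (p - 2) * ‖φ x.2‖ ^ 2 :=
      (measurable_fst.norm.pow_const _).mul ((hφ.comp measurable_snd).norm.pow_const 2)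
    have e := H.integral_eq (hS l) (φ := fun x => ‖x.1‖ ^ (p - 2) * ‖φ x.2‖ ^ 2)
      hm.stronglyMeasurable hi
    simp only [integral_const_mul] at e
    rw [integral_mul_const] at e
    rw [e, mul_comm]
    exact mul_le_mul_of_nonneg_right hvar (integral_nonneg fun ω => by positivity)

/-- The martingale part of the stochastic gradients, relative to the noise at the minimizer. -/
theorem lpLe_martingale_sum (S : SgdSetting f g ν θs μ L σ) (H : NoiseModel ν P θ₀ ξ)
    (hp : 2 ≤ p) (hG : ∀ y, LpLe ν p (fun z => g y z - g θs z) (L * ‖y - θs‖))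
    (ha : ∀ k, LpLe P p (fun ω => chain g h θ₀ ξ k ω - θs) (a k)) (k₀ n : ℕ) :
    LpLe P p (fun ω => ∑ l ∈ Finset.range n,
      (g (chain g h θ₀ ξ (k₀ + l) ω) (ξ (k₀ + l + 1) ω) - g θs (ξ (k₀ + l + 1) ω) -
        gradient f (chain g h θ₀ ξ (k₀ + l) ω)))
      √(10 * p * ∑ l ∈ Finset.range n, (2 * L * a (k₀ + l)) ^ 2) := by
  have hp1 : 1 ≤ p := by linarith
  set φ : Vec d × Z → Vec d := fun x => g x.1 x.2 - g θs x.2 - gradient f x.1 with hφdef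
  have hφ : Measurable φ :=
    (S.meas.sub ((S.measurable_apply θs).comp measurable_snd)).sub
      (S.smooth.contDiff_gradient.continuous.measurable.comp measurable_fst)
  have hmean : ∀ y, ∫ z, (g y z - g θs z) ∂ν = gradient f y := fun y => by
    rw [integral_sub (S.integrable y) (S.integrable θs), S.unbiased, S.unbiased, S.crit, sub_zero]
  have hφp : ∀ y, LpLe ν p (fun z => φ (y, z)) (2 * L * ‖y - θs‖) := fun y => by
    have := (hG y).sub_integral hp1
    rw [hmean, ← mul_assoc] at this
    exact this
  have hφi : ∀ y, Integrable (fun z => φ (y, z)) ν := fun y => (hφp y).integrable hp1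
  have hφ0 : ∀ y, ∫ z, φ (y, z) ∂ν = 0 := fun y => by
    have hi : Integrable (fun z => g y z - g θs z) ν := (S.integrable y).sub (S.integrable θs)
    simp only [hφdef]
    rw [integral_sub hi (integrable_const _), hmean,
      integral_const, probReal_univ, one_smul, sub_self]
  have hc : ∀ k, Measurable[past θ₀ ξ k] (chain g h θ₀ ξ k) := measurable_chain_past S.meas
  have hL := S.pos
  have hd : ∀ l, LpLe P p (fun ω => φ (chain g h θ₀ ξ (k₀ + l) ω, ξ (k₀ + l + 1) ω))
      (2 * L * a (k₀ + l)) := fun l =>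
    H.lpLe_of_conditional (by linarith) (by positivity) (hc _) (w := fun y => y - θs) (ha _)
      hφ.stronglyMeasurable fun y => (hφp y).lintegral_le (by linarith)
  refine LpLe.sum_of_orthogonal hp n (fun l _ => hd l) (fun l _ => ?_)
  have hS : Measurable[past θ₀ ξ (k₀ + l)]
      (fun ω => ∑ i ∈ Finset.range l, φ (chain g h θ₀ ξ (k₀ + i) ω, ξ (k₀ + i + 1) ω)) := by
    refine Finset.measurable_fun_sum _ fun i hi => ?_
    have hi' := Finset.mem_range.1 hi
    have h1 : Measurable[past θ₀ ξ (k₀ + l)] (chain g h θ₀ ξ (k₀ + i)) :=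
      (hc (k₀ + i)).mono (past_mono (by omega)) le_rfl
    have h2 : Measurable[past θ₀ ξ (k₀ + l)] (ξ (k₀ + i + 1)) := measurable_past_noise (by omega)
    exact hφ.comp (h1.prodMk h2)
  have hSp := LpLe.sum (Finset.range l) (fun i _ => hd i) hp1
  exact H.integral_inner_eq_zero hS (hc (k₀ + l)) hφ hφi hφ0
    (hSp.integrable_rpow_mul_inner hp (hd l))

end NoiseSums

/-! ### Geometric moment levels and the summed recursion. -/

section ChainBounds

variable {d : ℕ} {Z : Type*} [MeasurableSpace Z] {Ω : Type*} [MeasurableSpace Ω]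
  {f : Vec d → ℝ} {g : Vec d → Z → Vec d} {ν : Measure Z} [IsProbabilityMeasure ν]
  {P : Measure Ω} [IsProbabilityMeasure P] {θ₀ : Ω → Vec d} {ξ : ℕ → Ω → Z}
  {θs : Vec d} {μ L σ h p δ X r x : ℝ}

theorem add_cube_le {a b : ℝ} (ha : 0 ≤ a) (hb : 0 ≤ b) :
    (a + b) ^ 3 ≤ 4 * (a ^ 3 + b ^ 3) := by
  nlinarith [mul_nonneg (add_nonneg ha hb) (sq_nonneg (a - b))]

/-- Geometrically decaying moment levels. -/
noncomputable def level (δ X r : ℝ) (k : ℕ) : ℝ := √((1 - δ) ^ k * X ^ 2 + 2 * r ^ 2)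

theorem level_nonneg (k : ℕ) : 0 ≤ level δ X r k := Real.sqrt_nonneg _

theorem level_sq (hδ1 : δ ≤ 1) (k : ℕ) : level δ X r k ^ 2 = (1 - δ) ^ k * X ^ 2 + 2 * r ^ 2 :=
  Real.sq_sqrt (by have := pow_nonneg (sub_nonneg.2 hδ1) k; positivity)

/-- From here on `x` is the transient level at the start `k₀` of the window, so later bounds do not
mention the initial level `X`. -/
theorem level_add_sq (hδ1 : δ ≤ 1) {k₀ : ℕ} (hx : x ^ 2 = (1 - δ) ^ k₀ * X ^ 2) (k : ℕ) :
    level δ X r (k₀ + k) ^ 2 = (1 - δ) ^ k * x ^ 2 + 2 * r ^ 2 := by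
  rw [level_sq hδ1, hx, pow_add]
  ring

theorem level_add_sq_le (hδ : 0 < δ) (hδ1 : δ ≤ 1) {k₀ : ℕ} (hx : x ^ 2 = (1 - δ) ^ k₀ * X ^ 2)
    (k : ℕ) : level δ X r (k₀ + k) ^ 2 ≤ x ^ 2 + 2 * r ^ 2 := by
  rw [level_add_sq hδ1 hx]
  have := pow_le_one₀ (n := k) (sub_nonneg.2 hδ1) (by linarith)
  nlinarith [sq_nonneg x]

theorem level_add_le (hδ : 0 < δ) (hδ1 : δ ≤ 1) (hx0 : 0 ≤ x) (hr : 0 ≤ r) {k₀ : ℕ}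
    (hx : x ^ 2 = (1 - δ) ^ k₀ * X ^ 2) (k : ℕ) : level δ X r (k₀ + k) ≤ x + 2 * r := by
  refine abs_le_of_sq_le_sq' ?_ (by positivity) |>.2
  have := level_add_sq_le (r := r) hδ hδ1 hx k
  nlinarith [mul_nonneg hx0 hr, sq_nonneg r]

theorem sum_level_sq_le (hδ : 0 < δ) (hδ1 : δ ≤ 1) {k₀ : ℕ} (hx : x ^ 2 = (1 - δ) ^ k₀ * X ^ 2)
    (n : ℕ) : ∑ k ∈ Finset.range n, level δ X r (k₀ + k) ^ 2 ≤ x ^ 2 / δ + 2 * n * r ^ 2 := by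
  simp only [level_add_sq hδ1 hx]
  rw [Finset.sum_add_distrib, ← Finset.sum_mul, Finset.sum_const, Finset.card_range, nsmul_eq_mul]
  have h1 := mul_le_mul_of_nonneg_right (sum_pow_le_inv hδ hδ1 n) (sq_nonneg x)
  rw [div_mul_eq_mul_div, one_mul] at h1
  linarith

/-- The cube of the transient decays like `t ^ (3 / 2) ≤ t` with `t = (1 - δ) ^ k`, so the geometric
series still costs only `1 / δ`. -/
theorem sum_level_cube_le (hδ : 0 < δ) (hδ1 : δ ≤ 1) (hx0 : 0 ≤ x) (hr : 0 ≤ r) {k₀ : ℕ}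
    (hx : x ^ 2 = (1 - δ) ^ k₀ * X ^ 2) (n : ℕ) :
    ∑ k ∈ Finset.range n, level δ X r (k₀ + k) ^ 3 ≤ 4 * x ^ 3 / δ + 16 * n * r ^ 3 := by
  have hpt : ∀ k, level δ X r (k₀ + k) ^ 3 ≤ (1 - δ) ^ k * (4 * x ^ 3) + 16 * r ^ 3 := by
    intro k
    have hk0 := pow_nonneg (sub_nonneg.2 hδ1) k
    have hk1 := pow_le_one₀ (n := k) (sub_nonneg.2 hδ1) (by linarith)
    set t := (1 - δ) ^ k
    have ht : √t ^ 2 = t := Real.sq_sqrt hk0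
    have ht1 : √t ≤ 1 := by rw [Real.sqrt_le_left zero_le_one]; linarith
    have ht0 : 0 ≤ √t := Real.sqrt_nonneg _
    have h1 : level δ X r (k₀ + k) ≤ √t * x + √2 * r := by
      refine abs_le_of_sq_le_sq' ?_ (by positivity) |>.2
      rw [level_add_sq hδ1 hx, add_sq, mul_pow, mul_pow, ht, Real.sq_sqrt zero_le_two]
      have : 0 ≤ 2 * (√t * x) * (√2 * r) := by positivity
      linarith
    have h3 : √t ^ 3 ≤ t := by
      calc √t ^ 3 = √t * t := by rw [pow_succ', ht]
        _ ≤ 1 * t := by gcongr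
        _ = t := one_mul t
    have h4 : √2 ^ 3 ≤ 4 := by
      have : √2 ≤ 2 := by rw [Real.sqrt_le_left] <;> norm_num
      rw [pow_succ', Real.sq_sqrt zero_le_two]
      linarith
    calc level δ X r (k₀ + k) ^ 3 ≤ (√t * x + √2 * r) ^ 3 := by
          gcongr; exact level_nonneg _
      _ ≤ 4 * ((√t * x) ^ 3 + (√2 * r) ^ 3) :=
          add_cube_le (by positivity) (by positivity)
      _ = 4 * (√t ^ 3 * x ^ 3 + √2 ^ 3 * r ^ 3) := by ring
      _ ≤ 4 * (t * x ^ 3 + 4 * r ^ 3) := by gcongr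
      _ = _ := by ring
  refine (Finset.sum_le_sum fun k _ => hpt k).trans ?_
  rw [Finset.sum_add_distrib, ← Finset.sum_mul, Finset.sum_const, Finset.card_range, nsmul_eq_mul]
  have h1 := mul_le_mul_of_nonneg_right (sum_pow_le_inv hδ hδ1 n)
    (by positivity : 0 ≤ 4 * x ^ 3)
  rw [div_mul_eq_mul_div, one_mul] at h1
  linarith

/-- The hypothesis `1 ≤ n δ` trades the factor `1 / δ` of the transient for `n`. -/
theorem sum_level_four_le (hδ : 0 < δ) (hδ1 : δ ≤ 1) {k₀ : ℕ} (hx : x ^ 2 = (1 - δ) ^ k₀ * X ^ 2)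
    {n : ℕ} (hn : 1 ≤ n * δ) :
    ∑ k ∈ Finset.range n, level δ X r (k₀ + k) ^ 4 ≤ 8 * n * (x ^ 4 + r ^ 4) := by
  have hpt : ∀ k, level δ X r (k₀ + k) ^ 4 ≤ (1 - δ) ^ k * (2 * x ^ 4) + 8 * r ^ 4 := by
    intro k
    have hk0 := pow_nonneg (sub_nonneg.2 hδ1) k
    have hk1 := pow_le_one₀ (n := k) (sub_nonneg.2 hδ1) (by linarith)
    have e : level δ X r (k₀ + k) ^ 4 = (level δ X r (k₀ + k) ^ 2) ^ 2 := by ring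
    rw [e, level_add_sq hδ1 hx]
    set t := (1 - δ) ^ k
    have h1 : t ^ 2 * x ^ 4 ≤ t * x ^ 4 := by
      gcongr
      nlinarith
    nlinarith [sq_nonneg (t * x ^ 2 - 2 * r ^ 2)]
  refine (Finset.sum_le_sum fun k _ => hpt k).trans ?_
  rw [Finset.sum_add_distrib, ← Finset.sum_mul, Finset.sum_const, Finset.card_range, nsmul_eq_mul]
  have h1 := mul_le_mul_of_nonneg_right (sum_pow_le_inv hδ hδ1 n)
    (by positivity : 0 ≤ 2 * x ^ 4)
  have h2 : 1 / δ ≤ n := by rwa [div_le_iff₀ hδ]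
  have h3 := mul_le_mul_of_nonneg_right h2 (by positivity : 0 ≤ 2 * x ^ 4)
  have h4 : 0 ≤ n * x ^ 4 := by positivity
  linarith

variable (S : SgdSetting f g ν θs μ L σ)
include S

/-- Summation of the recursion for the SGD iterates. -/
theorem hessian_sum_eq (hh : 0 < h) (k₀ n : ℕ) (ω : Ω) :
    hessian f θs (∑ k ∈ Finset.range n, (chain g h θ₀ ξ (k₀ + k) ω - θs)) +
      ∑ k ∈ Finset.range n, g θs (ξ (k₀ + k + 1) ω) +
      ∑ k ∈ Finset.range n, nonlinPart f θs (chain g h θ₀ ξ (k₀ + k) ω) =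
    h⁻¹ • ((chain g h θ₀ ξ k₀ ω - θs) - (chain g h θ₀ ξ (k₀ + n) ω - θs)) -
      ∑ k ∈ Finset.range n, (g (chain g h θ₀ ξ (k₀ + k) ω) (ξ (k₀ + k + 1) ω) -
        g θs (ξ (k₀ + k + 1) ω) - gradient f (chain g h θ₀ ξ (k₀ + k) ω)) := by
  induction n with
  | zero => simp
  | succ n ih =>
    have e : h⁻¹ • ((chain g h θ₀ ξ k₀ ω - θs) - (chain g h θ₀ ξ (k₀ + (n + 1)) ω - θs)) =
        h⁻¹ • ((chain g h θ₀ ξ k₀ ω - θs) - (chain g h θ₀ ξ (k₀ + n) ω - θs)) +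
          g (chain g h θ₀ ξ (k₀ + n) ω) (ξ (k₀ + n + 1) ω) := by
      rw [← add_assoc, chain_succ]
      have h1 : ∀ a b c : Vec d, a - θs - (b - h • c - θs) = (a - θs - (b - θs)) + h • c := by
        intro a b c; abel
      rw [h1, smul_add, smul_smul, inv_mul_cancel₀ hh.ne', one_smul]
    rw [e]
    simp only [Finset.sum_range_succ, map_add] at ih ⊢
    have h2 : nonlinPart f θs (chain g h θ₀ ξ (k₀ + n) ω) =
        gradient f (chain g h θ₀ ξ (k₀ + n) ω) -
          hessian f θs (chain g h θ₀ ξ (k₀ + n) ω - θs) := rfl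
    rw [h2]
    rw [← sub_eq_zero] at ih ⊢
    rw [← ih]
    abel

variable (H : NoiseModel ν P θ₀ ξ)
include H

/-- The linear part of the recursion: boundary terms and martingale. -/
theorem lpLe_hessian_sum (hh : 0 < h) (hp : 2 ≤ p)
    (hG : ∀ y, LpLe ν p (fun z => g y z - g θs z) (L * ‖y - θs‖)) (hδ : 0 < δ) (hδ1 : δ ≤ 1)
    (hx0 : 0 ≤ x) (hr : 0 ≤ r) {k₀ : ℕ} (hx : x ^ 2 = (1 - δ) ^ k₀ * X ^ 2)
    (ha : ∀ k, LpLe P p (fun ω => chain g h θ₀ ξ k ω - θs) (level δ X r k)) (n : ℕ) :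
    LpLe P p (fun ω => hessian f θs (∑ k ∈ Finset.range n, (chain g h θ₀ ξ (k₀ + k) ω - θs)) +
        ∑ k ∈ Finset.range n, g θs (ξ (k₀ + k + 1) ω) +
        ∑ k ∈ Finset.range n, nonlinPart f θs (chain g h θ₀ ξ (k₀ + k) ω))
      (2 * (x + 2 * r) / h + 10 * L * √p * (x / √δ + √n * r)) := by
  have hp1 : 1 ≤ p := by linarith
  have hL := S.pos
  simp only [hessian_sum_eq S hh]
  have hb : ∀ k, LpLe P p (fun ω => chain g h θ₀ ξ (k₀ + k) ω - θs) (x + 2 * r) := fun k =>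
    (ha _).weaken (level_add_le hδ hδ1 hx0 hr hx k)
  have h1 := ((hb 0).sub (hb n) hp1).const_smul h⁻¹
  have h2 := lpLe_martingale_sum S H hp hG ha k₀ n
  refine (h1.sub h2 hp1).weaken (add_le_add (le_of_eq ?_) ?_)
  · rw [abs_of_pos (by positivity)]
    field_simp
    ring
  · have e : 10 * p * ∑ l ∈ Finset.range n, (2 * L * level δ X r (k₀ + l)) ^ 2 =
        40 * L ^ 2 * p * ∑ l ∈ Finset.range n, level δ X r (k₀ + l) ^ 2 := by
      rw [Finset.mul_sum, Finset.mul_sum]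
      exact Finset.sum_congr rfl fun l _ => by ring
    rw [e]
    refine Real.sqrt_le_iff.2 ⟨by positivity, ?_⟩
    have h3 := sum_level_sq_le (r := r) hδ hδ1 hx n
    have h4 : (10 * L * √p * (x / √δ + √n * r)) ^ 2 =
        100 * L ^ 2 * p * (x ^ 2 / δ + n * r ^ 2 + 2 * (x / √δ * (√n * r))) := by
      have e1 : √p ^ 2 = p := Real.sq_sqrt (by linarith)
      have e2 : (x / √δ) ^ 2 = x ^ 2 / δ := by rw [div_pow, Real.sq_sqrt hδ.le]
      have e3 : (√n * r) ^ 2 = n * r ^ 2 := by rw [mul_pow, Real.sq_sqrt (by positivity)]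
      rw [mul_pow, mul_pow, mul_pow, e1, add_sq, e2, e3]
      ring
    rw [h4]
    have h5 : 0 ≤ x / √δ * (√n * r) := by positivity
    have h6 : 0 ≤ x ^ 2 / δ := by positivity
    have h7 : 0 ≤ n * r ^ 2 := by positivity
    calc 40 * L ^ 2 * p * ∑ l ∈ Finset.range n, level δ X r (k₀ + l) ^ 2
        ≤ 40 * L ^ 2 * p * (x ^ 2 / δ + 2 * n * r ^ 2) := by gcongr
      _ = L ^ 2 * p * (40 * (x ^ 2 / δ) + 80 * (n * r ^ 2)) := by ring
      _ ≤ L ^ 2 * p * (100 * (x ^ 2 / δ + n * r ^ 2 + 2 * (x / √δ * (√n * r)))) := by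
          gcongr
          linarith
      _ = _ := by ring

end ChainBounds

/-! ### The nonlinear part: crude bound, fluctuation and extrapolated mean. -/

section NonlinearPart

variable {d : ℕ} {Z : Type*} [MeasurableSpace Z] {Ω : Type*} [MeasurableSpace Ω]
  {f : Vec d → ℝ} {g : Vec d → Z → Vec d} {ν : Measure Z} [IsProbabilityMeasure ν]
  {P : Measure Ω} [IsProbabilityMeasure P] {θ₀ : Ω → Vec d} {ξ : ℕ → Ω → Z}
  {θs : Vec d} {μ L σ h p δ X₂ r₂ x₂ X₃ r₃ x₃ γ : ℝ} {k₀ n : ℕ}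
  (S : SgdSetting f g ν θs μ L σ) (H : NoiseModel ν P θ₀ ξ)
include S H

omit [IsProbabilityMeasure ν] [IsProbabilityMeasure P] in
theorem measurable_nonlinPart (k : ℕ) :
    Measurable fun ω => nonlinPart f θs (chain g h θ₀ ξ k ω) := by
  have h1 : Continuous (nonlinPart f θs) :=
    S.smooth.contDiff_gradient.continuous.sub
      ((hessian f θs).continuous.comp (continuous_id.sub continuous_const))
  exact h1.measurable.comp (H.measurable_chain S.meas k)

/-- The direct quadratic bound, used for windows shorter than the relaxation time. -/
theorem lpLe_sum_nonlinPart (hp : 2 ≤ p) (hδ : 0 < δ) (hδ1 : δ ≤ 1)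
    (hx₂ : x₂ ^ 2 = (1 - δ) ^ k₀ * X₂ ^ 2)
    (ha₂ : ∀ k, LpLe P (2 * p) (fun ω => chain g h θ₀ ξ k ω - θs) (level δ X₂ r₂ k)) :
    LpLe P p (fun ω => ∑ k ∈ Finset.range n, nonlinPart f θs (chain g h θ₀ ξ (k₀ + k) ω))
      (n * (L * (x₂ ^ 2 + 2 * r₂ ^ 2))) := by
  have hp1 : 1 ≤ p := by linarith
  have hL := S.pos
  have h1 : ∀ k, LpLe P p (fun ω => nonlinPart f θs (chain g h θ₀ ξ (k₀ + k) ω))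
      (L * (x₂ ^ 2 + 2 * r₂ ^ 2)) := by
    intro k
    have h2 := (ha₂ (k₀ + k)).norm_pow two_pos (by linarith)
    rw [Nat.cast_ofNat, mul_div_cancel_left₀ _ two_ne_zero] at h2
    have h3 := h2.const_smul L
    rw [abs_of_pos hL] at h3
    refine (h3.mono (measurable_nonlinPart S H _).aestronglyMeasurable fun ω =>
      (S.norm_nonlinPart_le _).trans (le_abs_self _)).weaken ?_
    gcongr
    exact level_add_sq_le hδ hδ1 hx₂ k
  refine (LpLe.sum (Finset.range n) (fun k _ => h1 k) hp1).weaken (le_of_eq ?_)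
  rw [Finset.sum_const, Finset.card_range, nsmul_eq_mul]

/-- The first part of the bound is the cubic Taylor remainder, through moments of order `3p`; the
second is the fluctuation of the quadratic part, through moments of order `2p`. -/
theorem lpLe_sum_nonlinPart_sub (hh : 0 < h) (hL : h * L ≤ 1 / 2) (hp : 2 ≤ p) (hδ : 0 < δ)
    (hδ1 : δ ≤ 1) (hδh : δ ≤ h * μ) (hx₂ : x₂ ^ 2 = (1 - δ) ^ k₀ * X₂ ^ 2)
    (hx₃ : x₃ ^ 2 = (1 - δ) ^ k₀ * X₃ ^ 2) (hx₃0 : 0 ≤ x₃) (hr₃ : 0 ≤ r₃)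
    (hσ : h * σ ^ 2 ≤ μ * r₂ ^ 2)
    (ha₂ : ∀ k, LpLe P (2 * p) (fun ω => chain g h θ₀ ξ k ω - θs) (level δ X₂ r₂ k))
    (ha₃ : ∀ k, LpLe P (3 * p) (fun ω => chain g h θ₀ ξ k ω - θs) (level δ X₃ r₃ k)) :
    LpLe P p (fun ω => ∑ k ∈ Finset.range n, nonlinPart f θs (chain g h θ₀ ξ (k₀ + k) ω) -
        ∑ k ∈ Finset.range n, ∫ ω', quadPart f θs (chain g h θ₀ ξ (k₀ + k) ω') ∂P)
      (L * (4 * x₃ ^ 3 / δ + 16 * n * r₃ ^ 3) +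
        80 * √p * L * (x₂ ^ 2 / δ + √n / √δ * (11 * r₂ ^ 2))) := by
  have hp1 : 1 ≤ p := by linarith
  have hLp := S.pos
  set ψ := quadPart f θs with hψ
  -- The radius `3 r₂` meets the requirement `8 h σ ^ 2 ≤ μ s ^ 2`, and with the level `2 r₂ ^ 2` it
  -- produces the factor `11`.
  have hψq : QuadLip θs (3 * r₂) L ψ := quadLip_quadPart S.smooth
  have hs : 8 * h * σ ^ 2 ≤ μ * (3 * r₂) ^ 2 := by
    have h1 : 0 ≤ μ * r₂ ^ 2 := mul_nonneg S.convex.pos.le (sq_nonneg _)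
    nlinarith
  obtain ⟨c, hc⟩ := lpLe_chain_sum_sub S H hh hL hs hp hψq hδ hδ1 hδh (sq_nonneg X₂)
    (by positivity : 0 ≤ 2 * r₂ ^ 2) ha₂ (fun k => (level_sq hδ1 k).le) k₀ n
  have hψi : ∀ k, Integrable (fun ω => ψ (chain g h θ₀ ξ k ω)) P := fun k =>
    (lpLe_quadPart S H hp1 (ha₂ k)).integrable hp1
  -- The unknown centre `c` is exchanged for the mean at the cost of a factor `2`.
  have hfl := hc.sub_integral hp1
  have e1 : ∫ ω, (∑ k ∈ Finset.range n, ψ (chain g h θ₀ ξ (k₀ + k) ω) - c) ∂P =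
      ∑ k ∈ Finset.range n, ∫ ω', ψ (chain g h θ₀ ξ (k₀ + k) ω') ∂P - c := by
    rw [integral_sub (integrable_finsetSum _ fun k _ => hψi _) (integrable_const c),
      integral_finsetSum _ fun k _ => hψi _, integral_const, probReal_univ, one_smul]
  simp only [e1, sub_sub_sub_cancel_right] at hfl
  have h1 : ∀ k, LpLe P p (fun ω => nonlinPart f θs (chain g h θ₀ ξ (k₀ + k) ω) -
      ψ (chain g h θ₀ ξ (k₀ + k) ω)) (L * level δ X₃ r₃ (k₀ + k) ^ 3) := by
    intro k
    have h2 := (ha₃ (k₀ + k)).norm_pow three_pos (by linarith)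
    rw [Nat.cast_ofNat, mul_div_cancel_left₀ _ three_ne_zero] at h2
    have h3 := h2.const_smul L
    rw [abs_of_pos hLp] at h3
    exact h3.mono ((measurable_nonlinPart S H _).sub
      (hψq.continuous.measurable.comp (H.measurable_chain S.meas _))).aestronglyMeasurable
      fun ω => (S.norm_nonlinPart_sub_le _).trans (le_abs_self _)
  have h2 := (LpLe.sum (Finset.range n) (fun k _ => h1 k) hp1).add hfl hp1
  have e2 : ∀ ω, ∑ k ∈ Finset.range n, (nonlinPart f θs (chain g h θ₀ ξ (k₀ + k) ω) -
        ψ (chain g h θ₀ ξ (k₀ + k) ω)) +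
      (∑ k ∈ Finset.range n, ψ (chain g h θ₀ ξ (k₀ + k) ω) -
        ∑ k ∈ Finset.range n, ∫ ω', ψ (chain g h θ₀ ξ (k₀ + k) ω') ∂P) =
      ∑ k ∈ Finset.range n, nonlinPart f θs (chain g h θ₀ ξ (k₀ + k) ω) -
        ∑ k ∈ Finset.range n, ∫ ω', ψ (chain g h θ₀ ξ (k₀ + k) ω') ∂P := by
    intro ω
    rw [Finset.sum_sub_distrib]
    abel
  simp only [e2] at h2
  refine h2.weaken (add_le_add ?_ (le_of_eq ?_))
  · rw [← Finset.mul_sum]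
    gcongr
    exact sum_level_cube_le hδ hδ1 hx₃0 hr₃ hx₃ n
  · rw [← hx₂]
    ring

/-- Richardson–Romberg extrapolation cancels the leading bias of the quadratic part. -/
theorem norm_mean_extrapolation_le (hγ : 0 < γ) (hL : 2 * γ * L ≤ 1 / 2) (hp : 2 ≤ p)
    (hn : 1 ≤ n * (γ * μ)) {u : ℝ} (hx₂ : x₂ ^ 2 = (1 - γ * μ) ^ k₀ * X₂ ^ 2)
    (hx₃ : x₃ ^ 2 = (1 - γ * μ) ^ k₀ * X₃ ^ 2) (hx₃0 : 0 ≤ x₃) (hr₃ : 0 ≤ r₃) (hu : 0 < u)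
    (hu3 : x₃ + r₃ ≤ u) (hσ : 2 * γ * σ ^ 2 ≤ μ * r₃ ^ 2)
    (ha₂ : ∀ h ∈ ({γ, 2 * γ} : Set ℝ), ∀ k,
      LpLe P (2 * p) (fun ω => chain g h θ₀ ξ k ω - θs) (level (γ * μ) X₂ r₂ k))
    (ha₃ : ∀ h ∈ ({γ, 2 * γ} : Set ℝ), ∀ k,
      LpLe P (3 * p) (fun ω => chain g h θ₀ ξ k ω - θs) (level (γ * μ) X₃ r₃ k)) :
    ‖(2 : ℝ) • ∑ k ∈ Finset.range n, ∫ ω, quadPart f θs (chain g γ θ₀ ξ (k₀ + k) ω) ∂P -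
        ∑ k ∈ Finset.range n, ∫ ω, quadPart f θs (chain g (2 * γ) θ₀ ξ (k₀ + k) ω) ∂P‖ ≤
      3 * n * (2 * (L * (x₂ ^ 2 + 2 * r₂ ^ 2) / (n * (γ * μ))) + 12 * L * u ^ 3 +
        5 / 2 * (√(L / μ) * √(L * (2 * γ)) * (2 * γ * σ ^ 2))) := by
  have hLp := S.pos
  have hμ := S.convex.pos
  set δ := γ * μ with hδdef
  have hδ : 0 < δ := by positivity
  have hδ1 : δ ≤ 1 := by
    have h1 : γ * μ ≤ γ * L := by have := S.le; gcongr
    have h2 : 0 < γ * L := by positivity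
    linarith
  set m₁ := ∑ k ∈ Finset.range n, ∫ ω, quadPart f θs (chain g γ θ₀ ξ (k₀ + k) ω) ∂P
  set m₂ := ∑ k ∈ Finset.range n, ∫ ω, quadPart f θs (chain g (2 * γ) θ₀ ξ (k₀ + k) ω) ∂P
  -- The test vector is the very quantity to be bounded, so one constant `c` serves both step sizes.
  set v := (2 : ℝ) • m₁ - m₂ with hv
  set M := 2 * (L * (x₂ ^ 2 + 2 * r₂ ^ 2) / (n * δ)) + 12 * L * u ^ 3 +
        5 / 2 * (√(L / μ) * √(L * (2 * γ)) * (2 * γ * σ ^ 2)) with hM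
  -- The minimum allows the boundary term to be bounded at order `2p` and the fourth moments at
  -- order `3p`, with a single sequence.
  set b : ℕ → ℝ := fun k => min (level δ X₂ r₂ k) (level δ X₃ r₃ k) with hb
  have hb0 : ∀ k, 0 ≤ b k := fun k => le_min (level_nonneg k) (level_nonneg k)
  set E := min (x₂ ^ 2 + 2 * r₂ ^ 2) (x₃ ^ 2 + 2 * r₃ ^ 2) with hE
  obtain ⟨c, hc⟩ := exists_mean_bias S H v
  have hb4 : ∑ k ∈ Finset.range n, b (k₀ + k) ^ 4 ≤ 8 * n * u ^ 4 := by
    calc ∑ k ∈ Finset.range n, b (k₀ + k) ^ 4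
        ≤ ∑ k ∈ Finset.range n, level δ X₃ r₃ (k₀ + k) ^ 4 := by
          refine Finset.sum_le_sum fun k _ => pow_le_pow_left₀ (hb0 _) (min_le_right _ _) 4
      _ ≤ 8 * n * (x₃ ^ 4 + r₃ ^ 4) := sum_level_four_le hδ hδ1 hx₃ hn
      _ ≤ 8 * n * (x₃ + r₃) ^ 4 := by
          gcongr
          have h1 : (x₃ + r₃) ^ 4 = x₃ ^ 4 + r₃ ^ 4 +
            (4 * x₃ ^ 3 * r₃ + 6 * x₃ ^ 2 * r₃ ^ 2 + 4 * x₃ * r₃ ^ 3) := by ring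
          rw [h1]
          exact le_add_of_nonneg_right (by positivity)
      _ ≤ 8 * n * u ^ 4 := by gcongr
  have hbE : ∀ k, k₀ ≤ k → b k ^ 2 ≤ E := by
    intro k hk
    obtain ⟨j, rfl⟩ := Nat.exists_eq_add_of_le hk
    exact le_min
      ((pow_le_pow_left₀ (hb0 _) (min_le_left _ _) 2).trans (level_add_sq_le hδ hδ1 hx₂ j))
      ((pow_le_pow_left₀ (hb0 _) (min_le_right _ _) 2).trans (level_add_sq_le hδ hδ1 hx₃ j))
  have hu2 : (x₃ + r₃) ^ 2 ≤ u ^ 2 := by gcongr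
  have hru : r₃ ^ 2 ≤ u ^ 2 := by gcongr; linarith
  have hEu : E ≤ 2 * u ^ 2 := by
    refine (min_le_right _ _).trans ?_
    nlinarith [mul_nonneg hx₃0 hr₃, sq_nonneg x₃]
  have hE0 : 0 ≤ E := le_min (by positivity) (by positivity)
  have hn0 : (0 : ℝ) < n := by
    rcases Nat.eq_zero_or_pos n with h0 | h0
    · rw [h0] at hn; norm_num at hn
    · exact_mod_cast h0
  have hmain : ∀ h ∈ ({γ, 2 * γ} : Set ℝ),
      |inner ℝ v (∑ k ∈ Finset.range n, ∫ ω, quadPart f θs (chain g h θ₀ ξ (k₀ + k) ω) ∂P) -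
        n * (h * c)| ≤ n * M * ‖v‖ := by
    intro h hh
    have h1 : γ ≤ h ∧ h ≤ 2 * γ := by
      rcases hh with rfl | rfl
      · exact ⟨le_rfl, by linarith⟩
      · exact ⟨by linarith, le_rfl⟩
    have hh0 : 0 < h := by linarith
    have hhμ : δ ≤ h * μ := by rw [hδdef]; have := h1.1; gcongr
    have hσh : h * σ ^ 2 ≤ 2 * γ * σ ^ 2 := by have := h1.2; gcongr
    have hbl : ∀ k, LpLe P 4 (fun ω => chain g h θ₀ ξ k ω - θs) (b k) := by
      intro k
      rcases min_choice (level δ X₂ r₂ k) (level δ X₃ r₃ k) with h2 | h2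
      · rw [hb]
        simp only [h2]
        exact (ha₂ h hh k).exponent_mono (by linarith)
      · rw [hb]
        simp only [h2]
        exact (ha₃ h hh k).exponent_mono (by linarith)
    have h2 := hc hh0 (le_trans (by have := h1.2; gcongr) hL) hu
      (hn.trans (by gcongr)) hbl hbE hEu hb4
      (hσh.trans (hσ.trans (by gcongr)))
    refine h2.trans ?_
    rw [hM]
    have hle := h1.2
    have hEle : E ≤ x₂ ^ 2 + 2 * r₂ ^ 2 := min_le_left _ _
    gcongr
  have h1 := hmain γ (by simp)
  have h2 := hmain (2 * γ) (by simp)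
  -- In `2 ⟨v, m₁⟩ - ⟨v, m₂⟩` the linear biases `2 n γ c` and `n (2γ) c` cancel.
  have h3 : ‖v‖ ^ 2 ≤ 3 * n * M * ‖v‖ := by
    rw [← real_inner_self_eq_norm_sq]
    nth_rewrite 2 [hv]
    rw [inner_sub_right, inner_smul_right]
    have h4 := abs_le.1 h1
    have h5 := abs_le.1 h2
    linarith [h4.2, h5.1]
  rcases (norm_nonneg v).eq_or_lt with h0 | h0
  · rw [← h0]
    have : 0 ≤ M := by positivity
    positivity
  · rw [sq] at h3
    exact le_of_mul_le_mul_right h3 h0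

end NonlinearPart

/-! ### Assembling the extrapolated estimator. -/

section Extrapolation

/-- The mean estimate divides by `u > 0`, while the natural value `x₃ + r₃` may vanish; it is
reached as a limit from above. -/
theorem le_add_mul_cube_of_forall_gt {y K c a : ℝ} (h : ∀ u, a < u → y ≤ K + c * u ^ 3) :
    y ≤ K + c * a ^ 3 := by
  have hc : Continuous fun u : ℝ => K + c * u ^ 3 := by fun_prop
  have ht : Filter.Tendsto (fun u : ℝ => K + c * u ^ 3) (nhdsWithin a (Set.Ioi a))
      (nhds (K + c * a ^ 3)) := hc.continuousWithinAt
  exact ge_of_tendsto ht (eventually_nhdsWithin_of_forall fun u hu => h u hu)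

theorem prAverage_eq {d : ℕ} {Z Ω : Type*} (g : Vec d → Z → Vec d) (h : ℝ) (θ₀ : Ω → Vec d)
    (ξ : ℕ → Ω → Z) (n : ℕ) (ω : Ω) :
    prAverage g h (θ₀ ω) (fun k => ξ k ω) n =
      (n : ℝ)⁻¹ • ∑ k ∈ Finset.range n, chain g h θ₀ ξ (n + 1 + k) ω := by
  have e : Finset.Icc (n + 1) (2 * n) = Finset.Ico (n + 1) (2 * n + 1) := by
    ext k; simp only [Finset.mem_Icc, Finset.mem_Ico]; omega
  rw [prAverage, one_div, e, Finset.sum_Ico_eq_sum_range,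
    (by omega : 2 * n + 1 - (n + 1) = n)]
  rfl

variable {d : ℕ} {Z : Type*} [MeasurableSpace Z] {Ω : Type*} [MeasurableSpace Ω]
  {f : Vec d → ℝ} {g : Vec d → Z → Vec d} {ν : Measure Z} [IsProbabilityMeasure ν]
  {P : Measure Ω} [IsProbabilityMeasure P] {θ₀ : Ω → Vec d} {ξ : ℕ → Ω → Z}
  {θs : Vec d} {μ L σ p t X₁ r₁ x₁ X₂ r₂ x₂ X₃ r₃ x₃ γ : ℝ} {n : ℕ}
  (S : SgdSetting f g ν θs μ L σ) (H : NoiseModel ν P θ₀ ξ)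

theorem hessian_rrEstimator_sub_eq (f : Vec d → ℝ) (θs : Vec d) (hn : 1 ≤ n) (ω : Ω) :
    hessian f θs (rrEstimator g γ (θ₀ ω) (fun k => ξ k ω) n - θs) =
      (n : ℝ)⁻¹ •
        ((2 : ℝ) • hessian f θs
            (∑ k ∈ Finset.range n, (chain g γ θ₀ ξ (n + 1 + k) ω - θs)) -
          hessian f θs (∑ k ∈ Finset.range n, (chain g (2 * γ) θ₀ ξ (n + 1 + k) ω - θs))) := by
  have hn0 : (n : ℝ) ≠ 0 := by positivity
  rw [← map_smul, ← map_sub, ← map_smul]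
  congr 1
  rw [rrEstimator, prAverage_eq, prAverage_eq, Finset.sum_sub_distrib, Finset.sum_sub_distrib,
    Finset.sum_const, Finset.card_range, ← Nat.cast_smul_eq_nsmul ℝ]
  have h1 : (n : ℝ)⁻¹ • (n : ℝ) • θs = θs := by
    rw [smul_smul, inv_mul_cancel₀ hn0, one_smul]
  simp only [smul_sub]
  rw [smul_comm (n : ℝ)⁻¹ (2 : ℝ) ((n : ℝ) • θs), h1, smul_comm (n : ℝ)⁻¹ (2 : ℝ), two_smul ℝ θs]
  abel

include S H

theorem lpLe_hessian_rrEstimator_sub (hp : 2 ≤ p) (hγ : 0 < γ) (hL : 2 * γ * L ≤ 1 / 2)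
    (hn : 1 ≤ n) (hG : ∀ y, LpLe ν p (fun z => g y z - g θs z) (L * ‖y - θs‖))
    (ht : LpLe ν p (g θs) t) (hx : x₁ ^ 2 = (1 - γ * μ) ^ (n + 1) * X₁ ^ 2) (hx0 : 0 ≤ x₁)
    (hr : 0 ≤ r₁)
    (ha : ∀ h ∈ ({γ, 2 * γ} : Set ℝ), ∀ k,
      LpLe P p (fun ω => chain g h θ₀ ξ k ω - θs) (level (γ * μ) X₁ r₁ k)) {B : ℝ}
    (hB : LpLe P p (fun ω =>
      (2 : ℝ) • ∑ k ∈ Finset.range n, nonlinPart f θs (chain g γ θ₀ ξ (n + 1 + k) ω) -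
        ∑ k ∈ Finset.range n, nonlinPart f θs (chain g (2 * γ) θ₀ ξ (n + 1 + k) ω)) (n * B)) :
    LpLe P p (fun ω => hessian f θs (rrEstimator g γ (θ₀ ω) (fun k => ξ k ω) n - θs))
      (3 * (2 * (x₁ + 2 * r₁) / (γ * n) + 10 * L * √p * (x₁ / (√(γ * μ) * n) + r₁ / √n)) +
        (5 * (√p * σ / √n) + 4 * (p * t / (n : ℝ) ^ (1 - 1 / p))) + B) := by
  have hp1 : 1 ≤ p := by linarith
  have hLp := S.pos
  have hμ := S.convex.pos
  have hn0 : (0 : ℝ) < n := by positivity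
  set δ := γ * μ with hδdef
  have hδ : 0 < δ := by positivity
  have hδ1 : δ ≤ 1 := by
    have h1 : γ * μ ≤ γ * L := by have := S.le; gcongr
    have h2 : 0 < γ * L := by positivity
    linarith
  have h1 := lpLe_hessian_sum S H hγ hp hG hδ hδ1 hx0 hr hx (ha γ (by simp)) n
  have h2 := lpLe_hessian_sum S H (by positivity : 0 < 2 * γ) hp hG hδ hδ1 hx0 hr hx
    (ha (2 * γ) (by simp)) n
  have h3 := H.lpLe_noise_sum hp (S.measurable_apply θs) ht
    (by rw [S.unbiased, S.crit]) S.nonneg S.var.le (n + 1) n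
  have h4 := ((((h1.const_smul 2).sub h2 hp1).sub h3 hp1).sub hB hp1).const_smul (n : ℝ)⁻¹
  have e : ∀ ω, hessian f θs (rrEstimator g γ (θ₀ ω) (fun k => ξ k ω) n - θs) = _ :=
    hessian_rrEstimator_sub_eq (g := g) (γ := γ) (θ₀ := θ₀) (ξ := ξ) f θs hn
  simp only [e]
  -- Here `b` is the noise sum shared by the two chains: it enters twice with weight `2` and `-1`,
  -- so subtracting it once removes it, and Rosenthal is applied with weight one.
  have e2 : ∀ a a' b c c' : Vec d,
      (2 : ℝ) • (a + b + c) - (a' + b + c') - b - ((2 : ℝ) • c - c') = (2 : ℝ) • a - a' := by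
    intro a a' b c c'
    module
  simp only [e2] at h4
  refine h4.weaken ?_
  rw [abs_of_pos (by positivity : (0 : ℝ) < (n : ℝ)⁻¹), abs_two]
  have hsn : √(n : ℝ) * √n = n := Real.mul_self_sqrt hn0.le
  have hsn0 : 0 < √(n : ℝ) := by positivity
  have e3 : (n : ℝ)⁻¹ * √n = 1 / √n := by
    rw [inv_mul_eq_div, div_eq_div_iff hn0.ne' hsn0.ne', one_mul, hsn]
  have e4 : (n : ℝ)⁻¹ * (n : ℝ) ^ (1 / p) = 1 / (n : ℝ) ^ (1 - 1 / p) := by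
    rw [one_div ((n : ℝ) ^ (1 - 1 / p)), ← Real.rpow_neg hn0.le, neg_sub, Real.rpow_sub hn0,
      Real.rpow_one]
    field_simp
  have e5 : (n : ℝ)⁻¹ * (2 * (x₁ + 2 * r₁) / (2 * γ)) ≤ 2 * (x₁ + 2 * r₁) / (γ * n) := by
    rw [← div_eq_inv_mul, div_div]
    gcongr
    linarith
  have e6 : (n : ℝ)⁻¹ * (2 * (x₁ + 2 * r₁) / γ) = 2 * (x₁ + 2 * r₁) / (γ * n) := by
    rw [← div_eq_inv_mul, div_div]
  have e7 : (n : ℝ)⁻¹ * (x₁ / √δ + √n * r₁) = x₁ / (√δ * n) + r₁ / √n := by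
    rw [mul_add, ← mul_assoc, e3, ← div_eq_inv_mul, div_div]; ring
  have e8 : (n : ℝ)⁻¹ * (5 * (√p * √n * σ)) = 5 * (√p * σ / √n) := by
    calc (n : ℝ)⁻¹ * (5 * (√p * √n * σ)) = 5 * (√p * σ * ((n : ℝ)⁻¹ * √n)) := by ring
      _ = _ := by rw [e3]; ring
  have e9 : (n : ℝ)⁻¹ * (4 * (p * (n : ℝ) ^ (1 / p) * t)) = 4 * (p * t / (n : ℝ) ^ (1 - 1 / p)) := by
    calc (n : ℝ)⁻¹ * (4 * (p * (n : ℝ) ^ (1 / p) * t)) =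
        4 * (p * t * ((n : ℝ)⁻¹ * (n : ℝ) ^ (1 / p))) := by ring
      _ = _ := by rw [e4]; ring
  have e10 : (n : ℝ)⁻¹ * (n * B) = B := by field_simp
  calc (n : ℝ)⁻¹ * (2 * (2 * (x₁ + 2 * r₁) / γ + 10 * L * √p * (x₁ / √δ + √n * r₁)) +
        (2 * (x₁ + 2 * r₁) / (2 * γ) + 10 * L * √p * (x₁ / √δ + √n * r₁)) +
        (5 * (√p * √n * σ) + 4 * (p * (n : ℝ) ^ (1 / p) * t)) + n * B)
      = 2 * ((n : ℝ)⁻¹ * (2 * (x₁ + 2 * r₁) / γ)) + (n : ℝ)⁻¹ * (2 * (x₁ + 2 * r₁) / (2 * γ)) +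
        30 * L * √p * ((n : ℝ)⁻¹ * (x₁ / √δ + √n * r₁)) +
        ((n : ℝ)⁻¹ * (5 * (√p * √n * σ)) +
          (n : ℝ)⁻¹ * (4 * (p * (n : ℝ) ^ (1 / p) * t))) + (n : ℝ)⁻¹ * (n * B) := by ring
    _ ≤ _ := by
      rw [e6, e7, e8, e9, e10]
      linarith

/-- The nonlinear part after extrapolation. -/
theorem lpLe_nonlinPart_extrapolation (hp : 2 ≤ p) (hγ : 0 < γ) (hL : 2 * γ * L ≤ 1 / 2)
    (hn : 1 ≤ n) (hx₂ : x₂ ^ 2 = (1 - γ * μ) ^ (n + 1) * X₂ ^ 2)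
    (hx₃ : x₃ ^ 2 = (1 - γ * μ) ^ (n + 1) * X₃ ^ 2) (hx₁0 : 0 ≤ x₁) (hx₃0 : 0 ≤ x₃)
    (hr₃ : 0 ≤ r₃) (hx : x₂ ^ 4 ≤ x₁ * x₃ ^ 3)
    (hσ₂ : 2 * γ * σ ^ 2 ≤ μ * r₂ ^ 2) (hσ₃ : 2 * γ * σ ^ 2 ≤ μ * r₃ ^ 2)
    (ha₂ : ∀ h ∈ ({γ, 2 * γ} : Set ℝ), ∀ k,
      LpLe P (2 * p) (fun ω => chain g h θ₀ ξ k ω - θs) (level (γ * μ) X₂ r₂ k))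
    (ha₃ : ∀ h ∈ ({γ, 2 * γ} : Set ℝ), ∀ k,
      LpLe P (3 * p) (fun ω => chain g h θ₀ ξ k ω - θs) (level (γ * μ) X₃ r₃ k)) :
    LpLe P p (fun ω =>
      (2 : ℝ) • ∑ k ∈ Finset.range n, nonlinPart f θs (chain g γ θ₀ ξ (n + 1 + k) ω) -
        ∑ k ∈ Finset.range n, nonlinPart f θs (chain g (2 * γ) θ₀ ξ (n + 1 + k) ω))
      (n * (3000 * (L * p * r₂ ^ 2 / √(n * (γ * μ)) + L * (γ * √γ) * σ ^ 2 / √μ + L * r₃ ^ 3 +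
        (L * p * x₁ / (√(γ * μ) * n) + L * x₃ ^ 3 / (γ * μ))))) := by
  have hp1 : 1 ≤ p := by linarith
  have hp0 : 0 < p := by linarith
  have hLp := S.pos
  have hμ := S.convex.pos
  have hn0 : (0 : ℝ) < n := by positivity
  have hn1 : (1 : ℝ) ≤ n := by exact_mod_cast hn
  have hδ : 0 < γ * μ := by positivity
  have hδγ : ∀ h ∈ ({γ, 2 * γ} : Set ℝ), 0 < h ∧ h * L ≤ 1 / 2 ∧ γ * μ ≤ h * μ ∧
      h * σ ^ 2 ≤ μ * r₂ ^ 2 := by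
    intro h hh
    have h1 : γ ≤ h ∧ h ≤ 2 * γ := by
      rcases hh with rfl | rfl
      · exact ⟨le_rfl, by linarith⟩
      · exact ⟨by linarith, le_rfl⟩
    obtain ⟨h2, h3⟩ := h1
    exact ⟨by linarith, le_trans (by gcongr) hL, by gcongr, le_trans (by gcongr) hσ₂⟩
  have hδ1 : γ * μ ≤ 1 := by
    have h1 : γ * μ ≤ γ * L := by have := S.le; gcongr
    have h2 : 0 < γ * L := by positivity
    linarith
  set δ := γ * μ with hδdef
  set Λ := L * p * x₁ / (√δ * n) + L * x₃ ^ 3 / δ with hΛ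
  have hΛ0 : 0 ≤ Λ := by positivity
  set T₅ := L * p * r₂ ^ 2 / √(n * δ) with hT₅
  set T₆ := L * (γ * √γ) * σ ^ 2 / √μ with hT₆
  have hT₅0 : 0 ≤ T₅ := by positivity
  have hT₆0 : 0 ≤ T₆ := by positivity
  have hsδ : √δ ^ 2 = δ := Real.sq_sqrt hδ.le
  have hsδ0 : 0 < √δ := by positivity
  have hsδ1 : √δ ≤ 1 := by rw [Real.sqrt_le_left zero_le_one]; linarith
  have hsp : √p ^ 2 = p := Real.sq_sqrt hp0.le
  have hsp1 : 1 ≤ √p := Real.one_le_sqrt.2 hp1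
  have hspp : √p ≤ p := by rw [Real.sqrt_le_left hp0.le]; nlinarith
  -- The square of `Λ` is at least four times the product of its two terms, and `x₂ ^ 4 ≤ x₁ x₃ ^ 3`
  -- compares that product with `x₂`. So the transient of order `2p` is paid for by those of orders
  -- `p` and `3p`.
  have hΛsq : (L * √p * x₂ ^ 2) ^ 2 ≤ Λ ^ 2 * (δ * √δ * n) := by
    have h1 : Λ ^ 2 * (δ * √δ * n) ≥
        4 * (L * p * x₁ / (√δ * n)) * (L * x₃ ^ 3 / δ) * (δ * √δ * n) := by
      refine mul_le_mul_of_nonneg_right ?_ (by positivity)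
      rw [hΛ]
      nlinarith [sq_nonneg (L * p * x₁ / (√δ * n) - L * x₃ ^ 3 / δ)]
    have h2 : 4 * (L * p * x₁ / (√δ * n)) * (L * x₃ ^ 3 / δ) * (δ * √δ * n) =
        4 * (L ^ 2 * p * (x₁ * x₃ ^ 3)) := by
      field_simp
    have h3 : (L * √p * x₂ ^ 2) ^ 2 = L ^ 2 * p * x₂ ^ 4 := by
      rw [mul_pow, mul_pow, hsp]; ring
    have h4 : L ^ 2 * p * x₂ ^ 4 ≤ L ^ 2 * p * (x₁ * x₃ ^ 3) := by gcongr
    have h5 : 0 ≤ L ^ 2 * p * (x₁ * x₃ ^ 3) := by positivity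
    linarith
  -- Below the relaxation time `√(n δ) < 1`, and the crude quadratic bound already fits. Above it,
  -- fluctuation and extrapolated mean are estimated separately.
  rcases lt_or_ge (n * δ) 1 with hy | hy
  · have h1 := fun h hh => lpLe_sum_nonlinPart S H hp hδ hδ1 hx₂ (ha₂ h hh) (n := n)
    refine (((h1 γ (by simp)).const_smul 2).sub (h1 (2 * γ) (by simp)) hp1).weaken ?_
    rw [abs_two]
    have h2 : L * √p * x₂ ^ 2 ≤ Λ := by
      refine abs_le_of_sq_le_sq' (hΛsq.trans ?_) hΛ0 |>.2
      refine mul_le_of_le_one_right (by positivity) ?_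
      calc δ * √δ * n = √δ * (n * δ) := by ring
        _ ≤ 1 * 1 := by gcongr
        _ = 1 := one_mul 1
    have h3 : L * x₂ ^ 2 ≤ Λ := by
      refine le_trans ?_ h2
      have : 0 ≤ L * x₂ ^ 2 := by positivity
      calc L * x₂ ^ 2 ≤ √p * (L * x₂ ^ 2) := le_mul_of_one_le_left this hsp1
        _ = _ := by ring
    have h4 : L * r₂ ^ 2 ≤ T₅ := by
      rw [hT₅, le_div_iff₀ (by positivity)]
      have h5 : √(n * δ) ≤ 1 := by rw [Real.sqrt_le_left zero_le_one]; linarith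
      calc L * r₂ ^ 2 * √(n * δ) ≤ L * r₂ ^ 2 * p := by gcongr; linarith
        _ = _ := by ring
    have h6 : 0 ≤ L * r₃ ^ 3 := by positivity
    calc 2 * (n * (L * (x₂ ^ 2 + 2 * r₂ ^ 2))) + n * (L * (x₂ ^ 2 + 2 * r₂ ^ 2))
        = n * (3 * (L * x₂ ^ 2) + 6 * (L * r₂ ^ 2)) := by ring
      _ ≤ _ := by
        gcongr
        linarith
  · have h1 := fun h hh => lpLe_sum_nonlinPart_sub S H (hδγ h hh).1 (hδγ h hh).2.1 hp hδ hδ1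
      (hδγ h hh).2.2.1 hx₂ hx₃ hx₃0 hr₃ (hδγ h hh).2.2.2 (ha₂ h hh) (ha₃ h hh) (n := n)
    set K₀ := 3 * n * (2 * (L * (x₂ ^ 2 + 2 * r₂ ^ 2) / (n * δ)) +
        5 / 2 * (√(L / μ) * √(L * (2 * γ)) * (2 * γ * σ ^ 2))) with hK₀
    have hmean := le_add_mul_cube_of_forall_gt (a := x₃ + r₃) (K := K₀) (c := 3 * n * (12 * L))
      (fun u hu => (norm_mean_extrapolation_le S H hγ hL hp hy hx₂ hx₃ hx₃0 hr₃
        (lt_of_le_of_lt (by positivity) hu) hu.le hσ₃ ha₂ ha₃).trans (le_of_eq (by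
          rw [hK₀]; ring)))
    set m₁ := ∑ k ∈ Finset.range n, ∫ ω, quadPart f θs (chain g γ θ₀ ξ (n + 1 + k) ω) ∂P
    set m₂ := ∑ k ∈ Finset.range n, ∫ ω, quadPart f θs (chain g (2 * γ) θ₀ ξ (n + 1 + k) ω) ∂P
    have h2 := (((h1 γ (by simp)).const_smul 2).sub (h1 (2 * γ) (by simp)) hp1).add
      ((LpLe.const (P := P) (q := p) ((2 : ℝ) • m₁ - m₂)).weaken hmean) hp1
    have e : ∀ a b : Vec d, (2 : ℝ) • (a - m₁) - (b - m₂) + ((2 : ℝ) • m₁ - m₂) =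
        (2 : ℝ) • a - b := by
      intro a b; module
    simp only [m₁, m₂] at e h2
    simp only [e] at h2
    refine h2.weaken ?_
    rw [abs_two]
    have hx2 : L * √p * x₂ ^ 2 / (n * δ) ≤ Λ := by
      refine abs_le_of_sq_le_sq' ?_ hΛ0 |>.2
      rw [div_pow, div_le_iff₀ (by positivity)]
      refine hΛsq.trans ?_
      gcongr
      calc δ * √δ * n = √δ * (n * δ) := by ring
        _ ≤ (n * δ) * (n * δ) := by gcongr; linarith
        _ = _ := by ring
    have hx2' : L * x₂ ^ 2 / (n * δ) ≤ Λ := by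
      refine le_trans ?_ hx2
      gcongr
      exact le_mul_of_one_le_right hLp.le hsp1
    have hsy : √(n * δ) ≤ n * δ := by
      rw [Real.sqrt_le_left (by positivity)]; exact le_self_pow₀ hy two_ne_zero
    have hr2 : √p * L * r₂ ^ 2 / √(n * δ) ≤ T₅ := by
      rw [hT₅, mul_comm √p L]
      gcongr
    have hr2' : L * r₂ ^ 2 / (n * δ) ≤ T₅ := by
      rw [hT₅]
      gcongr
      exact le_mul_of_one_le_right hLp.le hp1
    have hx3 : L * x₃ ^ 3 / δ ≤ Λ := by
      rw [hΛ]; exact le_add_of_nonneg_left (by positivity)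
    have hx3n : L * x₃ ^ 3 / (n * δ) ≤ Λ := by
      refine le_trans ?_ hx3
      gcongr
      exact le_mul_of_one_le_left hδ.le hn1
    have hx3' : L * x₃ ^ 3 ≤ Λ := by
      refine le_trans ?_ hx3
      rw [le_div_iff₀ hδ]
      exact mul_le_of_le_one_right (by positivity) hδ1
    have hcube : L * (x₃ + r₃) ^ 3 ≤ 4 * (L * x₃ ^ 3) + 4 * (L * r₃ ^ 3) := by
      have h3 := add_cube_le hx₃0 hr₃
      have := mul_le_mul_of_nonneg_left h3 hLp.le
      linarith
    have hmix : √(L / μ) * √(L * (2 * γ)) * (2 * γ * σ ^ 2) ≤ 3 * T₆ := by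
      have hs2 : √2 ≤ 3 / 2 := by rw [Real.sqrt_le_left] <;> norm_num
      have hsL : √L * √L = L := Real.mul_self_sqrt hLp.le
      rw [hT₆, Real.sqrt_div hLp.le, Real.sqrt_mul hLp.le, Real.sqrt_mul zero_le_two]
      calc √L / √μ * (√L * (√2 * √γ)) * (2 * γ * σ ^ 2)
          = 2 * √2 * ((√L * √L) * (γ * √γ) * σ ^ 2 / √μ) := by ring
        _ ≤ 2 * (3 / 2) * (L * (γ * √γ) * σ ^ 2 / √μ) := by rw [hsL]; gcongr
        _ = _ := by ring
    have hsn : √(n : ℝ) / √δ = n / √(n * δ) := by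
      rw [Real.sqrt_mul hn0.le, div_eq_div_iff (by positivity) (by positivity)]
      have : √(n : ℝ) * √n = n := Real.mul_self_sqrt hn0.le
      calc √(n : ℝ) * (√n * √δ) = (√n * √n) * √δ := by ring
        _ = _ := by rw [this]
    have hr3 : 0 ≤ L * r₃ ^ 3 := by positivity
    have hQ : L * (4 * x₃ ^ 3 / δ + 16 * n * r₃ ^ 3) +
        80 * √p * L * (x₂ ^ 2 / δ + √n / √δ * (11 * r₂ ^ 2)) =
        n * (4 * (L * x₃ ^ 3 / (n * δ)) + 16 * (L * r₃ ^ 3) +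
          80 * (L * √p * x₂ ^ 2 / (n * δ)) + 880 * (√p * L * r₂ ^ 2 / √(n * δ))) := by
      rw [hsn]
      field_simp
      ring
    have hK : K₀ + 3 * n * (12 * L) * (x₃ + r₃) ^ 3 =
        n * (6 * (L * x₂ ^ 2 / (n * δ)) + 12 * (L * r₂ ^ 2 / (n * δ)) +
          15 / 2 * (√(L / μ) * √(L * (2 * γ)) * (2 * γ * σ ^ 2)) + 36 * (L * (x₃ + r₃) ^ 3)) := by
      rw [hK₀]; ring
    have hcollect : ∀ a b : ℝ, 2 * (n * a) + n * a + n * b = n * (3 * a + b) :=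
      fun a b => by ring
    rw [hQ, hK, hcollect]
    refine mul_le_mul_of_nonneg_left ?_ hn0.le
    linarith

end Extrapolation

/-! ### From the hypotheses to `L^p` bounds along the chains. -/

section Moments

variable {d : ℕ} {Z : Type*} [MeasurableSpace Z] {Ω : Type*} [MeasurableSpace Ω]
  {f : Vec d → ℝ} {g : Vec d → Z → Vec d} {ν : Measure Z} [IsProbabilityMeasure ν]
  {P : Measure Ω} [IsProbabilityMeasure P] {θ₀ : Ω → Vec d} {ξ : ℕ → Ω → Z}
  {θs : Vec d} {μ L L₁ q p : ℝ}

theorem normMoment_eq_eLpNorm_rpow (hq : 0 < q) (X : Ω → Vec d) (r : ℝ) :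
    normMoment P X q (r / q) = eLpNorm X (ENNReal.ofReal q) P ^ r := by
  rw [normMoment, eLpNorm_ofReal_eq hq, ← ENNReal.rpow_mul]
  congr 1
  ring

theorem NoiseMomentBound.lpLe {τ : ℝ} (h : NoiseMomentBound g ν θs q τ) (hq : 0 < q)
    (hg : Measurable (g θs)) : LpLe ν q (g θs) τ := by
  refine ⟨hg.aestronglyMeasurable, h.nonneg, ?_⟩
  have h1 := h.bound
  rwa [normMoment_eq_eLpNorm_rpow hq, ENNReal.rpow_one] at h1

theorem gradient_eq_zero_of_isMinOn (h : IsMinOn f Set.univ θs) : gradient f θs = 0 := by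
  have h1 : IsLocalMin f θs := h.isLocalMin Filter.univ_mem
  rw [gradient, h1.fderiv_eq_zero, map_zero]

/-- Co-coercivity is given for integer exponents only, so it is used at `⌈q⌉ ≤ q + 1` and lowered to
`q` on the probability space; the Lipschitz bound on the gradient closes the estimate. -/
theorem NoiseCondition.lpLe_sub {r : ℝ} (hN : NoiseCondition f g ν L₁ r)
    (hs : SmoothBounded f L L L) (hL : L₁ ≤ L) (hq : 2 ≤ q) (hr : q + 1 ≤ r) (x y : Vec d) :
    LpLe ν q (fun z => g x z - g y z) (L * ‖x - y‖) := by
  set m := ⌈q⌉₊ with hm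
  have hqm : q ≤ m := Nat.le_ceil q
  have hmr : (m : ℝ) ≤ r := (Nat.ceil_lt_add_one (by linarith)).le.trans hr
  have hm2 : 2 ≤ m := by exact_mod_cast hq.trans hqm
  have h1 := hN.cocoercive m hm2 hmr x y
  have hL1 := hN.pos.le
  have hL0 : 0 ≤ L := hL1.trans hL
  have hmeas : Measurable fun z => g x z - g y z :=
    (hN.measurable.comp measurable_prodMk_left).sub (hN.measurable.comp measurable_prodMk_left)
  suffices h : LpLe ν m (fun z => g x z - g y z) (L * ‖x - y‖) from h.exponent_mono hqm
  refine .of_lintegral hmeas.aestronglyMeasurable (by positivity) (by positivity) ?_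
  simp only [ENNReal.rpow_natCast, Real.rpow_natCast]
  refine h1.trans (ENNReal.ofReal_le_ofReal ?_)
  obtain ⟨j, hj⟩ := Nat.exists_eq_add_of_le hm2
  have e1 : m - 1 = j + 1 := by omega
  have e2 : m - 2 = j := by omega
  have h2 : inner ℝ (gradient f x - gradient f y) (x - y) ≤ L * ‖x - y‖ * ‖x - y‖ :=
    (real_inner_le_norm _ _).trans (by gcongr; exact hs.lipschitz x y)
  rw [e1, e2, hj]
  calc L₁ ^ (j + 1) * ‖x - y‖ ^ j * inner ℝ (gradient f x - gradient f y) (x - y)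
      ≤ L₁ ^ (j + 1) * ‖x - y‖ ^ j * (L * ‖x - y‖ * ‖x - y‖) := by gcongr
    _ ≤ L ^ (j + 1) * ‖x - y‖ ^ j * (L * ‖x - y‖ * ‖x - y‖) := by gcongr
    _ = (L * ‖x - y‖) ^ (2 + j) := by ring

theorem NoiseCondition.lpLe_two_sub {r : ℝ} (hN : NoiseCondition f g ν L₁ r)
    (hc : StronglyConvex f μ) (hr : 2 ≤ r) (x y : Vec d) :
    LpLe ν 2 (fun z => g x z - g y z) √(L₁ * inner ℝ (gradient f x - gradient f y) (x - y)) := by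
  have h1 := hN.cocoercive 2 le_rfl (by exact_mod_cast hr) x y
  have h0 : 0 ≤ L₁ * inner ℝ (gradient f x - gradient f y) (x - y) :=
    mul_nonneg hN.pos.le (le_trans (mul_nonneg hc.pos.le (sq_nonneg _)) (hc.monotone x y))
  have hmeas : Measurable fun z => g x z - g y z :=
    (hN.measurable.comp measurable_prodMk_left).sub (hN.measurable.comp measurable_prodMk_left)
  refine .of_lintegral hmeas.aestronglyMeasurable two_pos (Real.sqrt_nonneg _) ?_
  rw [Real.rpow_two, Real.sq_sqrt h0]
  simpa using h1

/-- Compare the lower and upper bounds of the Hessian on a nonzero vector; in dimension zero nothing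
relates `μ` to `L`. -/
theorem StronglyConvex.le_of_smooth [Nontrivial (Vec d)] (hc : StronglyConvex f μ)
    (hs : SmoothBounded f L L L) : μ ≤ L := by
  obtain ⟨u, hu⟩ := exists_ne (0 : Vec d)
  have h1 := hessian_lower hc hs 0 u
  have h2 : inner ℝ (hessian f 0 u) u ≤ L * ‖u‖ ^ 2 := by
    calc inner ℝ (hessian f 0 u) u ≤ ‖hessian f 0 u‖ * ‖u‖ := real_inner_le_norm _ _
      _ ≤ L * ‖u‖ * ‖u‖ := by
        gcongr
        exact (hessian f 0).le_of_opNorm_le (hs.norm_hessian_le 0) u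
      _ = _ := by ring
  have h3 : 0 < ‖u‖ ^ 2 := by have := norm_pos_iff.2 hu; positivity
  exact le_of_mul_le_mul_right (h1.trans h2) h3

theorem NoiseCondition.sgdSetting [Nontrivial (Vec d)] {r τ : ℝ} (hN : NoiseCondition f g ν L₁ r)
    (hmin : IsMinOn f Set.univ θs) (hc : StronglyConvex f μ) (hs : SmoothBounded f L L L)
    (hL : L₁ ≤ L) (hr : 2 ≤ r) (hτ : NoiseMomentBound g ν θs 2 τ) :
    SgdSetting f g ν θs μ L √(∫ z, ‖g θs z‖ ^ 2 ∂ν) where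
  convex := hc
  smooth := hs
  pos := hN.pos.trans_le hL
  le := hc.le_of_smooth hs
  crit := gradient_eq_zero_of_isMinOn hmin
  meas := hN.measurable
  integrable := hN.integrable
  unbiased := hN.unbiased
  integrable_sq x y := by
    simpa using (hN.lpLe_two_sub hc hr x y).integrable_rpow two_pos
  cocoercive x y := by
    have h0 : 0 ≤ inner ℝ (gradient f x - gradient f y) (x - y) :=
      le_trans (mul_nonneg hc.pos.le (sq_nonneg _)) (hc.monotone x y)
    have h1 := (hN.lpLe_two_sub hc hr x y).integral_sq_le le_rfl
    rw [Real.sq_sqrt (mul_nonneg hN.pos.le h0)] at h1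
    exact h1.trans (by gcongr)
  integrable_var := by
    simpa using (hτ.lpLe two_pos (hN.measurable.comp measurable_prodMk_left)).integrable_rpow
      two_pos
  nonneg := Real.sqrt_nonneg _
  var := (Real.sq_sqrt (integral_nonneg fun z => by positivity)).symm

theorem trace_noiseCov (hi : Integrable (fun z => ‖g θs z‖ ^ 2) ν) (hg : Measurable (g θs)) :
    (noiseCov g ν θs).trace = ∫ z, ‖g θs z‖ ^ 2 ∂ν := by
  have hcoord : ∀ i, Measurable fun z => g θs z i := fun i =>
    (EuclideanSpace.proj (𝕜 := ℝ) i).continuous.measurable.comp hg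
  have hint : ∀ i, Integrable (fun z => g θs z i * g θs z i) ν := by
    intro i
    refine hi.mono' ((hcoord i).mul (hcoord i)).aestronglyMeasurable
      (Filter.Eventually.of_forall fun z => ?_)
    rw [norm_mul, ← sq]
    gcongr
    exact PiLp.norm_apply_le (g θs z) i
  simp only [Matrix.trace, Matrix.diag, noiseCov, Matrix.of_apply]
  rw [← integral_finsetSum _ fun i _ => hint i]
  refine integral_congr_ae (Filter.Eventually.of_forall fun z => ?_)
  simp only [EuclideanSpace.norm_sq_eq]
  exact Finset.sum_congr rfl fun i _ => by rw [Real.norm_eq_abs, sq_abs, sq]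

/-- The moment condition along the chain, for step sizes between `γ` and `2γ`. -/
theorem MomentCondition.lpLe_level {τ K D γ h X r : ℝ} (hM : MomentCondition g ν θs μ L q τ K D)
    (H : NoiseModel ν P θ₀ ξ) (hg : Measurable (fun x : Vec d × Z => g x.1 x.2)) (hq : 0 < q)
    (hμ : 0 < μ) (hγ : 0 < γ) (hγh : γ ≤ h) (hhγ : h ≤ 2 * γ) (hhμ : h * μ ≤ 1)
    (hhK : h ≤ 1 / (L * K)) (hX0 : 0 ≤ X)
    (hX : eLpNorm (fun ω => θ₀ ω - θs) (ENNReal.ofReal q) P = ENNReal.ofReal X)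
    (hr : r ^ 2 = D * γ * τ ^ 2 / μ) (k : ℕ) :
    LpLe P q (fun ω => chain g h θ₀ ξ k ω - θs) (level (γ * μ) X r k) := by
  have hm := H.measurable_chain (h := h) hg
  have hδ1 : γ * μ ≤ 1 := le_trans (by gcongr) hhμ
  refine ⟨((hm k).sub_const θs).aestronglyMeasurable, level_nonneg k, ?_⟩
  have hD : 0 ≤ D := le_trans zero_le_two hM.two_le_D
  have h1 := hM.iterates h (by linarith) hhK (P.map θ₀)
    (Measure.isProbabilityMeasure_map H.meas₀.aemeasurable) k
  have hnm : ∀ {Y : Ω → Vec d}, Measurable Y →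
      normMoment (P.map Y) (fun θ => θ - θs) q (2 / q) =
        eLpNorm (fun ω => Y ω - θs) (ENNReal.ofReal q) P ^ (2 : ℝ) := by
    intro Y hY
    have hme : Measurable fun θ : Vec d => ‖θ - θs‖ₑ ^ q :=
      (measurable_id.sub_const θs).enorm.pow_const q
    rw [← normMoment_eq_eLpNorm_rpow hq, normMoment, normMoment,
      lintegral_map hme hY]
  rw [← H.map_chain hg k, hnm (hm k), hnm H.meas₀, hX, ENNReal.ofReal_rpow_of_nonneg hX0 zero_le_two,
    Real.rpow_two, ← ENNReal.ofReal_mul (pow_nonneg (by linarith) k),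
    ← ENNReal.ofReal_add (mul_nonneg (pow_nonneg (by linarith) k) (sq_nonneg X))
      (by have : 0 < h := by linarith
          positivity)] at h1
  -- One level serves both chains: it takes the slower decay, that of `γ`, and the larger noise,
  -- that of `2γ`. Hence the `2 * r ^ 2` in `level`.
  have h2 : (1 - h * μ) ^ k * X ^ 2 + D * h * τ ^ 2 / μ ≤ level (γ * μ) X r k ^ 2 := by
    rw [level_sq hδ1, hr]
    refine add_le_add ?_ ?_
    · gcongr
    · calc D * h * τ ^ 2 / μ ≤ D * (2 * γ) * τ ^ 2 / μ := by gcongr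
        _ = _ := by ring
  have h3 := h1.trans (ENNReal.ofReal_le_ofReal h2)
  rw [← Real.rpow_two, ← ENNReal.ofReal_rpow_of_nonneg (level_nonneg k) zero_le_two] at h3
  exact (ENNReal.rpow_le_rpow_iff two_pos).1 h3

/-- Interpolation of moments between the orders `p` and `3p`. -/
theorem LpLe.interpolate {X : Ω → Vec d} {A B : ℝ} (hp : 0 < p) (hA : LpLe P p X A)
    (hB : LpLe P (3 * p) X B) :
    LpLe P (2 * p) X (A ^ (1 / 4 : ℝ) * B ^ (3 / 4 : ℝ)) := by
  have h1 := hA.norm_rpow (r := 1 / 4) (by norm_num) hp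
  have h2 := hB.norm_rpow (r := 3 / 4) (by norm_num) (by positivity)
  have h3 := h1.norm_mul_norm h2 (q := 2 * p) (by positivity) (by positivity) (by positivity)
    (by field_simp; norm_num)
  refine h3.mono hA.meas fun ω => le_of_eq ?_
  rw [norm_mul, norm_norm, norm_norm, Real.norm_of_nonneg (by positivity),
    Real.norm_of_nonneg (by positivity), ← Real.rpow_add_of_nonneg (norm_nonneg _) (by norm_num)
      (by norm_num)]
  norm_num

end Moments

/-! ### Matching the estimates with the constants of the theorem. -/

section Collect

variable {p μ L γ σ : ℝ} {n : ℕ} {τ D : ℝ → ℝ}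

/-- The stationary moment level of order `q`. -/
noncomputable def statLevel (μ γ : ℝ) (τ D : ℝ → ℝ) (q : ℝ) : ℝ := √(D q) * τ q * √γ / √μ

theorem statLevel_sq (hμ : 0 < μ) (hγ : 0 < γ) {q : ℝ} (hD : 0 ≤ D q) :
    statLevel μ γ τ D q ^ 2 = D q * γ * τ q ^ 2 / μ := by
  rw [statLevel, div_pow, mul_pow, mul_pow, Real.sq_sqrt hD, Real.sq_sqrt hγ.le,
    Real.sq_sqrt hμ.le]
  ring

theorem rpow_three_half {a : ℝ} (ha : 0 ≤ a) : a ^ (3 / 2 : ℝ) = a * √a := by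
  rw [Real.sqrt_eq_rpow, (by norm_num : (3 / 2 : ℝ) = 1 + 1 / 2),
    Real.rpow_add_of_nonneg ha zero_le_one (by norm_num), Real.rpow_one]

/-- The moment bound is controlled by the terms of the theorem. -/
theorem bound_le_mainTerms (hp : 2 ≤ p) (hμ : 0 < μ) (hμL : μ ≤ L) (hγ : 0 < γ) (hn : 1 ≤ n)
    (hσ : σ ^ 2 ≤ τ 2 ^ 2) (hσ0 : 0 ≤ σ) (hD2 : 2 ≤ D 2) (hD₁ : 2 ≤ D p) (hD₂ : 2 ≤ D (2 * p))
    (hD₃ : 2 ≤ D (3 * p)) (hτ₁ : 0 ≤ τ p) (hτ₂ : 0 ≤ τ (2 * p)) (hτ₃ : 0 ≤ τ (3 * p))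
    {x₁ x₃ : ℝ} (hx₁ : 0 ≤ x₁) (hx₃ : 0 ≤ x₃) :
    3 * (2 * (x₁ + 2 * statLevel μ γ τ D p) / (γ * n) +
        10 * L * √p * (x₁ / (√(γ * μ) * n) + statLevel μ γ τ D p / √n)) +
      (5 * (√p * σ / √n) + 4 * (p * τ p / (n : ℝ) ^ (1 - 1 / p))) +
      3000 * (L * p * statLevel μ γ τ D (2 * p) ^ 2 / √(n * (γ * μ)) +
        L * (γ * √γ) * σ ^ 2 / √μ + L * statLevel μ γ τ D (3 * p) ^ 3 +
        (L * p * x₁ / (√(γ * μ) * n) + L * x₃ ^ 3 / (γ * μ))) ≤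
    4000 * (mainTerms p μ L γ n τ D (σ ^ 2) +
      (x₁ / (γ * n) + L * p * x₁ / (√μ * √γ * n) + L * x₃ ^ 3 / (γ * μ))) := by
  have hL : 0 < L := hμ.trans_le hμL
  have hp0 : 0 < p := by linarith
  have hn0 : (0 : ℝ) < n := by positivity
  have hsn0 : 0 < √(n : ℝ) := by positivity
  have hsμ : √μ * √μ = μ := Real.mul_self_sqrt hμ.le
  have hsγ : √γ * √γ = γ := Real.mul_self_sqrt hγ.le
  have hsn : √(n : ℝ) * √n = n := Real.mul_self_sqrt hn0.le
  have hsμ0 : 0 < √μ := by positivity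
  have hsγ0 : 0 < √γ := by positivity
  have hspp : √p ≤ p := by rw [Real.sqrt_le_left hp0.le]; nlinarith
  have hγμ : √(γ * μ) = √μ * √γ := by rw [Real.sqrt_mul hγ.le, mul_comm]
  have hD0 : 0 ≤ D 2 := by linarith
  have hD10 : 0 ≤ D p := by linarith
  have hD20 : 0 ≤ D (2 * p) := by linarith
  have hD30 : 0 ≤ D (3 * p) := by linarith
  set r₁ := statLevel μ γ τ D p with hr₁
  have hr₁0 : 0 ≤ r₁ := by rw [hr₁, statLevel]; positivity
  set A₁ := √(σ ^ 2) * √p / √(n : ℝ) with hA₁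
  set A₂ := p * τ p / (n : ℝ) ^ (1 - 1 / p) with hA₂
  set A₃ := const₅ p μ τ D / ((n : ℝ) * √γ) with hA₃
  set A₄ := L * √(D p) * p * τ p / √μ * √γ / √(n : ℝ) with hA₄
  set A₅ := L * D (2 * p) * p * τ (2 * p) ^ 2 / μ ^ (3 / 2 : ℝ) * √γ / √(n : ℝ) with hA₅
  set A₆ := biasConst μ L (τ 2) (D 2) * γ ^ (3 / 2 : ℝ) with hA₆
  set A₇ := L * D (3 * p) ^ (3 / 2 : ℝ) * τ (3 * p) ^ 3 / μ ^ (3 / 2 : ℝ) * γ ^ (3 / 2 : ℝ)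
    with hA₇
  set A₈ := const₈ p μ L τ D / (n : ℝ) with hA₈
  have hmain : mainTerms p μ L γ n τ D (σ ^ 2) =
      A₁ + A₂ + A₃ + (A₄ + A₅) + (A₆ + A₇) + A₈ := by
    rw [mainTerms, const₆, const₇, hA₁, hA₂, hA₃, hA₄, hA₅, hA₆, hA₇, hA₈]
    ring
  have h1 : √p * σ / √n = A₁ := by rw [hA₁, Real.sqrt_sq hσ0, mul_comm σ]
  have h3 : r₁ / (γ * n) = A₃ := by
    rw [hA₃, hr₁, statLevel, const₅, div_div, div_div, div_eq_div_iff (by positivity)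
      (by positivity)]
    calc √(D p) * τ p * √γ * (√μ * (n * √γ)) = √(D p) * τ p * (√μ * ((√γ * √γ) * n)) := by ring
      _ = _ := by rw [hsγ]
  have h4 : L * p * r₁ / √n = A₄ := by
    rw [hA₄, hr₁, statLevel]; ring
  have h4' : L * √p * (r₁ / √n) ≤ A₄ := by
    rw [← h4, mul_div_assoc]
    gcongr
  have h5 : L * p * statLevel μ γ τ D (2 * p) ^ 2 / √(n * (γ * μ)) = A₅ := by
    rw [hA₅, statLevel_sq hμ hγ hD20, rpow_three_half hμ.le, Real.sqrt_mul hn0.le, hγμ]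
    nth_rewrite 1 [← hsγ]
    field_simp
  have h6 : L * (γ * √γ) * σ ^ 2 / √μ ≤ A₆ := by
    rw [hA₆, rpow_three_half hγ.le, biasConst]
    -- The term in `L σ ^ 2 γ ^ (3 / 2) / √μ` fits under the first summand of `biasConst`, which is
    -- larger by the factor `(L / μ) * D 2`.
    have e1 : 1 * 1 ≤ L / μ * D 2 := by
      have : 1 ≤ L / μ := by rwa [le_div_iff₀ hμ, one_mul]
      gcongr
      linarith
    have e2 : L * (γ * √γ) * σ ^ 2 / √μ ≤
        (L ^ 2 * D 2 / √μ) * (τ 2 ^ 2 / μ) * (γ * √γ) := by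
      calc L * (γ * √γ) * σ ^ 2 / √μ ≤ L * (γ * √γ) * τ 2 ^ 2 / √μ := by gcongr
        _ = (L * (γ * √γ) * τ 2 ^ 2 / √μ) * (1 * 1) := by ring
        _ ≤ (L * (γ * √γ) * τ 2 ^ 2 / √μ) * (L / μ * D 2) := by gcongr
        _ = _ := by ring
    refine e2.trans ?_
    gcongr
    have e3 : 0 ≤ L * √(D 2) / √μ * (τ 2 ^ 2 / μ) := by positivity
    have e4 : 0 ≤ L / μ := by positivity
    linarith
  have h7 : L * statLevel μ γ τ D (3 * p) ^ 3 = A₇ := by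
    have e1 : √(D (3 * p)) ^ 3 = D (3 * p) * √(D (3 * p)) := by
      rw [pow_succ, Real.sq_sqrt hD30]
    have e2 : √γ ^ 3 = γ * √γ := by rw [pow_succ, Real.sq_sqrt hγ.le]
    have e3 : √μ ^ 3 = μ * √μ := by rw [pow_succ, Real.sq_sqrt hμ.le]
    rw [hA₇, statLevel, rpow_three_half hD30, rpow_three_half hμ.le, rpow_three_half hγ.le,
      div_pow, mul_pow, mul_pow, e1, e2, e3]
    ring
  have hA8 : 0 ≤ A₈ := by rw [hA₈, const₈]; positivity
  have hA1 : 0 ≤ A₁ := by positivity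
  have hA2 : 0 ≤ A₂ := by positivity
  have hA3 : 0 ≤ A₃ := by rw [← h3]; positivity
  have hA4 : 0 ≤ A₄ := by positivity
  have hA5 : 0 ≤ A₅ := by positivity
  have hA6 : 0 ≤ A₆ := le_trans (by positivity) h6
  have hA7 : 0 ≤ A₇ := by positivity
  have hx : L * √p * (x₁ / (√μ * √γ * n)) ≤ L * p * x₁ / (√μ * √γ * n) := by
    rw [mul_div_assoc]
    gcongr
  have hx' : 0 ≤ L * p * x₁ / (√μ * √γ * n) := by positivity
  have hxb : 0 ≤ x₁ / (γ * n) := by positivity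
  have hxc : 0 ≤ L * x₃ ^ 3 / (γ * μ) := by positivity
  rw [hγμ, hmain, h1, h5, h7]
  have e : 3 * (2 * (x₁ + 2 * r₁) / (γ * n) +
        10 * L * √p * (x₁ / (√μ * √γ * n) + r₁ / √n)) =
      6 * (x₁ / (γ * n)) + 12 * (r₁ / (γ * n)) + 30 * (L * √p * (x₁ / (√μ * √γ * n))) +
        30 * (L * √p * (r₁ / √n)) := by ring
  rw [e, h3]
  linarith

end Collect

/-! ### The bound under a finite moment of order `3p`, and the theorem. -/

section Final

variable {d : ℕ} {Z : Type*} [MeasurableSpace Z] {Ω : Type*} [MeasurableSpace Ω]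
  {f : Vec d → ℝ} {g : Vec d → Z → Vec d} {ν : Measure Z} [IsProbabilityMeasure ν]
  {P : Measure Ω} [IsProbabilityMeasure P] {θ₀ : Ω → Vec d} {ξ : ℕ → Ω → Z}
  {θs : Vec d} {p μ L₁ L₂ L₃ L₄ L K γ : ℝ} {τ D : ℝ → ℝ} {n : ℕ}

/-- The bound when the initial condition has a finite moment of order `3p`. -/
theorem normMoment_rrEstimator_le [Nontrivial (Vec d)] (hp : 2 ≤ p)
    (hL : L = max (max L₁ L₂) (max L₃ L₄)) (hmin : IsMinOn f Set.univ θs)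
    (hc : StronglyConvex f μ) (hs : SmoothBounded f L₂ L₃ L₄)
    (hN : NoiseCondition f g ν L₁ (3 * p))
    (hτ : ∀ q ∈ ({2, p, 2 * p, 3 * p} : Set ℝ), NoiseMomentBound g ν θs q (τ q))
    (hM : ∀ q ∈ ({2, p, 2 * p, 3 * p} : Set ℝ), MomentCondition g ν θs μ L q (τ q) K (D q))
    (H : NoiseModel ν P θ₀ ξ) (hγ : 0 < γ) (hγK : 2 * γ ≤ 1 / (L * K)) (hn : 1 ≤ n)
    (hfin : eLpNorm (fun ω => θ₀ ω - θs) (ENNReal.ofReal (3 * p)) P ≠ ∞) :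
    normMoment P (fun ω => hessian f θs (rrEstimator g γ (θ₀ ω) (fun k => ξ k ω) n - θs))
        p (1 / p) ≤
      ENNReal.ofReal 4000 *
        (ENNReal.ofReal (mainTerms p μ L γ n τ D (noiseCov g ν θs).trace) +
          remainder₅ P (fun ω => θ₀ ω - θs) p μ L γ n) := by
  have hp0 : 0 < p := by linarith
  have hL1 : L₁ ≤ L := by rw [hL]; exact (le_max_left _ _).trans (le_max_left _ _)
  have hs' : SmoothBounded f L L L := hs.mono
    (by rw [hL]; exact (le_max_right _ _).trans (le_max_left _ _))
    (by rw [hL]; exact (le_max_left _ _).trans (le_max_right _ _))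
    (by rw [hL]; exact (le_max_right _ _).trans (le_max_right _ _))
  have m2 : (2 : ℝ) ∈ ({2, p, 2 * p, 3 * p} : Set ℝ) := by simp
  have mp : p ∈ ({2, p, 2 * p, 3 * p} : Set ℝ) := by simp
  have m2p : 2 * p ∈ ({2, p, 2 * p, 3 * p} : Set ℝ) := by simp
  have m3p : 3 * p ∈ ({2, p, 2 * p, 3 * p} : Set ℝ) := by simp
  have S := hN.sgdSetting hmin hc hs' hL1 (by linarith) (hτ 2 m2)
  set σ := √(∫ z, ‖g θs z‖ ^ 2 ∂ν) with hσdef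
  have hLp := S.pos
  have hμ := S.convex.pos
  have hgm := S.measurable_apply θs
  have hK := (hM 2 m2).two_le_K
  -- `K ≥ 2` puts the larger step `2γ` in the range of the one-step estimates.
  have hγL : 2 * γ * L ≤ 1 / 2 := by
    rw [le_div_iff₀ (by positivity)] at hγK
    nlinarith [mul_nonneg (mul_nonneg hγ.le hLp.le) (sub_nonneg.2 hK)]
  have hδ : 0 < γ * μ := by positivity
  have hγμ : 2 * γ * μ ≤ 1 / 2 := le_trans (by have := S.le; gcongr) hγL
  have h1δ : 0 < 1 - γ * μ := by linarith
  have hstep : ∀ h ∈ ({γ, 2 * γ} : Set ℝ), γ ≤ h ∧ h ≤ 2 * γ := by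
    intro h hh
    rcases hh with rfl | rfl
    · exact ⟨le_rfl, by linarith⟩
    · exact ⟨by linarith, le_rfl⟩
  have hστ : ∀ q ∈ ({2, p, 2 * p, 3 * p} : Set ℝ), 2 ≤ q → σ ^ 2 ≤ τ q ^ 2 := by
    intro q hq hq2
    rw [← S.var]
    exact ((hτ q hq).lpLe (by linarith) hgm).integral_sq_le hq2
  set r := statLevel μ γ τ D with hr
  have hrsq : ∀ q ∈ ({2, p, 2 * p, 3 * p} : Set ℝ), r q ^ 2 = D q * γ * τ q ^ 2 / μ :=
    fun q hq => statLevel_sq hμ hγ (le_trans zero_le_two (hM q hq).two_le_D)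
  have hr0 : ∀ q ∈ ({2, p, 2 * p, 3 * p} : Set ℝ), 0 ≤ r q := fun q hq => by
    have := (hτ q hq).nonneg
    rw [hr, statLevel]
    positivity
  have hσr : ∀ q ∈ ({2, p, 2 * p, 3 * p} : Set ℝ), 2 ≤ q → 2 * γ * σ ^ 2 ≤ μ * r q ^ 2 := by
    intro q hq hq2
    have h1 := (hM q hq).two_le_D
    rw [hrsq q hq, mul_div_cancel₀ _ hμ.ne']
    have := hστ q hq hq2
    gcongr
  have hm0 : AEStronglyMeasurable (fun ω => θ₀ ω - θs) P :=
    (H.meas₀.sub_const θs).aestronglyMeasurable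
  have hfin' : ∀ q, q ≤ 3 * p → eLpNorm (fun ω => θ₀ ω - θs) (ENNReal.ofReal q) P ≠ ∞ :=
    fun q hq => ne_top_of_le_ne_top hfin
      (eLpNorm_le_eLpNorm_of_exponent_le (ENNReal.ofReal_le_ofReal hq) hm0)
  set X : ℝ → ℝ := fun q =>
    (eLpNorm (fun ω => θ₀ ω - θs) (ENNReal.ofReal q) P).toReal with hX
  have hX0 : ∀ q, 0 ≤ X q := fun q => ENNReal.toReal_nonneg
  have hXe : ∀ q, q ≤ 3 * p →
      eLpNorm (fun ω => θ₀ ω - θs) (ENNReal.ofReal q) P = ENNReal.ofReal (X q) :=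
    fun q hq => (ENNReal.ofReal_toReal (hfin' q hq)).symm
  have hXl : ∀ q, q ≤ 3 * p → LpLe P q (fun ω => θ₀ ω - θs) (X q) := fun q hq =>
    ⟨hm0, hX0 q, (hXe q hq).le⟩
  have ha : ∀ q ∈ ({2, p, 2 * p, 3 * p} : Set ℝ), 2 ≤ q → q ≤ 3 * p →
      ∀ h ∈ ({γ, 2 * γ} : Set ℝ), ∀ k,
      LpLe P q (fun ω => chain g h θ₀ ξ k ω - θs) (level (γ * μ) (X q) (r q) k) := by
    intro q hq hq2 hq3 h hh k
    obtain ⟨h1, h2⟩ := hstep h hh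
    have h3 : h * μ ≤ 2 * γ * μ := by gcongr
    exact (hM q hq).lpLe_level H S.meas (by linarith) hμ hγ h1 h2 (by linarith) (h2.trans hγK)
      (hX0 q) (hXe q hq3) (hrsq q hq) k
  -- The window starts at time `n + 1`, and squared levels decay by `1 - γ μ` per step; `w` is the
  -- decay of the level itself.
  set w := (1 - γ * μ) ^ (((n : ℝ) + 1) / 2) with hw
  have hw0 : 0 < w := Real.rpow_pos_of_pos h1δ _
  have hw2 : w ^ 2 = (1 - γ * μ) ^ (n + 1) := by
    rw [hw, ← Real.rpow_natCast, ← Real.rpow_mul h1δ.le, ← Real.rpow_natCast]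
    congr 1
    push_cast
    ring
  have hxs : ∀ q, (w * X q) ^ 2 = (1 - γ * μ) ^ (n + 1) * X q ^ 2 := fun q => by
    rw [mul_pow, hw2]
  have hxn : ∀ q, 0 ≤ w * X q := fun q => mul_nonneg hw0.le (hX0 q)
  -- Moments of order `2p` are interpolated with weights `1 / 4` and `3 / 4`; the common factor `w`
  -- is consistent because both sides have degree four.
  have hinter : (w * X (2 * p)) ^ 4 ≤ w * X p * (w * X (3 * p)) ^ 3 := by
    have h1 := ((hXl p (by linarith)).interpolate hp0 (hXl (3 * p) le_rfl)).le
    rw [hXe (2 * p) (by linarith)] at h1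
    have h2 : 0 ≤ X p ^ (1 / 4 : ℝ) * X (3 * p) ^ (3 / 4 : ℝ) :=
      mul_nonneg (Real.rpow_nonneg (hX0 _) _) (Real.rpow_nonneg (hX0 _) _)
    have h3 : X (2 * p) ≤ X p ^ (1 / 4 : ℝ) * X (3 * p) ^ (3 / 4 : ℝ) :=
      (ENNReal.ofReal_le_ofReal_iff h2).1 h1
    have h4 : X (2 * p) ^ 4 ≤ X p * X (3 * p) ^ 3 := by
      calc X (2 * p) ^ 4 ≤ (X p ^ (1 / 4 : ℝ) * X (3 * p) ^ (3 / 4 : ℝ)) ^ 4 :=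
            pow_le_pow_left₀ (hX0 _) h3 4
        _ = X p * X (3 * p) ^ 3 := by
            rw [mul_pow, ← Real.rpow_natCast, ← Real.rpow_natCast, ← Real.rpow_mul (hX0 _),
              ← Real.rpow_mul (hX0 _), ← Real.rpow_natCast (X (3 * p)) 3]
            norm_num
    calc (w * X (2 * p)) ^ 4 = w ^ 4 * X (2 * p) ^ 4 := by ring
      _ ≤ w ^ 4 * (X p * X (3 * p) ^ 3) := by gcongr
      _ = _ := by ring
  have hB := lpLe_nonlinPart_extrapolation S H hp hγ hγL hn (hxs (2 * p)) (hxs (3 * p)) (hxn p)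
    (hxn (3 * p)) (hr0 _ m3p) hinter (hσr _ m2p (by linarith)) (hσr _ m3p (by linarith))
    (ha _ m2p (by linarith) (by linarith)) (ha _ m3p (by linarith) le_rfl)
  have hA := lpLe_hessian_rrEstimator_sub S H hp hγ hγL hn
    (fun y => hN.lpLe_sub hs' hL1 hp (by linarith) y θs) ((hτ p mp).lpLe hp0 hgm) (hxs p) (hxn p)
    (hr0 _ mp) (ha _ mp hp (by linarith)) hB
  have hcol := bound_le_mainTerms hp hμ S.le hγ hn (hστ 2 m2 le_rfl) S.nonneg (hM _ m2).two_le_D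
    (hM _ mp).two_le_D (hM _ m2p).two_le_D (hM _ m3p).two_le_D (hτ _ mp).nonneg (hτ _ m2p).nonneg
    (hτ _ m3p).nonneg (hxn p) (hxn (3 * p))
  have htr : (noiseCov g ν θs).trace = σ ^ 2 := by
    rw [trace_noiseCov S.integrable_var hgm, S.var]
  have hle := (hA.weaken hcol).le
  rw [normMoment_eq_eLpNorm_rpow hp0, ENNReal.rpow_one, htr]
  refine hle.trans ?_
  rw [ENNReal.ofReal_mul (by norm_num)]
  gcongr
  refine ENNReal.ofReal_add_le.trans ?_
  gcongr
  have hX3 : 0 ≤ w * X (3 * p) := hxn _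
  have hXp : 0 ≤ w * X p := hxn _
  refine (ENNReal.ofReal_add_le.trans (add_le_add ENNReal.ofReal_add_le le_rfl)).trans ?_
  rw [remainder₅, normMoment_eq_eLpNorm_rpow hp0, ENNReal.rpow_one, hXe p (by linarith),
    show normMoment P (fun ω => θ₀ ω - θs) (3 * p) (1 / p) = ENNReal.ofReal (X (3 * p) ^ 3) by
      have e : (1 : ℝ) / p = 3 / (3 * p) := by field_simp
      rw [e, normMoment_eq_eLpNorm_rpow (by positivity), hXe _ le_rfl,
        ENNReal.ofReal_rpow_of_nonneg (hX0 _) (by norm_num)]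
      norm_cast]
  rw [← ENNReal.ofReal_mul (by positivity), ← ENNReal.ofReal_mul (by positivity),
    ← ENNReal.ofReal_mul (by positivity)]
  -- The term of `remainder₅` with moments of order `2p` is slack, thanks to the interpolation.
  refine add_le_add (le_trans (add_le_add ?_ ?_) le_self_add) ?_
  · refine ENNReal.ofReal_le_ofReal (le_of_eq ?_)
    ring
  · refine ENNReal.ofReal_le_ofReal (le_of_eq ?_)
    ring
  · refine ENNReal.ofReal_le_ofReal ?_
    -- The exponent obtained is `3 (n + 1) / 2`; the base is below one, so it may be lowered to `3 n
    -- / 2`.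
    have hw3 : w ^ 3 ≤ (1 - γ * μ) ^ (3 / 2 * (n : ℝ)) := by
      rw [hw, ← Real.rpow_natCast, ← Real.rpow_mul h1δ.le]
      refine Real.rpow_le_rpow_of_exponent_ge h1δ (by linarith) ?_
      push_cast
      linarith
    have hX3' := hX0 (3 * p)
    calc L * (w * X (3 * p)) ^ 3 / (γ * μ) = L * w ^ 3 / (γ * μ) * X (3 * p) ^ 3 := by ring
      _ ≤ _ := by gcongr

end Final

end RichardsonRomberg

theorem mainTheorem1 :
    ∃ c₀ : ℝ, 0 < c₀ ∧
      ∀ (d : ℕ) (Z : Type*) [MeasurableSpace Z] (ν : Measure Z) [IsProbabilityMeasure ν]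
        (f : Vec d → ℝ) (g : Vec d → Z → Vec d) (θs : Vec d)
        (p μ L₁ L₂ L₃ L₄ L K : ℝ) (τ D : ℝ → ℝ),
        2 ≤ p →
        L = max (max L₁ L₂) (max L₃ L₄) →
        IsMinOn f Set.univ θs →
        StronglyConvex f μ →
        SmoothBounded f L₂ L₃ L₄ →
        NoiseCondition f g ν L₁ (3 * p) →
        (∀ q ∈ ({2, p, 2 * p, 3 * p} : Set ℝ), NoiseMomentBound g ν θs q (τ q)) →
        (∀ q ∈ ({2, p, 2 * p, 3 * p} : Set ℝ), MomentCondition g ν θs μ L q (τ q) K (D q)) →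
        ∀ (Ω : Type*) [MeasurableSpace Ω] (P : Measure Ω) [IsProbabilityMeasure P]
          (θ₀ : Ω → Vec d) (ξ : ℕ → Ω → Z),
          Measurable θ₀ →
          (∀ k, Measurable (ξ k)) →
          (∀ k, P.map (ξ k) = ν) →
          iIndepFun ξ P →
          IndepFun θ₀ (fun ω k => ξ k ω) P →
          ∀ (γ : ℝ) (n : ℕ), 0 < γ → 2 * γ ≤ 1 / (L * K) → 1 ≤ n →
            normMoment P
                (fun ω => hessian f θs (rrEstimator g γ (θ₀ ω) (fun k => ξ k ω) n - θs))
                p (1 / p) ≤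
              ENNReal.ofReal c₀ *
                (ENNReal.ofReal (mainTerms p μ L γ n τ D (noiseCov g ν θs).trace) +
                  remainder₅ P (fun ω => θ₀ ω - θs) p μ L γ n) := by
  refine ⟨4000, by norm_num, ?_⟩
  intro d Z _ ν _ f g θs p μ L₁ L₂ L₃ L₄ L K τ D hp hL hmin hc hs hN hτ hM Ω _ P _ θ₀ ξ hθ₀ hξ
    hlaw hind hind₀ γ n hγ hγK hn
  have hp0 : 0 < p := by linarith
  -- In dimension zero `μ ≤ L` may fail, but the left side vanishes.
  rcases Nat.eq_zero_or_pos d with rfl | hd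
  · have h0 : normMoment P
        (fun ω => hessian f θs (rrEstimator g γ (θ₀ ω) (fun k => ξ k ω) n - θs)) p (1 / p) = 0 := by
      have e : ∀ x : Vec 0, ‖x‖ₑ ^ p = 0 := fun x => by
        rw [Subsingleton.elim x 0, enorm_zero, ENNReal.zero_rpow_of_pos hp0]
      rw [normMoment]
      simp only [e, lintegral_zero]
      exact ENNReal.zero_rpow_of_pos (by positivity)
    rw [h0]
    exact zero_le
  have : Nonempty (Fin d) := ⟨⟨0, hd⟩⟩
  have H : NoiseModel ν P θ₀ ξ := ⟨hθ₀, hξ, hlaw, hind, hind₀⟩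
  -- If the moment of order `3p` is infinite so is the right side, because `γ μ < 1` makes the
  -- coefficient of that moment strictly positive.
  rcases eq_or_ne (eLpNorm (fun ω => θ₀ ω - θs) (ENNReal.ofReal (3 * p)) P) ∞ with h | h
  · have hL0 : 0 < L := hN.pos.trans_le (by
      rw [hL]; exact (le_max_left _ _).trans (le_max_left _ _))
    have hμ := hc.pos
    have hs' : SmoothBounded f L L L := hs.mono
      (by rw [hL]; exact (le_max_right _ _).trans (le_max_left _ _))
      (by rw [hL]; exact (le_max_left _ _).trans (le_max_right _ _))
      (by rw [hL]; exact (le_max_right _ _).trans (le_max_right _ _))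
    have hK := (hM 2 (by simp)).two_le_K
    have h1 : 0 < 1 - γ * μ := by
      rw [le_div_iff₀ (by positivity)] at hγK
      have h2 : γ * μ ≤ γ * L := by
        have := hc.le_of_smooth hs'
        gcongr
      nlinarith [mul_nonneg (mul_nonneg hγ.le hL0.le) (sub_nonneg.2 hK)]
    have h2 : normMoment P (fun ω => θ₀ ω - θs) (3 * p) (1 / p) = ∞ := by
      have e : (1 : ℝ) / p = 3 / (3 * p) := by field_simp
      rw [e, normMoment_eq_eLpNorm_rpow (by positivity), h]
      exact ENNReal.top_rpow_of_pos (by norm_num)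
    have h3 : remainder₅ P (fun ω => θ₀ ω - θs) p μ L γ n = ∞ := by
      have h4 : 0 < L * (1 - γ * μ) ^ (3 / 2 * (n : ℝ)) / (γ * μ) := by
        have := Real.rpow_pos_of_pos h1 (3 / 2 * (n : ℝ))
        positivity
      rw [remainder₅, h2, ENNReal.mul_top (ENNReal.ofReal_pos.2 h4).ne', add_top]
    rw [h3, add_top, ENNReal.mul_top (ENNReal.ofReal_pos.2 (by norm_num)).ne']
    exact le_top
  · exact normMoment_rrEstimator_le hp hL hmin hc hs hN hτ hM H hγ hγK hn h
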